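/- Let $V:\mathbb R^d\to\mathbb R$ be bounded below and have an analytic continuation (also denoted $V$) to the strip $D=\{z\in\mathbb C^d: |\mathrm{Im}\,z_j|<\delta,\ j=1,\dots,d\}$, $\delta>0$, with $|V(z)|\le M\exp(\tau|z|^2)$ for all $z\in D$, where $M,\tau>0$ and $|z|^2=\sum_j|z_j|^2$. **Wave packets.** Let $A,B$ be complex $d\times d$ matrices with $A^tB-B^tA=0$ and $A^*B+B^*A=2I$, let $a,\eta\in\mathbb R^d$ and $\hbar>0$. Put $$\varphi_0(A,B,\hbar,a,\eta,x)=(\pi\hbar)^{-d/4}(\det A)^{-1/2}\exp\Big\{-\frac{\langle x-a,BA^{-1}(x-a)\rangle}{2\hbar}+\frac{i\langle\eta,x-a\rangle}{\hbar}\Big\},$$ $$\mathcal A_m^*=\frac1{\sqrt{2\hbar}}\Big[\sum_{n=1}^d\overline{B}_{nm}(x_n-a_n)-i\sum_{n=1}^d\overline{A}_{nm}\Big(-i\hbar\frac{\partial}{\partial x_n}-\eta_n\Big)\Big],\qquad m=1,\dots,d,$$ and, for a multi-index $j\in\mathbb N^d$, $\varphi_j=(j!)^{-1/2}(\mathcal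 A_1^*)^{j_1}\cdots(\mathcal A_d^*)^{j_d}\varphi_0$. **Classical data.** Let $a(t),\eta(t),A(t),B(t),S(t)$, $t\in\mathbb R$, solve $$\dot a=\eta,\quad \dot\eta=-\nabla V(a),\quad \dot A=iB,\quad \dot B=iV^{(2)}(a)A,\quad \dot S=\tfrac12|\eta|^2-V(a),$$ where $V^{(2)}$ is the Hessian of $V$, with $S(0)=0$ and with $A(0),B(0)$ satisfying the two matrix conditions above. The square root $(\det A(t))^{1/2}$ is chosen continuously in $t$ (either of the two choices). Write $\varphi_j(t)=\varphi_j(A(t),B(t),\hbar,a(t),\eta(t),\cdot)$. Let $J\in\mathbb N$ and let $c_j\in\mathbb C$, $|j|\le J$, satisfy $\sum_{|j|\le J}|c_j|^2=1$. **Approximation.** For $l\ge1$ let $\widetilde J(l)=J+3l-3$ and $$Z_a^{[l]}(x)=\sum_{3\le|m|\le l+1}\frac{(D^mV)(a)}{m!}(x-a)^m,\qquad K_{kj}(l,t,\hbar)=\big\langle\varphi_k(t),\,Z^{[l]}_{a(t)}\varphi_j(t)\big\rangle_{L^2}.$$ Let $c_k(l,t,\hbar)$, $|k|\le\widetilde J(l)$,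 solve $i\hbar\,\dot c_k=\sum_{|j|\le\widetilde J(l)}K_{kj}(l,t,\hbar)\,c_j$ with $c_k(l,0,\hbar)=c_k$ for $|k|\le J$ and $c_k(l,0,\hbar)=0$ for $J<|k|\le\widetilde J(l)$, and set $$\psi_l(x,t,\hbar)=e^{iS(t)/\hbar}\sum_{|j|\le\widetilde J(l)}c_j(l,t,\hbar)\,\varphi_j(A(t),B(t),\hbar,a(t),\eta(t),x).$$ **Exact solution.** Let $H(\hbar)$ be the closure in $L^2(\mathbb R^d)$ of $-\frac{\hbar^2}2\Delta+V$ on $C_c^\infty(\mathbb R^d)$ (its unique self-adjoint realization). Let $\Psi(\cdot,t,\hbar)$ be the solution of $i\hbar\,\partial_t\Psi=H(\hbar)\Psi$ in $L^2(\mathbb R^d)$, $t\in\mathbb R$ (differentiable in $t$, with values in the domain of $H(\hbar)$), with $\Psi(\cdot,0,\hbar)=\sum_{|j|\le J}c_j\,\varphi_j(A(0),B(0),\hbar,a(0),\eta(0),\cdot)$; this initial state lies in the domain of $H(\hbar)$, so that $\Psi$ exists, for all sufficiently small $\hbar$. **Theorem.** For every $T>0$ there is $g^*>0$ such that for every $g\in(0,g^*)$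 there exist $C>0$ and $\gamma>0$ with the following property. For every $\hbar\in(0,g]$ for which the solution $\Psi$ exists, the approximation $\psi=\psi_{l(\hbar)}$ with $l(\hbar)=\lfloor g/\hbar\rfloor$ satisfies $$\|\psi(\cdot,t,\hbar)-\Psi(\cdot,t,\hbar)\|_{L^2(\mathbb R^d)}\le C\,e^{-\gamma/\hbar}\qquad\text{whenever } |t|\le T.$$ -/

import Mathlib

namespace Hagedorn

/-- Configuration space `ℝᵈ` with its Euclidean structure. -/
abbrev Space (d : ℕ) : Type := EuclideanSpace ℝ (Fin d)

/-- The Hilbert space `L²(ℝᵈ; ℂ)`. -/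
abbrev L2 (d : ℕ) : Type :=
  MeasureTheory.Lp ℂ 2 (MeasureTheory.volume : MeasureTheory.Measure (Space d))

/-! ### Multi-indices -/

/-- The finite set of multi-indices `j` with `|j| ≤ N`. -/
def multiIndices (d N : ℕ) : Finset (Fin d → ℕ) :=
  (Fintype.piFinset fun _ => Finset.range (N + 1)).filter fun j => ∑ i, j i ≤ N

/-- `j! = j₁! ⋯ j_d!`. -/
def multiFactorial {d : ℕ} (j : Fin d → ℕ) : ℕ := ∏ i, (j i).factorial

/-- `T₁^{j₁} T₂^{j₂} ⋯ T_d^{j_d} f`, for a `d`-tuple of operators `T₁, …, T_d`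
(the last one is applied first). -/
def multiIterate {d : ℕ} {X : Type*} (T : Fin d → X → X) (j : Fin d → ℕ) (f : X) : X :=
  (List.finRange d).foldr (fun n g => (T n)^[j n] g) f

/-- The partial derivative `∂f/∂xₙ`. -/
noncomputable def partialDeriv {d : ℕ} {F : Type*} [NormedAddCommGroup F] [NormedSpace ℝ F]
    (n : Fin d) (f : Space d → F) : Space d → F :=
  fun x => fderiv ℝ f x (EuclideanSpace.single n (1 : ℝ))

/-- `Dᵐ f`. -/
noncomputable def multiDeriv {d : ℕ} (m : Fin d → ℕ) (f : Space d → ℝ) : Space d → ℝ :=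
  multiIterate (fun n => partialDeriv n) m f

/-- The Hessian matrix of `V` at `x`. -/
noncomputable def hessian {d : ℕ} (V : Space d → ℝ) (x : Space d) :
    Matrix (Fin d) (Fin d) ℝ :=
  Matrix.of fun i j => partialDeriv i (partialDeriv j V) x

/-! ### Hypotheses on the potential and on the matrices -/

/-- The strip `{z ∈ ℂᵈ : |Im z_j| < δ for all j}`. -/
def strip (d : ℕ) (δ : ℝ) : Set (Fin d → ℂ) := {z | ∀ j, |(z j).im| < δ}

/-- `V` has an analytic continuation to the strip of width `δ`, which is bounded there by
`M exp(τ |z|²)`. -/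
def HasStripContinuation {d : ℕ} (V : Space d → ℝ) (δ M τ : ℝ) : Prop :=
  ∃ Vc : (Fin d → ℂ) → ℂ,
    AnalyticOnNhd ℂ Vc (strip d δ) ∧
    (∀ x : Space d, Vc (fun j => (x j : ℂ)) = (V x : ℂ)) ∧
    ∀ z ∈ strip d δ, ‖Vc z‖ ≤ M * Real.exp (τ * ∑ j, ‖z j‖ ^ 2)

/-- `Aᵗ B - Bᵗ A = 0` and `A* B + B* A = 2 I`. -/
def Admissible {d : ℕ} (A B : Matrix (Fin d) (Fin d) ℂ) : Prop :=
  A.transpose * B - B.transpose * A = 0 ∧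
    A.conjTranspose * B + B.conjTranspose * A = (2 : ℂ) • (1 : Matrix (Fin d) (Fin d) ℂ)

/-- The classical equations of motion for `a, η, A, B, S`, for all times, with `S(0) = 0`. -/
structure IsClassicalFlow {d : ℕ} (V : Space d → ℝ) (a η : ℝ → Space d)
    (A B : ℝ → Matrix (Fin d) (Fin d) ℂ) (S : ℝ → ℝ) : Prop where
  position : ∀ t, HasDerivAt a (η t) t
  momentum : ∀ t, HasDerivAt η (-gradient V (a t)) t
  matrixA : ∀ t i j, HasDerivAt (fun s => A s i j) (Complex.I * B t i j) t
  matrixB : ∀ t i j, HasDerivAt (fun s => B s i j)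
    (Complex.I * ((hessian V (a t)).map (fun r : ℝ => (r : ℂ)) * A t) i j) t
  action : ∀ t, HasDerivAt S (‖η t‖ ^ 2 / 2 - V (a t)) t
  action_zero : S 0 = 0

/-! ### Semiclassical wave packets -/

/-- The Gaussian wave packet `φ₀(A, B, ħ, a, η, ·)`. The argument `s` is the chosen square root
of `det A`. -/
noncomputable def gaussianPacket {d : ℕ} (A B : Matrix (Fin d) (Fin d) ℂ) (s : ℂ) (ħ : ℝ)
    (a η : Space d) (x : Space d) : ℂ :=
  let v : Fin d → ℂ := fun n => ((x n - a n : ℝ) : ℂ)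
  ((Real.pi ^ (-(d : ℝ) / 4) * ħ ^ (-(d : ℝ) / 4) : ℝ) : ℂ) * s⁻¹ *
    Complex.exp (-(v ⬝ᵥ (B * A⁻¹).mulVec v) / (2 * ħ) +
      Complex.I * ((∑ n, η n * (x n - a n) : ℝ) : ℂ) / ħ)

/-- The raising operator
`𝒜ₘ* = (2ħ)^{-1/2} [ ∑ₙ conj(Bₙₘ) (xₙ - aₙ) - i ∑ₙ conj(Aₙₘ) (-iħ ∂/∂xₙ - ηₙ) ]`. -/
noncomputable def raising {d : ℕ} (A B : Matrix (Fin d) (Fin d) ℂ) (ħ : ℝ) (a η : Space d)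
    (m : Fin d) (f : Space d → ℂ) : Space d → ℂ := fun x =>
  ((1 / Real.sqrt (2 * ħ) : ℝ) : ℂ) *
    (∑ n, star (B n m) * ((x n - a n : ℝ) : ℂ) * f x
      - Complex.I * ∑ n, star (A n m) *
          (-Complex.I * (ħ : ℂ) * partialDeriv n f x - ((η n : ℝ) : ℂ) * f x))

/-- The wave packet `φ_j = (j!)^{-1/2} (𝒜₁*)^{j₁} ⋯ (𝒜_d*)^{j_d} φ₀`. -/
noncomputable def wavePacket {d : ℕ} (A B : Matrix (Fin d) (Fin d) ℂ) (s : ℂ) (ħ : ℝ)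
    (a η : Space d) (j : Fin d → ℕ) : Space d → ℂ := fun x =>
  ((1 / Real.sqrt (multiFactorial j) : ℝ) : ℂ) *
    multiIterate (raising A B ħ a η) j (gaussianPacket A B s ħ a η) x

/-! ### The truncated approximation -/

/-- The Taylor polynomial `∑_{3 ≤ |m| ≤ l+1} (DᵐV)(a) (x - a)ᵐ / m!`. -/
noncomputable def taylorTail {d : ℕ} (V : Space d → ℝ) (l : ℕ) (a x : Space d) : ℝ :=
  ∑ m ∈ (multiIndices d (l + 1)).filter (fun m => 3 ≤ ∑ i, m i),
    multiDeriv m V a / (multiFactorial m : ℝ) * ∏ i, (x i - a i) ^ m i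

/-- The matrix element `⟨φ_k, Z^{[l]}_a φ_j⟩` (antilinear in the first factor). -/
noncomputable def couplingMatrix {d : ℕ} (V : Space d → ℝ) (l : ℕ)
    (A B : Matrix (Fin d) (Fin d) ℂ) (s : ℂ) (ħ : ℝ) (a η : Space d) (k j : Fin d → ℕ) : ℂ :=
  ∫ x : Space d, star (wavePacket A B s ħ a η k x) *
    ((taylorTail V l a x : ℂ) * wavePacket A B s ħ a η j x)

/-- The truncation level `J + 3 l - 3` (used for `l ≥ 1`). -/
def truncLevel (J l : ℕ) : ℕ := J + 3 * l - 3

/-- `c` solves `iħ ċ_k = ∑_{|j| ≤ J+3l-3} K_{kj}(t) c_j`, `|k| ≤ J+3l-3`, with initial values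
`c_k(0) = c⁰_k` for `|k| ≤ J` and `c_k(0) = 0` for the other `k`. -/
structure IsCoefficientSolution {d : ℕ} (V : Space d → ℝ) (J l : ℕ) (ħ : ℝ)
    (a η : ℝ → Space d) (A B : ℝ → Matrix (Fin d) (Fin d) ℂ) (s : ℝ → ℂ)
    (c₀ : (Fin d → ℕ) → ℂ) (c : ℝ → (Fin d → ℕ) → ℂ) : Prop where
  initial : ∀ k ∈ multiIndices d (truncLevel J l),
    c 0 k = if ∑ i, k i ≤ J then c₀ k else 0
  ode : ∀ t, ∀ k ∈ multiIndices d (truncLevel J l),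
    HasDerivAt (fun r => c r k)
      ((Complex.I * (ħ : ℂ))⁻¹ * ∑ j ∈ multiIndices d (truncLevel J l),
        couplingMatrix V l (A t) (B t) (s t) ħ (a t) (η t) k j * c t j) t

/-- `ψ_l(x, t, ħ) = e^{iS(t)/ħ} ∑_{|j| ≤ J+3l-3} c_j(t) φ_j(A(t), B(t), ħ, a(t), η(t), x)`. -/
noncomputable def approxSolution {d : ℕ} (J l : ℕ) (ħ : ℝ)
    (a η : ℝ → Space d) (A B : ℝ → Matrix (Fin d) (Fin d) ℂ) (S : ℝ → ℝ) (s : ℝ → ℂ)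
    (c : ℝ → (Fin d → ℕ) → ℂ) (t : ℝ) (x : Space d) : ℂ :=
  Complex.exp (Complex.I * (S t : ℂ) / (ħ : ℂ)) *
    ∑ j ∈ multiIndices d (truncLevel J l),
      c t j * wavePacket (A t) (B t) (s t) ħ (a t) (η t) j x

/-! ### The exact solution -/

/-- The graph of `-(ħ²/2) Δ + V` on `C_c^∞(ℝᵈ)`, inside `L² × L²`. -/
def hamiltonianCore {d : ℕ} (V : Space d → ℝ) (ħ : ℝ) : Set (L2 d × L2 d) :=
  {p | ∃ f : Space d → ℂ, ContDiff ℝ ((⊤ : ℕ∞) : WithTop ℕ∞) f ∧ HasCompactSupport f ∧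
    p.1 =ᵐ[MeasureTheory.volume] f ∧
    p.2 =ᵐ[MeasureTheory.volume]
      fun x => -((ħ ^ 2 / 2 : ℝ) : ℂ) * Laplacian.laplacian f x + (V x : ℂ) * f x}

/-- The graph of the Hamiltonian `H(ħ)`, the closure in `L²` of `-(ħ²/2) Δ + V` on
`C_c^∞(ℝᵈ)`; `(u, w)` lies in it iff `u` is in the domain of `H(ħ)` and `H(ħ) u = w`. For a
continuous `V` that is bounded below this closure is the unique self-adjoint realization. -/
def hamiltonianGraph {d : ℕ} (V : Space d → ℝ) (ħ : ℝ) : Set (L2 d × L2 d) :=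
  closure (hamiltonianCore V ħ)

/-- `Ψ` is a solution in `L²` of `iħ ∂Ψ/∂t = H(ħ) Ψ` for all times, with `Ψ(0) = Ψ₀`: for every
`t`, `Ψ` is differentiable at `t` in `L²`, `Ψ(t)` lies in the domain of `H(ħ)`, and the equation
holds. -/
structure IsSchrodingerSolution {d : ℕ} (V : Space d → ℝ) (ħ : ℝ) (Ψ₀ : Space d → ℂ)
    (Ψ : ℝ → L2 d) : Prop where
  initial : Ψ 0 =ᵐ[MeasureTheory.volume] Ψ₀
  equation : ∀ t, ∃ Ψ' : L2 d, HasDerivAt Ψ Ψ' t ∧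
    (Ψ t, (Complex.I * (ħ : ℂ)) • Ψ') ∈ hamiltonianGraph V ħ

end Hagedorn

/-!
A wave packet is a polynomial times a Gaussian, `polyPacket A B s ħ a η p`, and `φ_j` corresponds to
the polynomial `hermitePoly A ħ j` obtained from `1` by the operators `raiseOp`. The whole argument
is carried out on these polynomials. The ladder operators are first-order operators with the
canonical commutators (`lowerOp_raiseOp`); together with integration by parts this makes the `φ_j`
orthonormal (`integral_hermitePoly`), and every polynomial is a combination of Hermite polynomials.
The generator of the quadratic part of the Hamiltonian commutes with the time-dependent raising
operators (`evolGen_firstOrder`), so that `e^{iS/ħ} φ_j(t)` solves the Schrödinger equation with the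
potential replaced by its second-order Taylor polynomial (`IsClassicalFlow.hasDerivAt_packet`).

What remains of the potential is treated in the weighted `ℓ¹` norm `∑ θ^{|j|} |c_j|` of the Hermite
coefficients (`HasSize`). There multiplication by a coordinate costs a constant times
`√(ħ · degree)` (`HasSize.X_mul`). All degrees in question are at most `J + 4l ≤ J + 4g/ħ`, so a
coordinate costs `ρ r` with `ρ` of order `√g`, where `r` is a radius on which the Cauchy estimates
give `|D^m V(a)| / m! ≤ C_V r^{-|m|}`. As `Z` starts at order three, its norm for `θ = 2` is
`Ω = O(ρ³)`, which is `g · O(√g)` (`HasSize.tailPoly_mul`). Hence for small `g` the coefficients grow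
at most by the factor `e^{Ω T / ħ} ≤ e^{g/(4ħ)}` (`IsCoefficientSolution.weight_le`).

The residual of `ψ_l` in the Schrödinger equation (`norm_residual_le`) has two parts. The first is
the component of `Zψ` above the truncation level; since it involves only indices with
`|j| > J + 3l - 3`, the weight `2^{|j|}` makes it `O(2^{-l})` times the weighted norm. The second is
`(V - Taylor polynomial) ψ`. By the Cauchy estimates near `a`, and by the bound
`|V(x)| ≤ M e^{τ|x|²}` away from it, the Taylor remainder is at most
`(2^{-l} + e^{-c/ħ}) e^{ν|x-a|²/ħ}` up to a constant; multiplication by `e^{ν|x-a|²/ħ}` is bounded in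
terms of the `HasSize` norm when `ν` is small, as one sees by expanding the exponential
(`HasSize.expSeries_mul`). With `l = ⌊g/ħ⌋` one has `2^{-l} ≤ 2 e^{-g/(2ħ)}`, which beats the growth
of the coefficients.

Finally `H(ħ)`, being the closure of a symmetric operator, is symmetric, and wave packets lie in its
domain; so the distance between `ψ` and `Ψ` is controlled by the residual through Grönwall's
inequality (`norm_sub_sq_le_of_residual`, `norm_approx_sub_le`).
-/

namespace Hagedorn

open Matrix
open scoped ComplexOrder

/-! ### Algebra of admissible matrix pairs -/

section Admissible

variable {d : ℕ} {A B : Matrix (Fin d) (Fin d) ℂ}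

theorem Admissible.transpose_mul_eq (h : Admissible A B) : Aᵀ * B = Bᵀ * A :=
  sub_eq_zero.mp h.1

/-- `Av = 0` gives `2⟨v, v⟩ = ⟨Av, Bv⟩ + ⟨Bv, Av⟩ = 0`. -/
theorem Admissible.det_ne_zero (h : Admissible A B) : A.det ≠ 0 := by
  intro hdet
  obtain ⟨v, hv, hAv⟩ := Matrix.exists_mulVec_eq_zero_iff.mpr hdet
  have h1 : star v ⬝ᵥ ((A.conjTranspose * B + B.conjTranspose * A) *ᵥ v) = 0 := by
    rw [Matrix.add_mulVec, dotProduct_add, ← Matrix.mulVec_mulVec, ← Matrix.mulVec_mulVec, hAv,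
      Matrix.mulVec_zero, dotProduct_zero, add_zero, Matrix.dotProduct_mulVec,
      ← Matrix.star_mulVec, hAv, star_zero, zero_dotProduct]
  rw [h.2, Matrix.smul_mulVec, Matrix.one_mulVec, dotProduct_smul, smul_eq_mul,
    mul_eq_zero] at h1
  exact hv (dotProduct_star_self_eq_zero.mp (h1.resolve_left two_ne_zero))

theorem Admissible.isUnit_det (h : Admissible A B) : IsUnit A.det :=
  isUnit_iff_ne_zero.mpr h.det_ne_zero

theorem Admissible.mul_inv (h : Admissible A B) : A * A⁻¹ = 1 :=
  Matrix.mul_nonsing_inv A h.isUnit_det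

theorem Admissible.inv_mul (h : Admissible A B) : A⁻¹ * A = 1 :=
  Matrix.nonsing_inv_mul A h.isUnit_det

/-- `BA⁻¹` is symmetric. -/
theorem Admissible.symm (h : Admissible A B) : (B * A⁻¹)ᵀ = B * A⁻¹ := by
  have h1 : (A⁻¹)ᵀ * Aᵀ = 1 := by rw [← Matrix.transpose_mul, h.mul_inv, transpose_one]
  calc (B * A⁻¹)ᵀ = (A⁻¹)ᵀ * Bᵀ * (A * A⁻¹) := by
        rw [h.mul_inv, Matrix.mul_one, Matrix.transpose_mul]
    _ = (A⁻¹)ᵀ * (Bᵀ * A) * A⁻¹ := by simp only [Matrix.mul_assoc]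
    _ = ((A⁻¹)ᵀ * Aᵀ) * B * A⁻¹ := by rw [← h.transpose_mul_eq]; simp only [Matrix.mul_assoc]
    _ = B * A⁻¹ := by rw [h1, Matrix.one_mul]

theorem Admissible.conj_inv_mul (h : Admissible A B) : (A⁻¹)ᴴ * Aᴴ = 1 := by
  rw [← Matrix.conjTranspose_mul, h.mul_inv, conjTranspose_one]

theorem Admissible.conj_mul_inv (h : Admissible A B) : Aᴴ * (A⁻¹)ᴴ = 1 := by
  rw [← Matrix.conjTranspose_mul, h.inv_mul, conjTranspose_one]

/-- `BA⁻¹ + (BA⁻¹)* = 2 (AA*)⁻¹`. -/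
theorem Admissible.add_conjTranspose (h : Admissible A B) :
    B * A⁻¹ + (B * A⁻¹)ᴴ = (2 : ℂ) • ((A⁻¹)ᴴ * A⁻¹) := by
  calc B * A⁻¹ + (B * A⁻¹)ᴴ = ((A⁻¹)ᴴ * Aᴴ) * (B * A⁻¹) + (A⁻¹)ᴴ * Bᴴ * (A * A⁻¹) := by
        rw [h.conj_inv_mul, h.mul_inv, Matrix.one_mul, Matrix.mul_one, conjTranspose_mul]
    _ = (A⁻¹)ᴴ * (Aᴴ * B + Bᴴ * A) * A⁻¹ := by
        simp only [Matrix.mul_add, Matrix.add_mul, Matrix.mul_assoc]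
    _ = _ := by rw [h.2]; simp

/-- `(AA*)⁻¹` is a symmetric (hence real) matrix. -/
theorem Admissible.gram_transpose (h : Admissible A B) :
    ((A⁻¹)ᴴ * A⁻¹)ᵀ = (A⁻¹)ᴴ * A⁻¹ := by
  have h1 := h.add_conjTranspose
  have h2 : (B * A⁻¹ + (B * A⁻¹)ᴴ)ᵀ = B * A⁻¹ + (B * A⁻¹)ᴴ := by
    rw [transpose_add, h.symm, ← conjTranspose_transpose_eq_transpose_conjTranspose, h.symm]
  rw [h1, transpose_smul] at h2
  exact smul_right_injective _ (two_ne_zero (α := ℂ)) h2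

/-- `AA*` is a symmetric (hence real) matrix. -/
theorem Admissible.mul_conjTranspose_transpose (h : Admissible A B) :
    (A * Aᴴ)ᵀ = A * Aᴴ := by
  have h1 : (A * Aᴴ) * ((A⁻¹)ᴴ * A⁻¹) = 1 := by
    calc (A * Aᴴ) * ((A⁻¹)ᴴ * A⁻¹) = A * (Aᴴ * (A⁻¹)ᴴ) * A⁻¹ := by
          simp only [Matrix.mul_assoc]
      _ = 1 := by rw [h.conj_mul_inv, Matrix.mul_one, h.mul_inv]
  have h2 : ((A⁻¹)ᴴ * A⁻¹) * (A * Aᴴ)ᵀ = 1 := by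
    rw [← h.gram_transpose, ← transpose_mul, h1, transpose_one]
  calc (A * Aᴴ)ᵀ = ((A * Aᴴ) * ((A⁻¹)ᴴ * A⁻¹)) * (A * Aᴴ)ᵀ := by rw [h1, Matrix.one_mul]
    _ = A * Aᴴ := by rw [Matrix.mul_assoc, h2, Matrix.mul_one]

theorem Admissible.conj_mul_symm_add (h : Admissible A B) :
    Aᴴ * (B * A⁻¹) + Bᴴ = (2 : ℂ) • A⁻¹ := by
  calc Aᴴ * (B * A⁻¹) + Bᴴ = (Aᴴ * B + Bᴴ * A) * A⁻¹ := by
        rw [Matrix.add_mul, Matrix.mul_assoc, Matrix.mul_assoc, h.mul_inv, Matrix.mul_one]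
    _ = _ := by rw [h.2]; simp

theorem Admissible.symm_mul_conj_add (h : Admissible A B) :
    (B * A⁻¹) * Aᴴᵀ + Bᴴᵀ = (2 : ℂ) • (A⁻¹)ᵀ := by
  have := congrArg Matrix.transpose h.conj_mul_symm_add
  rwa [transpose_add, transpose_mul, h.symm, transpose_smul] at this

/-- The matrix `A⁻¹ Ā` that controls the commutators of the raising operators is symmetric. -/
theorem Admissible.inv_mul_conj_symm (h : Admissible A B) : (A⁻¹ * Aᴴᵀ)ᵀ = A⁻¹ * Aᴴᵀ := by
  have h1 := h.mul_conjTranspose_transpose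
  rw [transpose_mul] at h1
  have h2 : Aᵀ * (A⁻¹)ᵀ = 1 := by rw [← transpose_mul, h.inv_mul, transpose_one]
  calc (A⁻¹ * Aᴴᵀ)ᵀ = (A⁻¹ * A) * Aᴴ * (A⁻¹)ᵀ := by
        rw [h.inv_mul, Matrix.one_mul, transpose_mul, transpose_transpose]
    _ = A⁻¹ * (A * Aᴴ) * (A⁻¹)ᵀ := by simp only [Matrix.mul_assoc]
    _ = A⁻¹ * Aᴴᵀ * (Aᵀ * (A⁻¹)ᵀ) := by rw [← h1]; simp only [Matrix.mul_assoc]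
    _ = A⁻¹ * Aᴴᵀ := by rw [h2, Matrix.mul_one]

/-- For a real vector `y`, the real part of `⟨y, BA⁻¹ y⟩` is `|A⁻¹ y|²`. -/
theorem Admissible.re_quadForm (h : Admissible A B) (y : Fin d → ℂ) (hy : star y = y) :
    (y ⬝ᵥ (B * A⁻¹) *ᵥ y).re = ∑ n, ‖(A⁻¹ *ᵥ y) n‖ ^ 2 := by
  have h1 : y ⬝ᵥ (B * A⁻¹) *ᵥ y + star (y ⬝ᵥ (B * A⁻¹) *ᵥ y)
      = 2 * (star (A⁻¹ *ᵥ y) ⬝ᵥ (A⁻¹ *ᵥ y)) := by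
    have h2 : star (y ⬝ᵥ (B * A⁻¹) *ᵥ y) = y ⬝ᵥ (B * A⁻¹)ᴴ *ᵥ y := by
      rw [← star_dotProduct_star, star_mulVec, hy, dotProduct_mulVec]
    rw [h2, ← dotProduct_add, ← add_mulVec, h.add_conjTranspose, smul_mulVec, dotProduct_smul,
      smul_eq_mul, ← mulVec_mulVec, dotProduct_mulVec, star_mulVec, hy]
  have h3 := congrArg Complex.re h1
  have h4 : (star (A⁻¹ *ᵥ y) ⬝ᵥ (A⁻¹ *ᵥ y)) = ((∑ n, ‖(A⁻¹ *ᵥ y) n‖ ^ 2 : ℝ) : ℂ) := by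
    simp only [dotProduct, Pi.star_apply, Complex.ofReal_sum]
    refine Finset.sum_congr rfl fun n _ => ?_
    rw [Complex.star_def, ← Complex.normSq_eq_conj_mul_self, Complex.normSq_eq_norm_sq]
  rw [h4] at h3
  simp only [Complex.add_re, Complex.star_def, Complex.conj_re, Complex.mul_re,
    Complex.ofReal_re, Complex.ofReal_im, Complex.re_ofNat, Complex.im_ofNat] at h3
  linarith

end Admissible

/-! ### Multi-indices and iterated operators -/

section MultiIndex

variable {d : ℕ}

theorem multiIndex_induction {P : (Fin d → ℕ) → Prop} (h0 : P 0)
    (hs : ∀ j m, P j → P (j + Pi.single m 1)) (j : Fin d → ℕ) : P j := by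
  induction hn : ∑ i, j i generalizing j with
  | zero =>
    have : j = 0 := by
      funext i
      exact (Finset.sum_eq_zero_iff.mp hn) i (Finset.mem_univ i)
    exact this ▸ h0
  | succ n ih =>
    obtain ⟨m, -, hm⟩ : ∃ m ∈ Finset.univ, j m ≠ 0 := by
      by_contra hcon
      push Not at hcon
      rw [Finset.sum_eq_zero hcon] at hn
      omega
    have hj : j = (j - Pi.single m 1) + Pi.single m 1 := by
      funext i
      by_cases hi : i = m
      · subst hi; simp; omega
      · simp [Pi.single_eq_of_ne hi]
    rw [hj]
    refine hs _ m (ih _ ?_)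
    have : ∑ i, j i = ∑ i, (j - Pi.single m 1 : Fin d → ℕ) i + 1 := by
      conv_lhs => rw [hj]
      simp [Finset.sum_add_distrib]
    omega

theorem sum_add_single (j : Fin d → ℕ) (m : Fin d) :
    ∑ i, (j + Pi.single m 1 : Fin d → ℕ) i = ∑ i, j i + 1 := by
  simp [Finset.sum_add_distrib]

theorem mem_multiIndices {N : ℕ} {j : Fin d → ℕ} : j ∈ multiIndices d N ↔ ∑ i, j i ≤ N := by
  simp only [multiIndices, Finset.mem_filter, Fintype.mem_piFinset, Finset.mem_range,
    and_iff_right_iff_imp]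
  intro h i
  exact Nat.lt_succ_of_le ((Finset.single_le_sum (f := j) (fun _ _ => Nat.zero_le _)
    (Finset.mem_univ i)).trans h)

theorem multiFactorial_pos (j : Fin d → ℕ) : 0 < multiFactorial j :=
  Finset.prod_pos fun _ _ => Nat.factorial_pos _

theorem multiFactorial_add_single (j : Fin d → ℕ) (m : Fin d) :
    multiFactorial (j + Pi.single m 1) = (j m + 1) * multiFactorial j := by
  unfold multiFactorial
  rw [← Finset.mul_prod_erase _ _ (Finset.mem_univ m),
    ← Finset.mul_prod_erase _ (fun i => (j i).factorial) (Finset.mem_univ m), ← mul_assoc]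
  congr 1
  · simp [Nat.factorial_succ]
  · refine Finset.prod_congr rfl fun i hi => ?_
    simp [Pi.single_eq_of_ne (Finset.ne_of_mem_erase hi)]

@[simp]
theorem multiIterate_zero {X : Type*} (T : Fin d → X → X) (f : X) : multiIterate T 0 f = f := by
  unfold multiIterate
  induction List.finRange d with
  | nil => rfl
  | cons n l ih => simp

theorem multiIterate_add_single {X : Type*} {T : Fin d → X → X}
    (hT : ∀ m n x, T m (T n x) = T n (T m x)) (j : Fin d → ℕ) (m : Fin d) (f : X) :
    multiIterate T (j + Pi.single m 1) f = T m (multiIterate T j f) := by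
  have hcomm : ∀ n k x, T m ((T n)^[k] x) = (T n)^[k] (T m x) := fun n k x =>
    (Function.Commute.iterate_right (f := T m) (g := T n) (fun y => hT m n y) k) x
  have h1 : ∀ l : List (Fin d), m ∉ l →
      l.foldr (fun n g => (T n)^[(j + Pi.single m 1 : Fin d → ℕ) n] g) f
        = l.foldr (fun n g => (T n)^[j n] g) f := by
    intro l
    induction l with
    | nil => intro _; rfl
    | cons n l ih =>
      intro hm
      rw [List.mem_cons, not_or] at hm
      rw [List.foldr_cons, List.foldr_cons, ih hm.2]
      simp [Pi.single_eq_of_ne (Ne.symm hm.1)]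
  have h2 : ∀ l : List (Fin d), l.Nodup → m ∈ l →
      l.foldr (fun n g => (T n)^[(j + Pi.single m 1 : Fin d → ℕ) n] g) f
        = T m (l.foldr (fun n g => (T n)^[j n] g) f) := by
    intro l
    induction l with
    | nil => intro _ h; simp at h
    | cons n l ih =>
      intro hl hm
      rw [List.nodup_cons] at hl
      rw [List.foldr_cons, List.foldr_cons]
      by_cases hnm : m = n
      · subst hnm
        rw [h1 l hl.1]
        simp [Function.iterate_succ_apply']
      · rw [ih hl.2 ((List.mem_cons.mp hm).resolve_left hnm), hcomm]
        simp [Pi.single_eq_of_ne (Ne.symm hnm)]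
  exact h2 _ (List.nodup_finRange d) (List.mem_finRange m)

end MultiIndex

/-! ### First-order differential operators on polynomials -/

/-- Complex polynomials in `d` variables; the variables stand for the components of `x - a`. -/
abbrev Poly (d : ℕ) : Type := MvPolynomial (Fin d) ℂ

section Operators

open MvPolynomial

variable {d : ℕ}

/-- The linear form `∑ uₙ Xₙ`. -/
noncomputable def linForm (u : Fin d → ℂ) : Poly d := ∑ n, u n • X n

/-- The constant-coefficient vector field `∑ vₙ ∂ₙ`. -/
noncomputable def dirDeriv (v : Fin d → ℂ) : Derivation ℂ (Poly d) (Poly d) :=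
  mkDerivation ℂ fun n => C (v n)

/-- The first-order operator `p ↦ (∑ uₙ Xₙ) p + ∑ vₙ ∂ₙ p`. -/
noncomputable def firstOrder (u v : Fin d → ℂ) : Poly d →ₗ[ℂ] Poly d :=
  LinearMap.mulLeft ℂ (linForm u) + (dirDeriv v : Poly d →ₗ[ℂ] Poly d)

theorem firstOrder_apply (u v : Fin d → ℂ) (p : Poly d) :
    firstOrder u v p = linForm u * p + dirDeriv v p := rfl

theorem derivation_sum_apply {ι : Type*} (s : Finset ι)
    (D : ι → Derivation ℂ (Poly d) (Poly d)) (p : Poly d) : (∑ i ∈ s, D i) p = ∑ i ∈ s, D i p := by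
  classical
  induction s using Finset.induction_on with
  | empty => simp
  | insert i s hi ih => rw [Finset.sum_insert hi, Finset.sum_insert hi, Derivation.add_apply, ih]

theorem dirDeriv_X (v : Fin d → ℂ) (n : Fin d) : dirDeriv v (X n) = C (v n) :=
  mkDerivation_X _ _ _

theorem dirDeriv_linForm (v u : Fin d → ℂ) : dirDeriv v (linForm u) = C (v ⬝ᵥ u) := by
  rw [linForm, map_sum, dotProduct, map_sum]
  refine Finset.sum_congr rfl fun n _ => ?_
  rw [Derivation.map_smul, dirDeriv_X, smul_eq_C_mul, ← C_mul, mul_comm]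

theorem dirDeriv_C (v : Fin d → ℂ) (c : ℂ) : dirDeriv v (C c) = 0 :=
  (dirDeriv v).map_algebraMap c

theorem dirDeriv_comm (v w : Fin d → ℂ) (p : Poly d) :
    dirDeriv v (dirDeriv w p) = dirDeriv w (dirDeriv v p) := by
  have h : ⁅dirDeriv v, dirDeriv w⁆ = 0 := by
    refine MvPolynomial.derivation_ext fun n => ?_
    simp [Derivation.commutator_apply, dirDeriv_X]
  have := congrArg (fun D : Derivation ℂ (Poly d) (Poly d) => D p) h
  simpa [Derivation.commutator_apply, sub_eq_zero] using this

theorem pderiv_eq_dirDeriv (n : Fin d) : (pderiv n : Derivation ℂ (Poly d) (Poly d))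
    = dirDeriv (Pi.single n 1) := by
  refine MvPolynomial.derivation_ext fun k => ?_
  rw [dirDeriv_X, pderiv_X]
  by_cases h : k = n
  · subst h; simp
  · simp [Pi.single_eq_of_ne h]

theorem dirDeriv_eq_sum (v : Fin d → ℂ) (p : Poly d) :
    dirDeriv v p = ∑ n, v n • pderiv n p := by
  have h : dirDeriv v = ∑ n, v n • (pderiv n : Derivation ℂ (Poly d) (Poly d)) := by
    refine MvPolynomial.derivation_ext fun k => ?_
    rw [derivation_sum_apply, dirDeriv_X, Finset.sum_eq_single k]
    · rw [Derivation.smul_apply, pderiv_X_self, smul_eq_C_mul, mul_one]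
    · intro n _ hn; rw [Derivation.smul_apply, pderiv_X_of_ne hn.symm, smul_zero]
    · simp
  rw [h, derivation_sum_apply]
  rfl

/-- The commutator of two first-order operators is the scalar given by the symplectic form. -/
theorem firstOrder_commutator (u v u' v' : Fin d → ℂ) (p : Poly d) :
    firstOrder u v (firstOrder u' v' p)
      = firstOrder u' v' (firstOrder u v p) + (v ⬝ᵥ u' - v' ⬝ᵥ u) • p := by
  simp only [firstOrder_apply, map_add, Derivation.leibniz, dirDeriv_linForm, smul_eq_mul,
    dirDeriv_comm v v', smul_eq_C_mul, C_sub]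
  ring

theorem linForm_smul (c : ℂ) (u : Fin d → ℂ) : linForm (c • u) = c • linForm u := by
  simp [linForm, Finset.smul_sum, mul_smul]

theorem dirDeriv_add (u v : Fin d → ℂ) (p : Poly d) :
    dirDeriv (u + v) p = dirDeriv u p + dirDeriv v p := by
  simp [dirDeriv_eq_sum, add_smul, Finset.sum_add_distrib]

theorem dirDeriv_smul (c : ℂ) (u : Fin d → ℂ) (p : Poly d) :
    dirDeriv (c • u) p = c • dirDeriv u p := by
  simp [dirDeriv_eq_sum, Finset.smul_sum, mul_smul]

/-- The transport operator `p ↦ ∑ₖ (ΓX)ₖ ∂ₖ p` of the linear vector field `y ↦ Γ y`. -/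
noncomputable def transport (Γ : Matrix (Fin d) (Fin d) ℂ) : Derivation ℂ (Poly d) (Poly d) :=
  mkDerivation ℂ fun k => linForm (Γ k)

theorem transport_linForm (Γ : Matrix (Fin d) (Fin d) ℂ) (u : Fin d → ℂ) :
    transport Γ (linForm u) = linForm (u ᵥ* Γ) := by
  have h : ∀ k, transport Γ (u k • X k) = ∑ n, (u k * Γ k n) • X n := by
    intro k
    rw [Derivation.map_smul, transport, mkDerivation_X, linForm, Finset.smul_sum]
    simp only [smul_smul]
  rw [linForm, map_sum, Finset.sum_congr rfl fun k _ => h k, Finset.sum_comm]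
  simp only [linForm, vecMul, dotProduct, Finset.sum_smul]

theorem transport_C (Γ : Matrix (Fin d) (Fin d) ℂ) (c : ℂ) : transport Γ (C c) = 0 :=
  (transport Γ).map_algebraMap c

theorem transport_dirDeriv (Γ : Matrix (Fin d) (Fin d) ℂ) (v : Fin d → ℂ) (p : Poly d) :
    transport Γ (dirDeriv v p) = dirDeriv v (transport Γ p) - dirDeriv (Γ *ᵥ v) p := by
  have h : ⁅transport Γ, dirDeriv v⁆ = - dirDeriv (Γ *ᵥ v) := by
    refine MvPolynomial.derivation_ext fun n => ?_
    rw [Derivation.commutator_apply, dirDeriv_X, transport_C, Derivation.coe_neg, Pi.neg_apply,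
      dirDeriv_X, transport, mkDerivation_X, dirDeriv_linForm, zero_sub, mulVec, dotProduct_comm]
  have := congrArg (fun D : Derivation ℂ (Poly d) (Poly d) => D p) h
  simp only [Derivation.commutator_apply, Derivation.coe_neg, Pi.neg_apply] at this
  rw [sub_eq_iff_eq_add] at this
  rw [this]; ring

theorem transport_eq_sum (Γ : Matrix (Fin d) (Fin d) ℂ) (p : Poly d) :
    transport Γ p = ∑ k, linForm (Γ k) * pderiv k p := by
  have h : transport Γ = ∑ n, linForm (Γ n) • (pderiv n : Derivation ℂ (Poly d) (Poly d)) := by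
    refine MvPolynomial.derivation_ext fun k => ?_
    rw [derivation_sum_apply, transport, mkDerivation_X, Finset.sum_eq_single k]
    · rw [Derivation.smul_apply, pderiv_X_self, smul_eq_mul, mul_one]
    · intro n _ hn; rw [Derivation.smul_apply, pderiv_X_of_ne hn.symm, smul_zero]
    · simp
  rw [h, derivation_sum_apply]
  rfl

/-- The Laplacian on polynomials. -/
noncomputable def polyLaplacian : Poly d →ₗ[ℂ] Poly d :=
  ∑ n, (pderiv n : Derivation ℂ (Poly d) (Poly d)).toLinearMap ∘ₗ
    (pderiv n : Derivation ℂ (Poly d) (Poly d)).toLinearMap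

theorem polyLaplacian_apply (p : Poly d) : polyLaplacian p = ∑ n, pderiv n (pderiv n p) := by
  simp [polyLaplacian]

theorem polyLaplacian_firstOrder (u v : Fin d → ℂ) (p : Poly d) :
    polyLaplacian (firstOrder u v p)
      = firstOrder u v (polyLaplacian p) + (2 : ℂ) • dirDeriv u p := by
  have h : ∀ n, pderiv n (pderiv n (firstOrder u v p))
      = firstOrder u v (pderiv n (pderiv n p)) + (2 : ℂ) • (u n • pderiv n p) := by
    intro n
    simp only [pderiv_eq_dirDeriv, firstOrder_apply, map_add, Derivation.leibniz,
      dirDeriv_linForm, smul_eq_mul, dirDeriv_comm _ v, single_dotProduct, one_mul, dirDeriv_C,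
      mul_zero, smul_eq_C_mul, map_ofNat]
    ring
  simp only [polyLaplacian_apply, h, Finset.sum_add_distrib, ← Finset.smul_sum, dirDeriv_eq_sum,
    map_sum]

/-- The generator of the evolution of the polynomial factor of a wave packet:
`(iħ/2) Δ p - i ∑ₖ (ΓX)ₖ ∂ₖ p`. -/
noncomputable def evolGen (ħ : ℝ) (Γ : Matrix (Fin d) (Fin d) ℂ) : Poly d →ₗ[ℂ] Poly d :=
  (Complex.I * ħ / 2) • polyLaplacian - Complex.I • (transport Γ).toLinearMap

theorem evolGen_apply (ħ : ℝ) (Γ : Matrix (Fin d) (Fin d) ℂ) (p : Poly d) :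
    evolGen ħ Γ p = (Complex.I * ħ / 2) • polyLaplacian p - Complex.I • transport Γ p := rfl

/-- The generator of the polynomial evolution is quadratic in position and derivative, so its
commutator with a first-order operator is again of first order. -/
theorem evolGen_firstOrder (ħ : ℝ) (Γ : Matrix (Fin d) (Fin d) ℂ) (u v : Fin d → ℂ) (p : Poly d) :
    evolGen ħ Γ (firstOrder u v p) = firstOrder u v (evolGen ħ Γ p)
      + firstOrder (-Complex.I • (u ᵥ* Γ)) ((Complex.I * ħ) • u + Complex.I • (Γ *ᵥ v)) p := by
  have h : transport Γ (firstOrder u v p) = firstOrder u v (transport Γ p)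
      + (linForm (u ᵥ* Γ) * p - dirDeriv (Γ *ᵥ v) p) := by
    simp only [firstOrder_apply, map_add, Derivation.leibniz, transport_linForm, smul_eq_mul,
      transport_dirDeriv]
    ring
  simp only [evolGen_apply, polyLaplacian_firstOrder, h, map_sub, map_smul]
  simp only [firstOrder_apply, linForm_smul, dirDeriv_add, dirDeriv_smul, smul_eq_C_mul, C_mul,
    map_neg, map_ofNat, show (Complex.I * ħ / 2) = (Complex.I * ħ) * (2 : ℂ)⁻¹ from rfl]
  have h2 : (C (2 : ℂ)⁻¹ : Poly d) * 2 = 1 := by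
    rw [← map_ofNat (C : ℂ →+* Poly d) 2, ← C_mul]; simp
  linear_combination (C Complex.I * C (ħ : ℂ) * dirDeriv u p) * h2

/-! ### Ladder operators and Hermite polynomials -/

/-- The raising operator `𝒜ₘ*` in terms of the polynomial factor `p` of `p φ₀`. -/
noncomputable def raiseOp (A : Matrix (Fin d) (Fin d) ℂ) (ħ : ℝ) (m : Fin d) :
    Poly d →ₗ[ℂ] Poly d :=
  firstOrder (fun n => 2 / (√(2 * ħ) : ℂ) * A⁻¹ m n) (fun n => -((√(2 * ħ) : ℂ) / 2) * star (A n m))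

/-- The lowering operator `𝒜ₘ` in terms of the polynomial factor `p` of `p φ₀`. -/
noncomputable def lowerOp (A : Matrix (Fin d) (Fin d) ℂ) (ħ : ℝ) (m : Fin d) :
    Poly d →ₗ[ℂ] Poly d :=
  firstOrder 0 (fun n => (√(2 * ħ) : ℂ) / 2 * A n m)

/-- The polynomial factor of the wave packet `φ_j`. -/
noncomputable def hermitePoly (A : Matrix (Fin d) (Fin d) ℂ) (ħ : ℝ) (j : Fin d → ℕ) : Poly d :=
  ((1 / √(multiFactorial j) : ℝ) : ℂ) • multiIterate (fun m => raiseOp A ħ m) j 1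

variable {A B : Matrix (Fin d) (Fin d) ℂ} {ħ : ℝ}

theorem sqrt_two_mul_ne_zero (hħ : 0 < ħ) : (√(2 * ħ) : ℂ) ≠ 0 :=
  Complex.ofReal_ne_zero.mpr (Real.sqrt_ne_zero'.mpr (by positivity))

theorem linForm_zero : linForm (0 : Fin d → ℂ) = 0 := by simp [linForm]

theorem lowerOp_apply (m : Fin d) (p : Poly d) :
    lowerOp A ħ m p = dirDeriv (fun n => (√(2 * ħ) : ℂ) / 2 * A n m) p := by
  rw [lowerOp, firstOrder_apply, linForm_zero, zero_mul, zero_add]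

theorem raiseOp_comm (h : Admissible A B) (hħ : 0 < ħ) (m n : Fin d) (p : Poly d) :
    raiseOp A ħ m (raiseOp A ħ n p) = raiseOp A ħ n (raiseOp A ħ m p) := by
  have hσ := sqrt_two_mul_ne_zero hħ
  have hs := congrFun (congrFun h.inv_mul_conj_symm m) n
  simp only [transpose_apply, mul_apply, conjTranspose_apply] at hs
  rw [raiseOp, raiseOp, firstOrder_commutator]
  convert add_zero _
  rw [smul_eq_zero]
  left
  simp only [dotProduct]
  rw [sub_eq_zero]
  calc _ = -∑ k, A⁻¹ n k * star (A k m) := by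
        rw [← Finset.sum_neg_distrib]
        refine Finset.sum_congr rfl fun k _ => ?_
        field_simp
    _ = -∑ k, A⁻¹ m k * star (A k n) := by rw [hs]
    _ = _ := by
        rw [← Finset.sum_neg_distrib]
        refine Finset.sum_congr rfl fun k _ => ?_
        field_simp

/-- The canonical commutation relations. -/
theorem lowerOp_raiseOp (h : Admissible A B) (hħ : 0 < ħ) (m n : Fin d) (p : Poly d) :
    lowerOp A ħ m (raiseOp A ħ n p)
      = raiseOp A ħ n (lowerOp A ħ m p) + (if m = n then (1 : ℂ) else 0) • p := by
  have hσ := sqrt_two_mul_ne_zero hħ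
  have hs := congrFun (congrFun h.inv_mul n) m
  rw [mul_apply, one_apply] at hs
  rw [raiseOp, lowerOp, firstOrder_commutator, dotProduct_zero, sub_zero]
  congr 2
  rw [show (if m = n then (1 : ℂ) else 0) = if n = m then 1 else 0 by simp only [eq_comm], ← hs]
  refine Finset.sum_congr rfl fun k _ => ?_
  field_simp

theorem lowerOp_one (m : Fin d) : lowerOp A ħ m 1 = 0 := by
  rw [lowerOp_apply, Derivation.map_one_eq_zero]

/-- Multiplication by a coordinate in terms of the ladder operators. -/
theorem X_mul_eq_ladder (h : Admissible A B) (hħ : 0 < ħ) (n : Fin d) (p : Poly d) :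
    X n * p = ((√(2 * ħ) : ℂ) / 2) •
      ∑ m, (A n m • raiseOp A ħ m p + star (A n m) • lowerOp A ħ m p) := by
  have hσ := sqrt_two_mul_ne_zero hħ
  set σ : ℂ := (√(2 * ħ) : ℂ) with hσdef
  have h1 : ∀ k, ∑ m, A n m * (2 / σ * A⁻¹ m k) = 2 / σ * if n = k then 1 else 0 := by
    intro k
    rw [← one_apply, ← h.mul_inv, mul_apply, Finset.mul_sum]
    exact Finset.sum_congr rfl fun m _ => by ring
  have h2 : ∀ k, ∑ m, A n m * (-(σ / 2) * star (A k m))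
      + ∑ m, star (A n m) * (σ / 2 * A k m) = 0 := by
    intro k
    have hs := congrFun (congrFun h.mul_conjTranspose_transpose n) k
    simp only [transpose_apply, mul_apply, conjTranspose_apply] at hs
    calc _ = -(σ / 2) * (∑ m, A n m * star (A k m)) + (σ / 2) * ∑ m, A k m * star (A n m) := by
          rw [Finset.mul_sum, Finset.mul_sum]
          congr 1 <;> exact Finset.sum_congr rfl fun m _ => by ring
      _ = 0 := by rw [hs]; ring
  simp only [raiseOp, lowerOp_apply, firstOrder_apply, ← hσdef, linForm,
    dirDeriv_eq_sum, Finset.sum_mul, smul_add, Finset.smul_sum, smul_mul_assoc, smul_smul,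
    Finset.sum_add_distrib]
  rw [Finset.sum_comm, add_assoc]
  have e1 : ∀ k, ∑ m, (σ / 2 * (A n m * (2 / σ * A⁻¹ m k))) • (X k * p : Poly d)
      = if n = k then (X k * p : Poly d) else 0 := by
    intro k
    rw [← Finset.sum_smul, ← Finset.mul_sum, h1]
    by_cases hk : n = k
    · simp only [hk, if_true, mul_one]
      rw [show σ / 2 * (2 / σ) = 1 by field_simp, one_smul]
    · simp [hk]
  have e2 : ∑ m, ∑ k, (σ / 2 * (A n m * (-(σ / 2) * star (A k m)))) • pderiv k p
      + ∑ m, ∑ k, (σ / 2 * (star (A n m) * (σ / 2 * A k m))) • pderiv k p = 0 := by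
    rw [Finset.sum_comm, Finset.sum_comm (f := fun m k =>
      (σ / 2 * (star (A n m) * (σ / 2 * A k m))) • pderiv k p), ← Finset.sum_add_distrib]
    refine Finset.sum_eq_zero fun k _ => ?_
    rw [← Finset.sum_smul, ← Finset.sum_smul, ← add_smul, ← Finset.mul_sum, ← Finset.mul_sum,
      ← mul_add, h2, mul_zero, zero_smul]
  rw [e2, add_zero, Finset.sum_congr rfl fun k _ => e1 k]
  simp

theorem raiseOp_iterate (h : Admissible A B) (hħ : 0 < ħ) (j : Fin d → ℕ) (m : Fin d) :
    multiIterate (fun m => raiseOp A ħ m) (j + Pi.single m 1) 1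
      = raiseOp A ħ m (multiIterate (fun m => raiseOp A ħ m) j 1) :=
  multiIterate_add_single (fun m n x => raiseOp_comm h hħ m n x) j m 1

theorem lowerOp_iterate (h : Admissible A B) (hħ : 0 < ħ) (m : Fin d) (j : Fin d → ℕ) :
    lowerOp A ħ m (multiIterate (fun m => raiseOp A ħ m) j 1)
      = (j m : ℂ) • multiIterate (fun m => raiseOp A ħ m) (j - Pi.single m 1) 1 := by
  induction j using multiIndex_induction with
  | h0 => simp [lowerOp_one]
  | hs j n ih =>
    rw [raiseOp_iterate h hħ, lowerOp_raiseOp h hħ, ih, map_smul, ← raiseOp_iterate h hħ]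
    by_cases hmn : m = n
    · subst hmn
      rw [if_pos rfl, add_tsub_cancel_right]
      by_cases hj : j m = 0
      · simp [hj]
      · have : (j - Pi.single m 1 + Pi.single m 1 : Fin d → ℕ) = j := by
          funext i
          by_cases hi : i = m
          · subst hi; simp; omega
          · simp [Pi.single_eq_of_ne hi]
        rw [this, ← add_smul]
        simp
    · rw [if_neg hmn, zero_smul, add_zero]
      by_cases hj : j m = 0
      · simp [hj, Pi.single_eq_of_ne hmn]
      · have : (j - Pi.single m 1 + Pi.single n 1 : Fin d → ℕ)
            = j + Pi.single n 1 - Pi.single m 1 := by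
          funext i
          by_cases hi : i = m
          · subst hi; simp [Pi.single_eq_of_ne hmn]
          · simp [Pi.single_eq_of_ne hi]
        rw [this]
        simp [Pi.single_eq_of_ne hmn]

theorem hermitePoly_zero : hermitePoly A ħ 0 = 1 := by
  simp [hermitePoly, multiFactorial]

theorem raiseOp_hermitePoly (h : Admissible A B) (hħ : 0 < ħ) (j : Fin d → ℕ) (m : Fin d) :
    raiseOp A ħ m (hermitePoly A ħ j)
      = ((√(j m + 1) : ℝ) : ℂ) • hermitePoly A ħ (j + Pi.single m 1) := by
  rw [hermitePoly, hermitePoly, map_smul, raiseOp_iterate h hħ, smul_smul, multiFactorial_add_single]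
  congr 1
  rw [← Complex.ofReal_mul]
  congr 1
  have h1 : (0 : ℝ) < multiFactorial j := by exact_mod_cast multiFactorial_pos j
  have h2 : (0 : ℝ) < j m + 1 := by positivity
  push_cast
  rw [Real.sqrt_mul h2.le]
  have := Real.sqrt_pos.mpr h1
  have := Real.sqrt_pos.mpr h2
  field_simp

theorem lowerOp_hermitePoly_add (h : Admissible A B) (hħ : 0 < ħ) (j : Fin d → ℕ) (m : Fin d) :
    lowerOp A ħ m (hermitePoly A ħ (j + Pi.single m 1))
      = ((√(j m + 1) : ℝ) : ℂ) • hermitePoly A ħ j := by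
  rw [hermitePoly, hermitePoly, map_smul, lowerOp_iterate h hħ, smul_smul, smul_smul,
    multiFactorial_add_single, add_tsub_cancel_right]
  congr 1
  have h1 : (0 : ℝ) < multiFactorial j := by exact_mod_cast multiFactorial_pos j
  have h2 : (0 : ℝ) < j m + 1 := by positivity
  have h3 : (((j + Pi.single m 1 : Fin d → ℕ) m : ℕ) : ℂ) = ((j m + 1 : ℝ) : ℂ) := by simp
  rw [h3, ← Complex.ofReal_mul, ← Complex.ofReal_mul]
  congr 1
  push_cast
  rw [Real.sqrt_mul h2.le]
  have := Real.sqrt_pos.mpr h1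
  have := Real.sqrt_pos.mpr h2
  field_simp
  rw [Real.sq_sqrt h2.le]

theorem lowerOp_hermitePoly_of_eq_zero (h : Admissible A B) (hħ : 0 < ħ) {j : Fin d → ℕ}
    {m : Fin d} (hj : j m = 0) : lowerOp A ħ m (hermitePoly A ħ j) = 0 := by
  rw [hermitePoly, map_smul, lowerOp_iterate h hħ, hj]
  simp

end Operators

open MvPolynomial

/-! ### Polynomials times a Gaussian -/

section Packets

variable {d : ℕ}

/-- The displacement `x - a` as a complex vector. -/
noncomputable def disp (a x : Space d) : Fin d → ℂ := fun n => ((x n - a n : ℝ) : ℂ)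

/-- The function `p(x - a) φ₀(x)`. -/
noncomputable def polyPacket (A B : Matrix (Fin d) (Fin d) ℂ) (s : ℂ) (ħ : ℝ) (a η : Space d)
    (p : Poly d) (x : Space d) : ℂ :=
  eval (disp a x) p * gaussianPacket A B s ħ a η x

theorem star_disp (a x : Space d) : star (disp a x) = disp a x := by
  funext n; simp [disp]

theorem gaussianPacket_eq (A B : Matrix (Fin d) (Fin d) ℂ) (s : ℂ) (ħ : ℝ) (a η x : Space d) :
    gaussianPacket A B s ħ a η x
      = ((Real.pi ^ (-(d : ℝ) / 4) * ħ ^ (-(d : ℝ) / 4) : ℝ) : ℂ) * s⁻¹ *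
        Complex.exp (-(disp a x ⬝ᵥ (B * A⁻¹) *ᵥ disp a x) / (2 * ħ) +
          Complex.I * ((fun n => ((η n : ℝ) : ℂ)) ⬝ᵥ disp a x) / ħ) := by
  have : (fun n => ((η n : ℝ) : ℂ)) ⬝ᵥ disp a x = ((∑ n, η n * (x n - a n) : ℝ) : ℂ) := by
    simp [disp, dotProduct]
  rw [this]
  rfl

/-- Chain rule for a fixed polynomial along a curve. -/
theorem hasDerivAt_eval {y : ℝ → Fin d → ℂ} {y' : Fin d → ℂ} {t : ℝ}
    (hy : ∀ n, HasDerivAt (fun r => y r n) (y' n) t) (p : Poly d) :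
    HasDerivAt (fun r => eval (y r) p) (eval (y t) (dirDeriv y' p)) t := by
  induction p using MvPolynomial.induction_on with
  | C c => simpa [dirDeriv_C] using hasDerivAt_const t c
  | add p q hp hq => simpa using hp.fun_add hq
  | mul_X p n hp =>
    have := hp.fun_mul (hy n)
    simp only [map_mul, eval_X]
    refine this.congr_deriv ?_
    rw [Derivation.leibniz, dirDeriv_X]
    simp only [smul_eq_mul, map_add, map_mul, eval_X, eval_C]
    ring

theorem hasDerivAt_dotProduct {ι : Type*} [Fintype ι] {y z : ℝ → ι → ℂ} {y' z' : ι → ℂ} {t : ℝ}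
    (hy : ∀ n, HasDerivAt (fun r => y r n) (y' n) t)
    (hz : ∀ n, HasDerivAt (fun r => z r n) (z' n) t) :
    HasDerivAt (fun r => y r ⬝ᵥ z r) (y' ⬝ᵥ z t + y t ⬝ᵥ z') t := by
  simp only [dotProduct, ← Finset.sum_add_distrib]
  exact HasDerivAt.fun_sum fun n _ => (hy n).mul (hz n)

theorem hasDerivAt_quadForm {y : ℝ → Fin d → ℂ} {y' : Fin d → ℂ}
    {G : ℝ → Matrix (Fin d) (Fin d) ℂ} {G' : Matrix (Fin d) (Fin d) ℂ} {t : ℝ}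
    (hy : ∀ n, HasDerivAt (fun r => y r n) (y' n) t)
    (hG : ∀ i j, HasDerivAt (fun r => G r i j) (G' i j) t) (hsymm : (G t)ᵀ = G t) :
    HasDerivAt (fun r => y r ⬝ᵥ G r *ᵥ y r)
      (2 * (y' ⬝ᵥ G t *ᵥ y t) + y t ⬝ᵥ G' *ᵥ y t) t := by
  have h := hasDerivAt_dotProduct (z := fun r => G r *ᵥ y r) (z' := G' *ᵥ y t + G t *ᵥ y') hy
    (fun n => hasDerivAt_dotProduct (fun k => hG n k) hy)
  refine h.congr_deriv ?_
  have : y t ⬝ᵥ G t *ᵥ y' = y' ⬝ᵥ G t *ᵥ y t := by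
    rw [dotProduct_mulVec, dotProduct_comm, ← mulVec_transpose, hsymm]
  rw [dotProduct_add, this]
  ring

theorem contDiff_disp (a : Space d) {k : WithTop ℕ∞} (n : Fin d) :
    ContDiff ℝ k (fun x => disp a x n) := by
  unfold disp
  exact Complex.ofRealCLM.contDiff.comp
    ((EuclideanSpace.proj (𝕜 := ℝ) n).contDiff.sub contDiff_const)

theorem contDiff_eval_disp (a : Space d) {k : WithTop ℕ∞} (p : Poly d) :
    ContDiff ℝ k (fun x => eval (disp a x) p) := by
  induction p using MvPolynomial.induction_on with
  | C c => simpa using contDiff_const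
  | add p q hp hq => simpa using hp.add hq
  | mul_X p n hp => simpa using hp.mul (contDiff_disp a n)

theorem contDiff_gaussianPacket (A B : Matrix (Fin d) (Fin d) ℂ) (s : ℂ) (ħ : ℝ) (a η : Space d)
    {k : WithTop ℕ∞} : ContDiff ℝ k (gaussianPacket A B s ħ a η) := by
  rw [show gaussianPacket A B s ħ a η = _ from funext (gaussianPacket_eq A B s ħ a η)]
  refine contDiff_const.mul (ContDiff.cexp (ContDiff.add (ContDiff.div_const (ContDiff.neg ?_) _)
    (ContDiff.div_const (contDiff_const.mul ?_) _)))
  · simp only [dotProduct, mulVec]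
    exact ContDiff.sum fun i _ => (contDiff_disp a i).mul
      (ContDiff.sum fun j _ => contDiff_const.mul (contDiff_disp a j))
  · simp only [dotProduct]
    exact ContDiff.sum fun i _ => contDiff_const.mul (contDiff_disp a i)

theorem contDiff_polyPacket (A B : Matrix (Fin d) (Fin d) ℂ) (s : ℂ) (ħ : ℝ) (a η : Space d)
    {k : WithTop ℕ∞} (p : Poly d) : ContDiff ℝ k (polyPacket A B s ħ a η p) :=
  (contDiff_eval_disp a p).mul (contDiff_gaussianPacket A B s ħ a η)

theorem polyPacket_add (A B : Matrix (Fin d) (Fin d) ℂ) (s : ℂ) (ħ : ℝ) (a η : Space d)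
    (p q : Poly d) (x : Space d) : polyPacket A B s ħ a η (p + q) x
      = polyPacket A B s ħ a η p x + polyPacket A B s ħ a η q x := by
  simp [polyPacket, add_mul]

theorem polyPacket_smul (A B : Matrix (Fin d) (Fin d) ℂ) (s : ℂ) (ħ : ℝ) (a η : Space d)
    (c : ℂ) (p : Poly d) (x : Space d) : polyPacket A B s ħ a η (c • p) x
      = c * polyPacket A B s ħ a η p x := by
  simp [polyPacket, smul_eval, mul_assoc]

theorem polyPacket_sum (A B : Matrix (Fin d) (Fin d) ℂ) (s : ℂ) (ħ : ℝ) (a η : Space d)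
    {ι : Type*} (S : Finset ι) (p : ι → Poly d) (x : Space d) :
    polyPacket A B s ħ a η (∑ i ∈ S, p i) x = ∑ i ∈ S, polyPacket A B s ħ a η (p i) x := by
  simp [polyPacket, Finset.sum_mul]

theorem polyPacket_mul (A B : Matrix (Fin d) (Fin d) ℂ) (s : ℂ) (ħ : ℝ) (a η : Space d)
    (p q : Poly d) (x : Space d) : polyPacket A B s ħ a η (p * q) x
      = eval (disp a x) p * polyPacket A B s ħ a η q x := by
  simp [polyPacket, mul_assoc]

theorem eval_linForm (y u : Fin d → ℂ) : eval y (linForm u) = u ⬝ᵥ y := by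
  simp [linForm, dotProduct, smul_eval]

/-- The logarithmic derivative `∂ₙφ₀ / φ₀ = (iηₙ - (Γ(x - a))ₙ)/ħ`, as a polynomial in `x - a`. -/
noncomputable def logDeriv (Γ : Matrix (Fin d) (Fin d) ℂ) (ħ : ℝ) (η : Space d) (n : Fin d) :
    Poly d :=
  C (Complex.I * (η n : ℂ) / ħ) - (1 / (ħ : ℂ)) • linForm (Γ n)

/-- The partial derivative in terms of the polynomial factor `p` of `p φ₀`. -/
noncomputable def covDeriv (Γ : Matrix (Fin d) (Fin d) ℂ) (ħ : ℝ) (η : Space d) (n : Fin d)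
    (p : Poly d) : Poly d :=
  pderiv n p + logDeriv Γ ħ η n * p

variable {A B : Matrix (Fin d) (Fin d) ℂ} {s : ℂ} {ħ : ℝ} {a η : Space d}

theorem partialDeriv_polyPacket (h : Admissible A B) (n : Fin d) (p : Poly d) :
    partialDeriv n (polyPacket A B s ħ a η p)
      = polyPacket A B s ħ a η (covDeriv (B * A⁻¹) ħ η n p) := by
  funext x
  have hdiff : DifferentiableAt ℝ (polyPacket A B s ħ a η p) x :=
    ((contDiff_polyPacket A B s ħ a η p (k := 1)).differentiable one_ne_zero) x
  rw [partialDeriv, ← hdiff.lineDeriv_eq_fderiv]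
  refine HasLineDerivAt.lineDeriv ?_
  unfold HasLineDerivAt
  have hy : ∀ k, HasDerivAt (fun r : ℝ => disp a (x + r • EuclideanSpace.single n (1 : ℝ)) k)
      ((Pi.single n 1 : Fin d → ℂ) k) 0 := by
    intro k
    have h1 : HasDerivAt (fun r : ℝ => x k + r * (EuclideanSpace.single n (1 : ℝ) : Space d) k - a k)
        ((EuclideanSpace.single n (1 : ℝ) : Space d) k) 0 := by
      simpa using (((hasDerivAt_id (0 : ℝ)).mul_const
        ((EuclideanSpace.single n (1 : ℝ) : Space d) k)).const_add (x k)).sub_const (a k)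
    have h2 := h1.ofReal_comp
    have h3 : (fun r : ℝ => disp a (x + r • EuclideanSpace.single n (1 : ℝ)) k) = fun r : ℝ =>
        ((x k + r * (EuclideanSpace.single n (1 : ℝ) : Space d) k - a k : ℝ) : ℂ) := by
      funext r; simp [disp]
    rw [h3]
    refine h2.congr_deriv ?_
    by_cases hk : k = n
    · subst hk; simp
    · simp [hk]
  have hq := hasDerivAt_quadForm (G := fun _ => B * A⁻¹) (G' := 0) hy
    (fun i j => by simpa using hasDerivAt_const (0 : ℝ) _) h.symm
  have hl := hasDerivAt_dotProduct (y := fun _ n => ((η n : ℝ) : ℂ)) (y' := 0)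
    (fun i => by simpa using hasDerivAt_const (0 : ℝ) _) hy
  have hexp := ((hq.fun_neg.div_const (2 * (ħ : ℂ))).fun_add ((hl.const_mul Complex.I).div_const (ħ : ℂ))).cexp
  have hmul := (hasDerivAt_eval hy p).fun_mul (hexp.const_mul
    (((Real.pi ^ (-(d : ℝ) / 4) * ħ ^ (-(d : ℝ) / 4) : ℝ) : ℂ) * s⁻¹))
  have hfun : (fun r : ℝ => polyPacket A B s ħ a η p (x + r • EuclideanSpace.single n (1 : ℝ)))
      = _ := funext fun r => by rw [polyPacket, gaussianPacket_eq]
  rw [hfun]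
  refine hmul.congr_deriv ?_
  simp only [zero_smul, add_zero, zero_mulVec, dotProduct_zero, zero_dotProduct, zero_add,
    single_dotProduct, dotProduct_single]
  rw [polyPacket, gaussianPacket_eq, covDeriv, logDeriv, pderiv_eq_dirDeriv]
  simp only [map_add, map_mul, map_sub, eval_C, smul_eval, eval_linForm, mulVec]
  ring

/-- Conjugation by the Gaussian turns `𝒜_m^*` into the operator `raiseOp` on polynomials. -/
theorem raising_polyPacket (h : Admissible A B) (hħ : 0 < ħ) (m : Fin d) (p : Poly d) :
    raising A B ħ a η m (polyPacket A B s ħ a η p)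
      = polyPacket A B s ħ a η (raiseOp A ħ m p) := by
  have hσ := sqrt_two_mul_ne_zero hħ
  have hħ' : (ħ : ℂ) ≠ 0 := Complex.ofReal_ne_zero.mpr hħ.ne'
  have hσ2 : (√(2 * ħ) : ℂ) ^ 2 = 2 * ħ := by
    rw [← Complex.ofReal_pow, Real.sq_sqrt (by positivity)]; push_cast; rfl
  funext x
  rw [raising]
  simp only [partialDeriv_polyPacket h]
  have hkey : ∑ n, star (A n m) * ((B * A⁻¹) n ⬝ᵥ disp a x) + ∑ n, star (B n m) * disp a x n
      = 2 * (A⁻¹ m ⬝ᵥ disp a x) := by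
    have h1 := congrFun (congrArg (· *ᵥ disp a x) h.conj_mul_symm_add) m
    simp only [add_mulVec, smul_mulVec, Pi.add_apply, Pi.smul_apply, smul_eq_mul] at h1
    rw [← mulVec_mulVec] at h1
    exact h1
  set σ : ℂ := (√(2 * ħ) : ℂ) with hσdef
  set v := disp a x with hv
  set g := gaussianPacket A B s ħ a η x
  have hf : polyPacket A B s ħ a η p x = eval v p * g := rfl
  have hf' : ∀ n, polyPacket A B s ħ a η (covDeriv (B * A⁻¹) ħ η n p) x
      = (eval v (pderiv n p) + (Complex.I * (η n : ℂ) / ħ - 1 / ħ * ((B * A⁻¹) n ⬝ᵥ v)) * eval v p)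
        * g := by
    intro n
    rw [polyPacket, covDeriv, logDeriv]
    simp only [map_add, map_mul, map_sub, eval_C, smul_eval, eval_linForm, hv, g]
  have hr : polyPacket A B s ħ a η (raiseOp A ħ m p) x
      = (2 / σ * (A⁻¹ m ⬝ᵥ v) * eval v p
          - σ / 2 * ∑ n, star (A n m) * eval v (pderiv n p)) * g := by
    rw [polyPacket, raiseOp, firstOrder_apply, dirDeriv_eq_sum]
    simp only [map_add, map_mul, eval_linForm, map_sum, smul_eval, ← hσdef, ← hv]
    congr 1
    simp only [dotProduct, Finset.mul_sum, sub_eq_add_neg, ← Finset.sum_neg_distrib]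
    congr 1
    · congr 1; exact Finset.sum_congr rfl fun n _ => by ring
    · exact Finset.sum_congr rfl fun n _ => by ring
  have hterm : ∀ n, star (A n m) * (-Complex.I * (ħ : ℂ) *
        ((eval v (pderiv n p) + (Complex.I * (η n : ℂ) / ħ - 1 / ħ * ((B * A⁻¹) n ⬝ᵥ v)) * eval v p)
        * g) - ((η n : ℝ) : ℂ) * (eval v p * g))
      = -Complex.I * ħ * g * (star (A n m) * eval v (pderiv n p))
        + Complex.I * (eval v p * g) * (star (A n m) * ((B * A⁻¹) n ⬝ᵥ v)) := by
    intro n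
    field_simp
    linear_combination (-(star (A n m)) * g * (η n : ℂ) * eval v p) * Complex.I_sq
  have h0 : ∀ n, star (B n m) * ((x n - a n : ℝ) : ℂ) * (eval v p * g)
      = (eval v p * g) * (star (B n m) * v n) := by
    intro n; rw [hv, disp]; ring
  rw [hr, hf]
  simp only [hf', hterm, h0, Finset.sum_add_distrib, ← Finset.mul_sum]
  push_cast
  rw [← hσdef]
  have e1 : 2 * (A⁻¹ m ⬝ᵥ v) = _ := hkey.symm
  have e2 : 2 / σ * (A⁻¹ m ⬝ᵥ v) = 1 / σ * (2 * (A⁻¹ m ⬝ᵥ v)) := by ring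
  have e3 : σ / 2 = ħ / σ := by field_simp; rw [hσ2]
  rw [e2, e1, e3]
  linear_combination (1 / σ * ħ * g * ∑ n, star (A n m) * eval v (pderiv n p)
    - 1 / σ * eval v p * g * ∑ n, star (A n m) * ((B * A⁻¹) n ⬝ᵥ v)) * Complex.I_sq

/-- The wave packets are Hermite polynomials times the Gaussian packet. -/
theorem wavePacket_eq_polyPacket (h : Admissible A B) (hħ : 0 < ħ) (j : Fin d → ℕ) :
    wavePacket A B s ħ a η j = polyPacket A B s ħ a η (hermitePoly A ħ j) := by
  have hit : multiIterate (raising A B ħ a η) j (gaussianPacket A B s ħ a η)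
      = polyPacket A B s ħ a η (multiIterate (fun m => raiseOp A ħ m) j 1) := by
    unfold multiIterate
    induction List.finRange d with
    | nil => funext x; simp [polyPacket]
    | cons n l ih =>
      rw [List.foldr_cons, List.foldr_cons, ih]
      generalize List.foldr (fun n g => (fun p => raiseOp A ħ n p)^[j n] g) 1 l = q
      induction j n generalizing q with
      | zero => rfl
      | succ k ihk =>
        rw [Function.iterate_succ_apply, Function.iterate_succ_apply, raising_polyPacket h hħ, ihk]
  funext x
  rw [wavePacket, hit, hermitePoly, polyPacket_smul]

end Packets

/-! ### Gaussian bounds and square integrability -/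

section Bounds

open MeasureTheory

variable {d : ℕ}

theorem norm_sub_sq_eq (a x : Space d) : ‖x - a‖ ^ 2 = ∑ n, ‖disp a x n‖ ^ 2 := by
  rw [EuclideanSpace.norm_sq_eq]
  refine Finset.sum_congr rfl fun n _ => ?_
  rw [disp, Complex.norm_real]
  rfl

theorem norm_disp_le (a x : Space d) (n : Fin d) : ‖disp a x n‖ ≤ ‖x - a‖ := by
  have := PiLp.norm_apply_le (x - a) n
  rw [disp, Complex.norm_real]
  exact this

theorem norm_gaussianPacket {A B : Matrix (Fin d) (Fin d) ℂ} (h : Admissible A B) (s : ℂ) {ħ : ℝ}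
    (hħ : 0 < ħ) (a η x : Space d) :
    ‖gaussianPacket A B s ħ a η x‖ = Real.pi ^ (-(d : ℝ) / 4) * ħ ^ (-(d : ℝ) / 4) * ‖s‖⁻¹ *
      Real.exp (-(∑ n, ‖(A⁻¹ *ᵥ disp a x) n‖ ^ 2) / (2 * ħ)) := by
  have him : ((Complex.I * ((fun n => ((η n : ℝ) : ℂ)) ⬝ᵥ disp a x) / ħ)).re = 0 := by
    have : (fun n => ((η n : ℝ) : ℂ)) ⬝ᵥ disp a x = ((∑ n, η n * (x n - a n) : ℝ) : ℂ) := by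
      simp [disp, dotProduct]
    rw [this, mul_div_assoc, ← Complex.ofReal_div, Complex.re_mul_ofReal]
    simp
  rw [gaussianPacket_eq, norm_mul, norm_mul, norm_inv, Complex.norm_real, Complex.norm_exp,
    Complex.add_re, him, add_zero, Real.norm_of_nonneg (by positivity),
    ← h.re_quadForm (disp a x) (star_disp a x)]
  congr 2
  rw [show (2 * (ħ : ℂ)) = ((2 * ħ : ℝ) : ℂ) by push_cast; rfl, Complex.div_ofReal_re,
    Complex.neg_re]

theorem norm_sub_sq_le {A B : Matrix (Fin d) (Fin d) ℂ} (h : Admissible A B) {K : ℝ}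
    (hK : ∀ i j, ‖A i j‖ ≤ K) (a x : Space d) :
    ‖x - a‖ ^ 2 ≤ (d * K) ^ 2 * ∑ n, ‖(A⁻¹ *ᵥ disp a x) n‖ ^ 2 := by
  set w := A⁻¹ *ᵥ disp a x
  have hw : disp a x = A *ᵥ w := by rw [mulVec_mulVec, h.mul_inv, one_mulVec]
  rw [norm_sub_sq_eq, hw]
  have hn : ∀ n, ‖(A *ᵥ w) n‖ ^ 2 ≤ K ^ 2 * (d * ∑ m, ‖w m‖ ^ 2) := by
    intro n
    have h1 : ‖(A *ᵥ w) n‖ ≤ K * ∑ m, ‖w m‖ := by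
      rw [mulVec, dotProduct, Finset.mul_sum]
      refine (norm_sum_le _ _).trans (Finset.sum_le_sum fun m _ => ?_)
      rw [norm_mul]
      exact mul_le_mul_of_nonneg_right (hK n m) (norm_nonneg _)
    have h2 : (∑ m, ‖w m‖) ^ 2 ≤ d * ∑ m, ‖w m‖ ^ 2 := by
      simpa using sq_sum_le_card_mul_sum_sq (s := Finset.univ) (f := fun m => ‖w m‖)
    calc ‖(A *ᵥ w) n‖ ^ 2 ≤ (K * ∑ m, ‖w m‖) ^ 2 := by gcongr
      _ = K ^ 2 * (∑ m, ‖w m‖) ^ 2 := by ring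
      _ ≤ _ := by gcongr
  calc ∑ n, ‖(A *ᵥ w) n‖ ^ 2 ≤ ∑ _n : Fin d, K ^ 2 * (d * ∑ m, ‖w m‖ ^ 2) :=
        Finset.sum_le_sum fun n _ => hn n
    _ = _ := by simp; ring

theorem exists_norm_eval_le (p : Poly d) : ∃ (C : ℝ) (k : ℕ), 0 ≤ C ∧
    ∀ (y : Fin d → ℂ) (R : ℝ), 1 ≤ R → (∀ n, ‖y n‖ ≤ R) → ‖eval y p‖ ≤ C * R ^ k := by
  induction p using MvPolynomial.induction_on with
  | C c => exact ⟨‖c‖, 0, norm_nonneg _, fun y R _ _ => by simp⟩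
  | add p q hp hq =>
    obtain ⟨C, k, hC, h⟩ := hp
    obtain ⟨C', k', hC', h'⟩ := hq
    refine ⟨C + C', k + k', by positivity, fun y R hR hy => ?_⟩
    rw [map_add]
    calc _ ≤ C * R ^ k + C' * R ^ k' := (norm_add_le _ _).trans (add_le_add (h y R hR hy) (h' y R hR hy))
      _ ≤ C * R ^ (k + k') + C' * R ^ (k + k') := by
        gcongr <;> first | assumption | omega
      _ = _ := by ring
  | mul_X p n hp =>
    obtain ⟨C, k, hC, h⟩ := hp
    refine ⟨C, k + 1, hC, fun y R hR hy => ?_⟩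
    rw [map_mul, eval_X, norm_mul, pow_succ, ← mul_assoc]
    exact mul_le_mul (h y R hR hy) (hy n) (norm_nonneg _) (by positivity)

/-- A time-dependent polynomial whose coefficients are continuous in time: a finite combination of
fixed polynomials with continuous scalar coefficients. -/
def ContPoly (p : ℝ → Poly d) : Prop :=
  ∃ (ι : Type) (_ : Fintype ι) (f : ι → ℝ → ℂ) (b : ι → Poly d),
    (∀ i, Continuous (f i)) ∧ ∀ t, p t = ∑ i, f i t • b i

theorem ContPoly.const (b : Poly d) : ContPoly fun _ => b :=
  ⟨Unit, inferInstance, fun _ _ => 1, fun _ => b, fun _ => continuous_const, fun t => by simp⟩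

theorem ContPoly.add {p q : ℝ → Poly d} (hp : ContPoly p) (hq : ContPoly q) :
    ContPoly fun t => p t + q t := by
  obtain ⟨ι, _, f, b, hf, hp⟩ := hp
  obtain ⟨κ, _, g, c, hg, hq⟩ := hq
  exact ⟨ι ⊕ κ, inferInstance, Sum.elim f g, Sum.elim b c, by
    rintro (i | i); exacts [hf i, hg i], fun t => by simp [hp, hq]⟩

theorem ContPoly.smul {p : ℝ → Poly d} (hp : ContPoly p) {g : ℝ → ℂ} (hg : Continuous g) :
    ContPoly fun t => g t • p t := by
  obtain ⟨ι, _, f, b, hf, hp⟩ := hp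
  exact ⟨ι, inferInstance, fun i t => g t * f i t, b, fun i => hg.mul (hf i), fun t => by
    simp [hp, Finset.smul_sum, mul_smul]⟩

theorem ContPoly.map {p : ℝ → Poly d} (hp : ContPoly p) (L : Poly d →ₗ[ℂ] Poly d) :
    ContPoly fun t => L (p t) := by
  obtain ⟨ι, _, f, b, hf, hp⟩ := hp
  exact ⟨ι, inferInstance, f, fun i => L (b i), hf, fun t => by simp [hp]⟩

theorem ContPoly.sum {κ : Type*} (S : Finset κ) {p : κ → ℝ → Poly d}
    (hp : ∀ k ∈ S, ContPoly (p k)) : ContPoly fun t => ∑ k ∈ S, p k t := by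
  classical
  induction S using Finset.induction_on with
  | empty => simpa using ContPoly.const 0
  | insert k S hk ih =>
    simp only [Finset.sum_insert hk]
    exact (hp k (by simp)).add (ih fun i hi => hp i (by simp [hi]))

theorem ContPoly.linForm_mul {p : ℝ → Poly d} (hp : ContPoly p) {u : ℝ → Fin d → ℂ}
    (hu : ∀ n, Continuous fun t => u t n) : ContPoly fun t => linForm (u t) * p t := by
  simp only [linForm, Finset.sum_mul, smul_mul_assoc]
  exact ContPoly.sum _ fun n _ => (hp.map (LinearMap.mulLeft ℂ (X n))).smul (hu n)

theorem ContPoly.exists_norm_eval_le {p : ℝ → Poly d} (hp : ContPoly p) {I : Set ℝ}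
    (hI : IsCompact I) : ∃ (C : ℝ) (k : ℕ), 0 ≤ C ∧ ∀ t ∈ I,
      ∀ (y : Fin d → ℂ) (R : ℝ), 1 ≤ R → (∀ n, ‖y n‖ ≤ R) → ‖eval y (p t)‖ ≤ C * R ^ k := by
  classical
  obtain ⟨ι, _, f, b, hf, hp⟩ := hp
  choose C k hC hb using fun i => Hagedorn.exists_norm_eval_le (b i)
  choose D hD using fun i => hI.exists_bound_of_continuousOn (hf i).continuousOn
  refine ⟨∑ i, |D i| * C i, ∑ i, k i, Finset.sum_nonneg fun i _ => mul_nonneg (abs_nonneg _) (hC i),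
    fun t ht y R hR hy => ?_⟩
  rw [hp, map_sum, Finset.sum_mul]
  refine (norm_sum_le _ _).trans (Finset.sum_le_sum fun i _ => ?_)
  rw [smul_eval, norm_mul, mul_assoc]
  refine mul_le_mul ((hD i t ht).trans (le_abs_self _)) ((hb i y R hR hy).trans ?_)
    (norm_nonneg _) (abs_nonneg _)
  exact mul_le_mul_of_nonneg_left (pow_le_pow_right₀ hR
    (Finset.single_le_sum (f := k) (fun _ _ => Nat.zero_le _) (Finset.mem_univ i))) (hC i)

/-- Uniform Gaussian decay of a family of functions, for parameters in `I`. -/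
def GaussBddOn {E : Type*} [Norm E] (I : Set ℝ) (f : ℝ → Space d → E) : Prop :=
  ∃ C κ : ℝ, 0 < κ ∧ ∀ t ∈ I, ∀ x, ‖f t x‖ ≤ C * Real.exp (-κ * ‖x‖ ^ 2)

theorem pow_mul_exp_le (k : ℕ) {κ r : ℝ} (hκ : 0 < κ) (hr : 0 ≤ r) :
    (1 + r) ^ k * Real.exp (-κ * r ^ 2)
      ≤ (k.factorial * Real.exp (1 + 1 / (2 * κ))) * Real.exp (-(κ / 2) * r ^ 2) := by
  have h1 : (1 + r) ^ k ≤ k.factorial * Real.exp (1 + r) := by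
    have := Real.pow_div_factorial_le_exp (1 + r) (by positivity) k
    rwa [div_le_iff₀ (by positivity), mul_comm] at this
  have h2 : (1 + r) + -κ * r ^ 2 ≤ (1 + 1 / (2 * κ)) + -(κ / 2) * r ^ 2 := by
    have : 0 ≤ κ / 2 * (r - 1 / κ) ^ 2 := by positivity
    have h3 : κ / 2 * (r - 1 / κ) ^ 2 = κ / 2 * r ^ 2 - r + 1 / (2 * κ) := by
      field_simp; ring
    linarith
  calc _ ≤ (k.factorial * Real.exp (1 + r)) * Real.exp (-κ * r ^ 2) := by gcongr
    _ = k.factorial * Real.exp ((1 + r) + -κ * r ^ 2) := by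
        rw [mul_assoc, ← Real.exp_add]
    _ ≤ k.factorial * Real.exp ((1 + 1 / (2 * κ)) + -(κ / 2) * r ^ 2) := by gcongr
    _ = _ := by rw [Real.exp_add, mul_assoc]

/-- Over a compact set of times, wave packets are dominated by one Gaussian; this provides the
dominating functions for differentiation in `L²`. -/
theorem gaussBddOn_polyPacket {A B : ℝ → Matrix (Fin d) (Fin d) ℂ} {s : ℝ → ℂ} {ħ : ℝ}
    {a η : ℝ → Space d} {p : ℝ → Poly d} (hħ : 0 < ħ) (hAB : ∀ t, Admissible (A t) (B t))
    (hA : ∀ i j, Continuous fun t => A t i j) (hs : Continuous s) (hs0 : ∀ t, s t ≠ 0)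
    (ha : Continuous a) (hp : ContPoly p) {I : Set ℝ} (hI : IsCompact I) :
    GaussBddOn I fun t => polyPacket (A t) (B t) (s t) ħ (a t) (η t) (p t) := by
  choose DA hDA using fun i j => hI.exists_bound_of_continuousOn (hA i j).continuousOn
  obtain ⟨Ca, hCa⟩ := hI.exists_bound_of_continuousOn ha.continuousOn
  obtain ⟨Cs, hCs⟩ := hI.exists_bound_of_continuousOn (hs.inv₀ hs0).continuousOn
  obtain ⟨Cp, k, hCp, hpk⟩ := hp.exists_norm_eval_le hI
  set K : ℝ := ∑ i, ∑ j, |DA i j|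
  have hK : ∀ t ∈ I, ∀ i j, ‖A t i j‖ ≤ K := fun t ht i j =>
    (hDA i j t ht).trans ((le_abs_self _).trans
      ((Finset.single_le_sum (f := fun j => |DA i j|) (fun _ _ => abs_nonneg _)
        (Finset.mem_univ j)).trans (Finset.single_le_sum (f := fun i => ∑ j, |DA i j|)
        (fun _ _ => Finset.sum_nonneg fun _ _ => abs_nonneg _) (Finset.mem_univ i))))
  have hK0 : 0 ≤ K := Finset.sum_nonneg fun _ _ => Finset.sum_nonneg fun _ _ => abs_nonneg _
  set κ : ℝ := 1 / (2 * ħ * (d * K + 1) ^ 2) with hκdef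
  have hκ : 0 < κ := by positivity
  set c0 : ℝ := Real.pi ^ (-(d : ℝ) / 4) * ħ ^ (-(d : ℝ) / 4)
  have hc0 : 0 ≤ c0 := by positivity
  have hg : ∀ t ∈ I, ∀ x, ‖gaussianPacket (A t) (B t) (s t) ħ (a t) (η t) x‖
      ≤ c0 * |Cs| * Real.exp (-κ * ‖x - a t‖ ^ 2) := by
    intro t ht x
    rw [norm_gaussianPacket (hAB t) _ hħ]
    have h1 : ‖s t‖⁻¹ ≤ |Cs| := by
      have := hCs t ht
      rw [Pi.inv_apply, norm_inv] at this
      exact this.trans (le_abs_self _)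
    have h2 : -(∑ n, ‖((A t)⁻¹ *ᵥ disp (a t) x) n‖ ^ 2) / (2 * ħ) ≤ -κ * ‖x - a t‖ ^ 2 := by
      have h3 := norm_sub_sq_le (hAB t) (hK t ht) (a t) x
      set W := ∑ n, ‖((A t)⁻¹ *ᵥ disp (a t) x) n‖ ^ 2
      have hW : 0 ≤ W := Finset.sum_nonneg fun _ _ => by positivity
      have h4 : ‖x - a t‖ ^ 2 ≤ (d * K + 1) ^ 2 * W :=
        h3.trans (by gcongr; linarith)
      rw [neg_div, neg_mul, neg_le_neg_iff, hκdef, one_div_mul_eq_div, div_le_div_iff₀ (by positivity)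
        (by positivity)]
      nlinarith
    gcongr
  refine ⟨Cp * (c0 * |Cs|) * (k.factorial * Real.exp (1 + 1 / (2 * κ))) *
    Real.exp (κ / 2 * Ca ^ 2), κ / 4, by positivity, fun t ht x => ?_⟩
  dsimp only
  rw [polyPacket, norm_mul]
  set r := ‖x - a t‖
  have hr : 0 ≤ r := norm_nonneg _
  have h1 := hpk t ht (disp (a t) x) (1 + r) (by linarith)
    (fun n => (norm_disp_le _ _ _).trans (by linarith))
  have hx : ‖x‖ ^ 2 ≤ 2 * r ^ 2 + 2 * Ca ^ 2 := by
    have h2 : ‖x‖ ≤ r + Ca := by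
      calc ‖x‖ = ‖(x - a t) + a t‖ := by simp
        _ ≤ _ := (norm_add_le _ _).trans (add_le_add le_rfl (hCa t ht))
    calc ‖x‖ ^ 2 ≤ (r + Ca) ^ 2 := by gcongr
      _ ≤ _ := by nlinarith [sq_nonneg (r - Ca)]
  calc _ ≤ (Cp * (1 + r) ^ k) * (c0 * |Cs| * Real.exp (-κ * r ^ 2)) :=
        mul_le_mul h1 (hg t ht x) (norm_nonneg _) (by positivity)
    _ = Cp * (c0 * |Cs|) * ((1 + r) ^ k * Real.exp (-κ * r ^ 2)) := by ring
    _ ≤ Cp * (c0 * |Cs|) * ((k.factorial * Real.exp (1 + 1 / (2 * κ))) *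
          Real.exp (-(κ / 2) * r ^ 2)) :=
        mul_le_mul_of_nonneg_left (pow_mul_exp_le k hκ hr) (by positivity)
    _ ≤ Cp * (c0 * |Cs|) * ((k.factorial * Real.exp (1 + 1 / (2 * κ))) *
          Real.exp (κ / 2 * Ca ^ 2 + -(κ / 4) * ‖x‖ ^ 2)) := by
        gcongr
        nlinarith
    _ = _ := by rw [Real.exp_add (κ / 2 * Ca ^ 2)]; ring

theorem memLp_gaussian {κ : ℝ} (hκ : 0 < κ) :
    MemLp (fun x : Space d => Real.exp (-κ * ‖x‖ ^ 2)) 2 volume := by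
  have hcont : Continuous fun x : Space d => Real.exp (-κ * ‖x‖ ^ 2) := by fun_prop
  rw [memLp_two_iff_integrable_sq hcont.aestronglyMeasurable]
  have h := (GaussianFourier.integrable_cexp_neg_mul_sq_norm_add (V := Space d) (b := 2 * κ)
    (by simpa using hκ) 0 0).norm
  refine h.congr (Filter.Eventually.of_forall fun x => ?_)
  simp only [zero_mul, add_zero]
  rw [Complex.norm_exp, ← Real.exp_nat_mul]
  congr 1
  rw [show (-(2 * (κ : ℂ)) * (‖x‖ : ℂ) ^ 2) = ((-(2 * κ) * ‖x‖ ^ 2 : ℝ) : ℂ) by push_cast; ring,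
    Complex.ofReal_re]
  push_cast
  ring

theorem GaussBddOn.memLp {f : ℝ → Space d → ℂ} {I : Set ℝ} (hf : GaussBddOn I f) {t : ℝ}
    (ht : t ∈ I) (hc : Continuous (f t)) : MemLp (f t) 2 volume := by
  obtain ⟨C, κ, hκ, h⟩ := hf
  exact MemLp.of_le ((memLp_gaussian hκ).const_mul C) hc.aestronglyMeasurable
    (Filter.Eventually.of_forall fun x => (h t ht x).trans (le_abs_self _))

theorem memLp_polyPacket {A B : Matrix (Fin d) (Fin d) ℂ} {s : ℂ} {ħ : ℝ} {a η : Space d}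
    (hħ : 0 < ħ) (h : Admissible A B) (hs : s ≠ 0) (p : Poly d) :
    MemLp (polyPacket A B s ħ a η p) 2 volume :=
  (gaussBddOn_polyPacket (A := fun _ => A) (B := fun _ => B) (s := fun _ => s) (a := fun _ => a)
    (η := fun _ => η) (p := fun _ => p) hħ (fun _ => h) (fun _ _ => continuous_const)
    continuous_const (fun _ => hs) continuous_const (ContPoly.const p)
    (isCompact_singleton (x := (0 : ℝ)))).memLp (Set.mem_singleton 0)
    (contDiff_polyPacket A B s ħ a η p (k := 0)).continuous

end Bounds

/-! ### Integration by parts and orthonormality -/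

section Orthonormality

open MeasureTheory

variable {d : ℕ}

theorem memLp_star {f : Space d → ℂ} (hf : MemLp f 2 volume) :
    MemLp (fun x => star (f x)) 2 volume :=
  hf.star

theorem integrable_star_mul {f g : Space d → ℂ} (hf : MemLp f 2 volume) (hg : MemLp g 2 volume) :
    Integrable (fun x => star (f x) * g x) volume :=
  MemLp.integrable_mul (memLp_star hf) hg

theorem partialDeriv_star {u : Space d → ℂ} (hu : Differentiable ℝ u) (n : Fin d) (x : Space d) :
    partialDeriv n (fun x => star (u x)) x = star (partialDeriv n u x) := by
  unfold partialDeriv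
  rw [((hu x).hasFDerivAt.star).fderiv]
  rfl

/-- Integration by parts for functions that are square integrable together with the derivative
in question. -/
theorem integral_star_partialDeriv_mul {u v : Space d → ℂ} (n : Fin d)
    (hu : Differentiable ℝ u) (hv : Differentiable ℝ v) (hu2 : MemLp u 2 volume)
    (hv2 : MemLp v 2 volume) (hu' : MemLp (partialDeriv n u) 2 volume)
    (hv' : MemLp (partialDeriv n v) 2 volume) :
    ∫ x, star (partialDeriv n u x) * v x = -∫ x, star (u x) * partialDeriv n v x := by
  have h := integral_mul_fderiv_eq_neg_fderiv_mul_of_integrable (μ := volume)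
    (f := fun x => star (u x)) (g := v) (v := EuclideanSpace.single n (1 : ℝ))
    ((integrable_star_mul hu' hv2).congr (Filter.Eventually.of_forall fun x => by
      dsimp only
      rw [← partialDeriv_star hu]; rfl))
    (integrable_star_mul hu2 hv') (integrable_star_mul hu2 hv2)
    (fun x _ => (hu x).star) (fun x _ => hv x)
  have h2 : ∀ x, fderiv ℝ (fun x => star (u x)) x (EuclideanSpace.single n (1 : ℝ))
      = star (partialDeriv n u x) := fun x => partialDeriv_star hu n x
  simp only [h2] at h
  rw [eq_neg_iff_add_eq_zero] at h ⊢
  rw [← h, add_comm]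
  rfl

variable {A B : Matrix (Fin d) (Fin d) ℂ} {s : ℂ} {ħ : ℝ} {a η : Space d}

/-- On wave packets the lowering operators are adjoint to the raising operators. -/
theorem integral_star_lowerOp_mul (h : Admissible A B) (hħ : 0 < ħ) (hs : s ≠ 0) (m : Fin d)
    (p q : Poly d) :
    ∫ x, star (polyPacket A B s ħ a η (lowerOp A ħ m p) x) * polyPacket A B s ħ a η q x
      = ∫ x, star (polyPacket A B s ħ a η p x) * polyPacket A B s ħ a η (raiseOp A ħ m q) x := by
  have hσ := sqrt_two_mul_ne_zero hħ
  have hħ' : (ħ : ℂ) ≠ 0 := Complex.ofReal_ne_zero.mpr hħ.ne'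
  have hσ2 : (√(2 * ħ) : ℂ) ^ 2 = 2 * ħ := by
    rw [← Complex.ofReal_pow, Real.sq_sqrt (by positivity)]; push_cast; rfl
  set σ : ℂ := (√(2 * ħ) : ℂ) with hσdef
  have hσstar : star σ = σ := by rw [hσdef]; simp
  have hint : ∀ p q : Poly d, Integrable (fun x => star (polyPacket A B s ħ a η p x)
      * polyPacket A B s ħ a η q x) volume := fun p q =>
    integrable_star_mul (memLp_polyPacket hħ h hs p) (memLp_polyPacket hħ h hs q)
  have hdiff : ∀ p : Poly d, Differentiable ℝ (polyPacket A B s ħ a η p) := fun p =>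
    (contDiff_polyPacket A B s ħ a η p (k := 1)).differentiable one_ne_zero
  set D := covDeriv (B * A⁻¹) ħ η
  have hparts : ∀ n, ∫ x, (star (polyPacket A B s ħ a η (D n p) x) * polyPacket A B s ħ a η q x
      + star (polyPacket A B s ħ a η p x) * polyPacket A B s ħ a η (D n q) x) = 0 := by
    intro n
    rw [integral_add (hint _ _) (hint _ _)]
    have := integral_star_partialDeriv_mul n (hdiff p) (hdiff q) (memLp_polyPacket hħ h hs p)
      (memLp_polyPacket hħ h hs q)
      (by rw [partialDeriv_polyPacket h]; exact memLp_polyPacket hħ h hs _)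
      (by rw [partialDeriv_polyPacket h]; exact memLp_polyPacket hħ h hs _)
    rw [partialDeriv_polyPacket h, partialDeriv_polyPacket h] at this
    rw [this, neg_add_cancel]
  rw [← sub_eq_zero, ← integral_sub (hint _ _) (hint _ _)]
  have hpt : ∀ x, star (polyPacket A B s ħ a η (lowerOp A ħ m p) x) * polyPacket A B s ħ a η q x
      - star (polyPacket A B s ħ a η p x) * polyPacket A B s ħ a η (raiseOp A ħ m q) x
      = ∑ n, (σ / 2 * star (A n m)) *
        (star (polyPacket A B s ħ a η (D n p) x) * polyPacket A B s ħ a η q x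
      + star (polyPacket A B s ħ a η p x) * polyPacket A B s ħ a η (D n q) x) := by
    intro x
    set v := disp a x with hv
    have hkey : ∑ n, star (A n m) * ((B * A⁻¹) n ⬝ᵥ v + star ((B * A⁻¹) n ⬝ᵥ v))
        = 2 * (A⁻¹ m ⬝ᵥ v) := by
      have h1 : Aᴴ * (B * A⁻¹ + (B * A⁻¹)ᴴ) = (2 : ℂ) • A⁻¹ := by
        rw [h.add_conjTranspose, Matrix.mul_smul, ← Matrix.mul_assoc, h.conj_mul_inv,
          Matrix.one_mul]
      have h2 := congrFun (congrArg (· *ᵥ v) h1) m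
      simp only [smul_mulVec, Pi.smul_apply, smul_eq_mul] at h2
      rw [← mulVec_mulVec, add_mulVec] at h2
      refine Eq.trans (Finset.sum_congr rfl fun n _ => ?_) h2
      congr 2
      have h3 : star ((B * A⁻¹) n ⬝ᵥ v) = star v ⬝ᵥ star ((B * A⁻¹) n) :=
        (star_dotProduct_star _ _).symm
      rw [h3, hv, star_disp, dotProduct_comm]
      congr 1
      funext k
      have h4 : (B * A⁻¹) n k = (B * A⁻¹) k n := congrFun (congrFun h.symm k) n
      rw [Pi.star_apply, h4, conjTranspose_apply]
    have hD : ∀ n (p : Poly d), polyPacket A B s ħ a η (D n p) x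
        = (eval v (pderiv n p) + (Complex.I * (η n : ℂ) / ħ - 1 / ħ * ((B * A⁻¹) n ⬝ᵥ v)) * eval v p)
          * gaussianPacket A B s ħ a η x := by
      intro n p
      simp only [polyPacket, D, covDeriv, logDeriv, map_add, map_mul, map_sub, eval_C, smul_eval,
        eval_linForm, hv]
    have hR : polyPacket A B s ħ a η (raiseOp A ħ m q) x
        = (2 / σ * (A⁻¹ m ⬝ᵥ v) * eval v q
            - ∑ n, σ / 2 * star (A n m) * eval v (pderiv n q)) * gaussianPacket A B s ħ a η x := by
      rw [polyPacket, raiseOp, firstOrder_apply, dirDeriv_eq_sum]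
      simp only [map_add, map_mul, eval_linForm, map_sum, smul_eval, ← hσdef, ← hv]
      congr 1
      simp only [dotProduct, Finset.mul_sum, sub_eq_add_neg, ← Finset.sum_neg_distrib]
      congr 1
      · congr 1; exact Finset.sum_congr rfl fun n _ => by ring
      · exact Finset.sum_congr rfl fun n _ => by ring
    have hL : polyPacket A B s ħ a η (lowerOp A ħ m p) x
        = (∑ n, σ / 2 * A n m * eval v (pderiv n p)) * gaussianPacket A B s ħ a η x := by
      rw [polyPacket, lowerOp_apply, dirDeriv_eq_sum]
      simp only [map_sum, smul_eval, ← hσdef, ← hv]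
    have hp : ∀ p, polyPacket A B s ħ a η p x = eval v p * gaussianPacket A B s ħ a η x :=
      fun p => rfl
    set g := gaussianPacket A B s ħ a η x
    simp only [hD, hR, hL, hp]
    have hterm : ∀ n, σ / 2 * star (A n m) * (star ((eval v (pderiv n p)
          + (Complex.I * (η n : ℂ) / ħ - 1 / ħ * ((B * A⁻¹) n ⬝ᵥ v)) * eval v p) * g)
          * (eval v q * g) + star (eval v p * g) * ((eval v (pderiv n q)
          + (Complex.I * (η n : ℂ) / ħ - 1 / ħ * ((B * A⁻¹) n ⬝ᵥ v)) * eval v q) * g))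
        = star (σ / 2 * A n m * eval v (pderiv n p)) * (star g * g * eval v q)
          + (σ / 2 * star (A n m) * eval v (pderiv n q)) * (star g * g * star (eval v p))
          + (star (A n m) * ((B * A⁻¹) n ⬝ᵥ v + star ((B * A⁻¹) n ⬝ᵥ v)))
            * (-(σ / (2 * ħ)) * (star g * g * star (eval v p) * eval v q)) := by
      intro n
      have e1 : star (Complex.I * (η n : ℂ) / ħ - 1 / ħ * ((B * A⁻¹) n ⬝ᵥ v))
          = -(Complex.I * (η n : ℂ) / ħ) - 1 / ħ * star ((B * A⁻¹) n ⬝ᵥ v) := by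
        simp [neg_div]
      have e2 : star (σ / 2) = σ / 2 := by
        rw [Complex.star_def, map_div₀, ← Complex.star_def, hσstar]; simp
      rw [star_mul', star_add, star_mul', e1, star_mul', star_mul' (σ / 2 * A n m), star_mul', e2]
      ring
    simp only [hterm, Finset.sum_add_distrib, ← Finset.sum_mul]
    rw [hkey, star_mul', star_mul', star_sum]
    have e3 : σ / (2 * ħ) = 1 / σ := by rw [← hσ2]; field_simp
    rw [e3]
    ring
  simp only [hpt]
  rw [integral_finsetSum _ fun n _ => ((hint _ _).fun_add (hint _ _)).const_mul _]
  refine Finset.sum_eq_zero fun n _ => ?_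
  rw [integral_const_mul, hparts, mul_zero]

/-- The Gaussian wave packet is normalized. -/
theorem integral_star_gaussian_mul (h : Admissible A B) (hħ : 0 < ħ) (hs : s ^ 2 = A.det) :
    ∫ x, star (gaussianPacket A B s ħ a η x) * gaussianPacket A B s ħ a η x = 1 := by
  have hs0 : s ≠ 0 := by
    rintro rfl
    exact h.det_ne_zero (by rw [← hs]; simp)
  set P : Matrix (Fin d) (Fin d) ℂ := (A⁻¹)ᴴ * A⁻¹ with hP
  set Pr : Matrix (Fin d) (Fin d) ℝ := P.map Complex.re with hPr
  have hPreal : P = Pr.map (fun r : ℝ => (r : ℂ)) := by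
    ext i j
    have h1 : star (P j i) = P i j := by
      have : Pᴴ = P := by rw [hP, conjTranspose_mul, conjTranspose_conjTranspose]
      exact congrFun (congrFun this i) j
    have h2 : P j i = P i j := congrFun (congrFun h.gram_transpose i) j
    rw [h2] at h1
    simp only [hPr, map_apply]
    exact ((Complex.conj_eq_iff_re).mp h1).symm
  have hquad : ∀ y : Fin d → ℝ, ((y ⬝ᵥ Pr *ᵥ y : ℝ) : ℂ)
      = ((∑ n, ‖(A⁻¹ *ᵥ fun k => (y k : ℂ)) n‖ ^ 2 : ℝ) : ℂ) := by
    intro y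
    set w : Fin d → ℂ := fun k => (y k : ℂ) with hw
    have h1 : ((y ⬝ᵥ Pr *ᵥ y : ℝ) : ℂ) = w ⬝ᵥ P *ᵥ w := by
      rw [hPreal]
      simp [dotProduct, mulVec, hw]
    have hwstar : star w = w := by funext k; simp [hw]
    rw [h1, hP, ← mulVec_mulVec, dotProduct_mulVec]
    nth_rewrite 1 [← hwstar]
    rw [← star_mulVec]
    simp only [dotProduct, Pi.star_apply, Complex.ofReal_sum]
    refine Finset.sum_congr rfl fun n _ => ?_
    rw [Complex.star_def, ← Complex.normSq_eq_conj_mul_self, Complex.normSq_eq_norm_sq]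
  have hpos : Pr.PosSemidef := by
    refine PosSemidef.of_dotProduct_mulVec_nonneg ?_ fun y => ?_
    · ext i j
      have h2 : P j i = P i j := congrFun (congrFun h.gram_transpose i) j
      simp only [conjTranspose_apply, hPr, map_apply, h2, star_trivial]
    · rw [star_trivial, Complex.ofReal_inj.mp (hquad y)]
      exact Finset.sum_nonneg fun _ _ => by positivity
  obtain ⟨Q, hQ⟩ : ∃ Q : Matrix (Fin d) (Fin d) ℝ, Pr = Qᵀ * Q := by
    open scoped MatrixOrder Matrix.Norms.L2Operator in
    obtain ⟨Q, hQ⟩ := CStarAlgebra.nonneg_iff_eq_star_mul_self.mp hpos.nonneg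
    exact ⟨Q, hQ⟩
  have hdet : |Q.det| = ‖A.det‖⁻¹ := by
    have h1 : P.det = ((‖A.det‖⁻¹ ^ 2 : ℝ) : ℂ) := by
      rw [hP, det_mul, det_conjTranspose, det_nonsing_inv, Ring.inverse_eq_inv',
        Complex.star_def, ← Complex.normSq_eq_conj_mul_self, Complex.normSq_eq_norm_sq, norm_inv]
    have h2 : P.det = ((Q.det ^ 2 : ℝ) : ℂ) := by
      rw [hPreal, show (Pr.map fun r : ℝ => (r : ℂ)) = Complex.ofRealHom.mapMatrix Pr from rfl,
        ← RingHom.map_det, hQ, det_mul, det_transpose, sq]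
      rfl
    rw [h1, Complex.ofReal_inj] at h2
    rw [← abs_of_nonneg (show 0 ≤ ‖A.det‖⁻¹ by positivity)]
    exact ((sq_eq_sq_iff_abs_eq_abs _ _).mp h2).symm
  have hdet0 : Q.det ≠ 0 := by
    rw [← abs_ne_zero, hdet]
    exact inv_ne_zero (norm_ne_zero_iff.mpr h.det_ne_zero)
  set L := Matrix.toLpLin 2 2 Q
  set c0 : ℝ := Real.pi ^ (-(d : ℝ) / 4) * ħ ^ (-(d : ℝ) / 4) with hc0
  have hLdet : LinearMap.det L = Q.det := by simp [L]
  have hnorm : ∀ x : Space d, ∑ n, ‖(A⁻¹ *ᵥ disp a x) n‖ ^ 2 = ‖L (x - a)‖ ^ 2 := by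
    intro x
    have h1 := Complex.ofReal_inj.mp (hquad (fun k => x k - a k))
    rw [show A⁻¹ *ᵥ disp a x = A⁻¹ *ᵥ fun k => ((x k - a k : ℝ) : ℂ) from rfl, ← h1, hQ,
      ← mulVec_mulVec, dotProduct_mulVec, vecMul_transpose, EuclideanSpace.norm_sq_eq]
    simp only [dotProduct]
    refine Finset.sum_congr rfl fun n _ => ?_
    rw [Real.norm_eq_abs, sq_abs, sq]
    rfl
  have hpt : ∀ x, star (gaussianPacket A B s ħ a η x) * gaussianPacket A B s ħ a η x
      = ((c0 ^ 2 * ‖A.det‖⁻¹ * Real.exp (-(1 / ħ) * ‖L (x - a)‖ ^ 2) : ℝ) : ℂ) := by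
    intro x
    rw [Complex.star_def, ← Complex.normSq_eq_conj_mul_self, Complex.normSq_eq_norm_sq,
      norm_gaussianPacket h s hħ, ← hs, norm_pow, hnorm]
    congr 1
    rw [mul_pow, mul_pow, ← Real.exp_nat_mul, inv_pow]
    congr 2
    field_simp
    push_cast
    ring
  simp only [hpt]
  rw [integral_complex_ofReal, integral_const_mul,
    integral_sub_right_eq_self (fun x => Real.exp (-(1 / ħ) * ‖L x‖ ^ 2)) a]
  have hmap := Measure.map_linearMap_addHaar_eq_smul_addHaar (volume : Measure (Space d))
    (f := L) (by rw [hLdet]; exact hdet0)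
  have hLc : Continuous L := L.continuous_of_finiteDimensional
  have hint : ∫ x, Real.exp (-(1 / ħ) * ‖L x‖ ^ 2)
      = ‖A.det‖ * (Real.pi / (1 / ħ)) ^ (Module.finrank ℝ (Space d) / 2 : ℝ) := by
    rw [← GaussianFourier.integral_rexp_neg_mul_sq_norm (V := Space d) (b := 1 / ħ) (by positivity)]
    have h1 := integral_map (μ := (volume : Measure (Space d))) hLc.measurable.aemeasurable
      (f := fun x : Space d => Real.exp (-(1 / ħ) * ‖x‖ ^ 2))
      (Continuous.aestronglyMeasurable (by fun_prop))
    rw [← h1, hmap, integral_smul_measure, hLdet, abs_inv, hdet, inv_inv,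
      ENNReal.toReal_ofReal (norm_nonneg _), smul_eq_mul]
  rw [hint, finrank_euclideanSpace, Fintype.card_fin]
  have hA0 : ‖A.det‖ ≠ 0 := norm_ne_zero_iff.mpr h.det_ne_zero
  have hc : c0 ^ 2 * (Real.pi / (1 / ħ)) ^ (d / 2 : ℝ) = 1 := by
    rw [hc0, ← Real.mul_rpow Real.pi_pos.le hħ.le, ← Real.rpow_natCast, ← Real.rpow_mul
      (by positivity), div_div_eq_mul_div, div_one, ← Real.rpow_add (by positivity)]
    convert Real.rpow_zero _ using 2
    push_cast
    ring
  rw [show c0 ^ 2 * ‖A.det‖⁻¹ * (‖A.det‖ * (Real.pi / (1 / ħ)) ^ (d / 2 : ℝ))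
    = (c0 ^ 2 * (Real.pi / (1 / ħ)) ^ (d / 2 : ℝ)) * (‖A.det‖⁻¹ * ‖A.det‖) by ring, hc,
    inv_mul_cancel₀ hA0]
  simp

/-- The wave packets `φ_j` are orthonormal. -/
theorem integral_hermitePoly (h : Admissible A B) (hħ : 0 < ħ) (hs : s ^ 2 = A.det)
    (k j : Fin d → ℕ) :
    ∫ x, star (polyPacket A B s ħ a η (hermitePoly A ħ k) x)
      * polyPacket A B s ħ a η (hermitePoly A ħ j) x = if k = j then 1 else 0 := by
  have hs0 : s ≠ 0 := by
    rintro rfl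
    exact h.det_ne_zero (by rw [← hs]; simp)
  set I : Poly d → Poly d → ℂ := fun p q => ∫ x, star (polyPacket A B s ħ a η p x)
    * polyPacket A B s ħ a η q x with hI
  have hadj : ∀ m p q, I (lowerOp A ħ m p) q = I p (raiseOp A ħ m q) :=
    fun m p q => integral_star_lowerOp_mul h hħ hs0 m p q
  have hsymm : ∀ p q, I q p = star (I p q) := by
    intro p q
    simp only [hI]
    rw [Complex.star_def, ← integral_conj]
    refine integral_congr_ae (Filter.Eventually.of_forall fun x => ?_)
    simp [mul_comm]
  have hsm : ∀ c p q, I p (c • q) = c * I p q := by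
    intro c p q
    simp only [hI, polyPacket_smul]
    rw [← integral_const_mul]
    refine integral_congr_ae (Filter.Eventually.of_forall fun x => ?_)
    ring_nf
  have hz : ∀ q, I 0 q = 0 := by
    intro q; simp [hI, polyPacket]
  have hadj' : ∀ m p q, I (raiseOp A ħ m p) q = I p (lowerOp A ħ m q) := by
    intro m p q
    rw [hsymm, ← hadj, ← hsymm]
  have hsm' : ∀ c p q, I (c • p) q = star c * I p q := by
    intro c p q; rw [hsymm, hsm, star_mul', ← hsymm]
  have hsq : ∀ n : ℕ, (((√(n + 1) : ℝ) : ℂ)) ≠ 0 := fun n =>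
    Complex.ofReal_ne_zero.mpr (Real.sqrt_ne_zero'.mpr (by positivity))
  change I _ _ = _
  induction k using multiIndex_induction generalizing j with
  | h0 =>
    rw [hermitePoly_zero]
    by_cases hj : (0 : Fin d → ℕ) = j
    · subst hj
      rw [hermitePoly_zero, if_pos rfl]
      simp only [hI, polyPacket, map_one, one_mul]
      exact integral_star_gaussian_mul h hħ hs
    · rw [if_neg hj]
      obtain ⟨m, hm⟩ : ∃ m, j m ≠ 0 := by
        by_contra hcon
        push Not at hcon
        exact hj (funext fun m => (hcon m).symm)
      obtain ⟨j', rfl⟩ : ∃ j', j = j' + Pi.single m 1 :=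
        ⟨j - Pi.single m 1, by
          funext i
          by_cases hi : i = m
          · subst hi; simp; omega
          · simp [Pi.single_eq_of_ne hi]⟩
      have h1 := hadj m 1 (hermitePoly A ħ j')
      rw [lowerOp_one, hz, raiseOp_hermitePoly h hħ, hsm] at h1
      exact (mul_eq_zero.mp h1.symm).resolve_left (hsq _)
  | hs k m ih =>
    have h1 := hadj' m (hermitePoly A ħ k) (hermitePoly A ħ j)
    rw [raiseOp_hermitePoly h hħ, hsm'] at h1
    have h2 : star (((√(k m + 1) : ℝ) : ℂ)) ≠ 0 := star_ne_zero.mpr (hsq _)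
    by_cases hj : j m = 0
    · rw [lowerOp_hermitePoly_of_eq_zero h hħ hj, hsymm 0, hz, star_zero] at h1
      rw [(mul_eq_zero.mp h1).resolve_left h2, if_neg]
      rintro rfl
      simp at hj
    · obtain ⟨j', rfl⟩ : ∃ j', j = j' + Pi.single m 1 :=
        ⟨j - Pi.single m 1, by
          funext i
          by_cases hi : i = m
          · subst hi; simp; omega
          · simp [Pi.single_eq_of_ne hi]⟩
      rw [lowerOp_hermitePoly_add h hħ, hsm, ih] at h1
      by_cases hk : k = j'
      · subst hk
        rw [if_pos rfl, mul_one] at h1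
        rw [if_pos rfl]
        have h3 : star (((√(k m + 1) : ℝ) : ℂ)) = ((√(k m + 1) : ℝ) : ℂ) := Complex.conj_ofReal _
        rw [h3] at h1 h2
        exact mul_left_cancel₀ h2 (by rw [h1, mul_one])
      · rw [if_neg hk, mul_zero] at h1
        rw [(mul_eq_zero.mp h1).resolve_left h2, if_neg]
        intro hkj
        exact hk (add_right_cancel hkj)

end Orthonormality

/-! ### Matrices depending on time -/

section MatrixCurves

variable {d : ℕ}

/-- Entrywise differentiability of a curve of matrices. -/
def MatDeriv (F : ℝ → Matrix (Fin d) (Fin d) ℂ) (F' : Matrix (Fin d) (Fin d) ℂ) (t : ℝ) : Prop :=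
  ∀ i j, HasDerivAt (fun r => F r i j) (F' i j) t

variable {F G : ℝ → Matrix (Fin d) (Fin d) ℂ} {F' G' : Matrix (Fin d) (Fin d) ℂ} {t : ℝ}

theorem MatDeriv.congr_deriv {F'' : Matrix (Fin d) (Fin d) ℂ} (h : MatDeriv F F' t)
    (e : F' = F'') : MatDeriv F F'' t := e ▸ h

theorem MatDeriv.mul (hF : MatDeriv F F' t) (hG : MatDeriv G G' t) :
    MatDeriv (fun r => F r * G r) (F' * G t + F t * G') t := fun i j =>
  hasDerivAt_dotProduct (y := fun r => F r i) (z := fun r k => G r k j) (hF i) (fun k => hG k j)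

theorem MatDeriv.transpose (hF : MatDeriv F F' t) : MatDeriv (fun r => (F r)ᵀ) F'ᵀ t :=
  fun i j => hF j i

theorem MatDeriv.conjTranspose (hF : MatDeriv F F' t) : MatDeriv (fun r => (F r)ᴴ) F'ᴴ t :=
  fun i j => (hF j i).star

theorem MatDeriv.add (hF : MatDeriv F F' t) (hG : MatDeriv G G' t) :
    MatDeriv (fun r => F r + G r) (F' + G') t := fun i j => (hF i j).fun_add (hG i j)

theorem MatDeriv.sub (hF : MatDeriv F F' t) (hG : MatDeriv G G' t) :
    MatDeriv (fun r => F r - G r) (F' - G') t := fun i j => (hF i j).fun_sub (hG i j)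

theorem matDeriv_const (M : Matrix (Fin d) (Fin d) ℂ) : MatDeriv (fun _ => M) 0 t :=
  fun _ _ => hasDerivAt_const _ _

theorem MatDeriv.unique (hF : MatDeriv F F' t) (hG : MatDeriv F G' t) : F' = G' := by
  ext i j; exact (hF i j).unique (hG i j)

theorem eq_of_matDeriv_zero (h : ∀ t, MatDeriv F 0 t) (t : ℝ) : F t = F 0 := by
  ext i j
  exact is_const_of_deriv_eq_zero (fun r => (h r i j).differentiableAt)
    (fun r => (h r i j).deriv) t 0

/-- The derivative of the determinant at the identity is the trace. -/
theorem MatDeriv.det_of_eq_one (hF : MatDeriv F F' t) (h1 : F t = 1) :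
    HasDerivAt (fun r => (F r).det) F'.trace t := by
  have h : HasDerivAt (fun r => (F r).det) (∑ σ : Equiv.Perm (Fin d),
      (Equiv.Perm.sign σ : ℂ) * ∑ i, (∏ j ∈ Finset.univ.erase i, F t (σ j) j) * F' (σ i) i) t := by
    simp only [det_apply']
    refine HasDerivAt.fun_sum fun σ _ => HasDerivAt.const_mul _ ?_
    have := HasDerivAt.fun_finsetProd (u := Finset.univ) (f := fun i r => F r (σ i) i)
      (f' := fun i => F' (σ i) i) (x := t) (fun i _ => hF (σ i) i)
    simpa only [smul_eq_mul] using this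
  refine h.congr_deriv ?_
  rw [Finset.sum_eq_single 1]
  · simp [h1, trace]
  · intro σ _ hσ
    refine mul_eq_zero_of_right _ (Finset.sum_eq_zero fun i _ => mul_eq_zero_of_left ?_ _)
    obtain ⟨j, hji, hj⟩ : ∃ j, j ≠ i ∧ σ j ≠ j := by
      by_contra hcon
      push Not at hcon
      have hi : σ i = i := by
        by_contra hi
        have h2 := hcon (σ i) hi
        exact hi (σ.injective h2)
      exact hσ (Equiv.ext fun j => by
        by_cases hj : j = i
        · rw [hj, hi]; rfl
        · rw [hcon j hj]; rfl)
    refine Finset.prod_eq_zero (Finset.mem_erase.mpr ⟨hji, Finset.mem_univ j⟩) ?_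
    rw [h1, one_apply_ne hj]
  · simp

/-- Jacobi's formula. -/
theorem MatDeriv.det (hF : MatDeriv F F' t) (hu : IsUnit (F t).det) :
    HasDerivAt (fun r => (F r).det) ((F t).det * ((F t)⁻¹ * F').trace) t := by
  have h := ((matDeriv_const (t := t) (F t)⁻¹).mul hF).det_of_eq_one
    (nonsing_inv_mul _ hu)
  rw [Matrix.zero_mul, zero_add] at h
  have h2 := h.const_mul (F t).det
  have h3 : (fun r => (F t).det * ((F t)⁻¹ * F r).det) = fun r => (F r).det := by
    funext r
    rw [det_mul, ← mul_assoc, ← det_mul, mul_nonsing_inv _ hu, det_one, one_mul]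
  rwa [h3] at h2

theorem MatDeriv.differentiableAt_det (hF : ∀ i j, DifferentiableAt ℝ (fun r => F r i j) t) :
    DifferentiableAt ℝ (fun r => (F r).det) t := by
  simp only [det_apply']
  refine DifferentiableAt.fun_sum fun σ _ => DifferentiableAt.const_mul ?_ _
  have := HasDerivAt.fun_finsetProd (u := Finset.univ) (f := fun i r => F r (σ i) i)
    (x := t) (fun i _ => (hF (σ i) i).hasDerivAt)
  exact this.differentiableAt

theorem MatDeriv.inv (hF : MatDeriv F F' t) (hu : ∀ r, IsUnit (F r).det) :
    MatDeriv (fun r => (F r)⁻¹) (-((F t)⁻¹ * F' * (F t)⁻¹)) t := by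
  have hd : ∀ i j, DifferentiableAt ℝ (fun r => (F r)⁻¹ i j) t := by
    intro i j
    simp only [inv_def, Ring.inverse_eq_inv', Matrix.smul_apply, smul_eq_mul, adjugate_apply]
    have h1 : DifferentiableAt ℝ (fun r => (F r).det) t :=
      MatDeriv.differentiableAt_det fun i j => (hF i j).differentiableAt
    have h2 : DifferentiableAt ℝ (fun r => ((F r).updateRow j (Pi.single i 1)).det) t := by
      refine MatDeriv.differentiableAt_det fun k l => ?_
      by_cases hk : k = j
      · subst hk; simp
      · simpa [updateRow_ne hk] using (hF k l).differentiableAt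
    exact (h1.fun_inv (hu t).ne_zero).fun_mul h2
  have hX : MatDeriv (fun r => (F r)⁻¹) (Matrix.of fun i j => deriv (fun r => (F r)⁻¹ i j) t) t :=
    fun i j => (hd i j).hasDerivAt
  set X : Matrix (Fin d) (Fin d) ℂ := Matrix.of fun i j => deriv (fun r => (F r)⁻¹ i j) t
  have h1 : F' * (F t)⁻¹ + F t * X = 0 := by
    have h2 := hF.mul hX
    have h3 : (fun r => F r * (F r)⁻¹) = fun _ => 1 := funext fun r => mul_nonsing_inv _ (hu r)
    rw [h3] at h2
    exact h2.unique (matDeriv_const 1)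
  refine hX.congr_deriv ?_
  calc X = (F t)⁻¹ * (F t * X) := by
        rw [← Matrix.mul_assoc, nonsing_inv_mul _ (hu t), Matrix.one_mul]
    _ = _ := by rw [eq_neg_of_add_eq_zero_right h1, Matrix.mul_neg, Matrix.mul_assoc]

/-- A continuous square root of a differentiable nonvanishing function is differentiable. -/
theorem hasDerivAt_of_sq {s f : ℝ → ℂ} {f' : ℂ} (hs : Continuous s) (hsq : ∀ r, s r ^ 2 = f r)
    (h0 : s t ≠ 0) (hf : HasDerivAt f f' t) : HasDerivAt s (f' / (2 * s t)) t := by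
  rw [hasDerivAt_iff_tendsto_slope] at hf ⊢
  have hlim : Filter.Tendsto (fun r => s r + s t) (nhdsWithin t {t}ᶜ) (nhds (2 * s t)) := by
    rw [two_mul]
    exact ((hs.tendsto t).mono_left nhdsWithin_le_nhds).add tendsto_const_nhds
  have h2 : (2 * s t) ≠ 0 := mul_ne_zero two_ne_zero h0
  refine (hf.div hlim h2).congr' ?_
  filter_upwards [hlim.eventually_ne h2] with r hr
  rw [Pi.div_apply, slope_def_module, slope_def_module, ← hsq, ← hsq, Complex.real_smul,
    Complex.real_smul]
  field_simp
  ring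

end MatrixCurves

/-! ### Time-dependent polynomials -/

section DiffPoly

variable {d : ℕ}

/-- `p` is a curve of polynomials with derivative `p'`: a finite combination of fixed polynomials
with differentiable scalar coefficients. -/
def DiffPoly (p p' : ℝ → Poly d) : Prop :=
  ∃ (ι : Type) (_ : Fintype ι) (f f' : ι → ℝ → ℂ) (b : ι → Poly d),
    (∀ i t, HasDerivAt (f i) (f' i t) t) ∧ (∀ t, p t = ∑ i, f i t • b i) ∧
      ∀ t, p' t = ∑ i, f' i t • b i

theorem DiffPoly.congr {p p' q' : ℝ → Poly d} (h : DiffPoly p p') (e : ∀ t, p' t = q' t) :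
    DiffPoly p q' := by
  rwa [← funext e]

theorem DiffPoly.contPoly {p p' : ℝ → Poly d} (h : DiffPoly p p') : ContPoly p := by
  obtain ⟨ι, _, f, f', b, hf, hp, -⟩ := h
  exact ⟨ι, inferInstance, f, b, fun i =>
    continuous_iff_continuousAt.mpr fun t => (hf i t).continuousAt, hp⟩

theorem DiffPoly.const (b : Poly d) : DiffPoly (fun _ => b) fun _ => 0 :=
  ⟨Unit, inferInstance, fun _ _ => 1, fun _ _ => 0, fun _ => b,
    fun _ _ => hasDerivAt_const _ _, fun t => by simp, fun t => by simp⟩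

theorem DiffPoly.add {p p' q q' : ℝ → Poly d} (hp : DiffPoly p p') (hq : DiffPoly q q') :
    DiffPoly (fun t => p t + q t) fun t => p' t + q' t := by
  obtain ⟨ι, _, f, f', b, hf, hp, hp'⟩ := hp
  obtain ⟨κ, _, g, g', c, hg, hq, hq'⟩ := hq
  exact ⟨ι ⊕ κ, inferInstance, Sum.elim f g, Sum.elim f' g', Sum.elim b c, by
    rintro (i | i) t; exacts [hf i t, hg i t], fun t => by simp [hp, hq],
    fun t => by simp [hp', hq']⟩

theorem DiffPoly.smul {p p' : ℝ → Poly d} (hp : DiffPoly p p') {g g' : ℝ → ℂ}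
    (hg : ∀ t, HasDerivAt g (g' t) t) :
    DiffPoly (fun t => g t • p t) fun t => g' t • p t + g t • p' t := by
  obtain ⟨ι, _, f, f', b, hf, hp, hp'⟩ := hp
  refine ⟨ι, inferInstance, fun i t => g t * f i t, fun i t => g' t * f i t + g t * f' i t, b,
    fun i t => (hg t).fun_mul (hf i t), fun t => ?_, fun t => ?_⟩
  · simp [hp, Finset.smul_sum, mul_smul]
  · simp [hp, hp', Finset.smul_sum, mul_smul, add_smul, Finset.sum_add_distrib]

theorem DiffPoly.map {p p' : ℝ → Poly d} (hp : DiffPoly p p') (L : Poly d →ₗ[ℂ] Poly d) :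
    DiffPoly (fun t => L (p t)) fun t => L (p' t) := by
  obtain ⟨ι, _, f, f', b, hf, hp, hp'⟩ := hp
  exact ⟨ι, inferInstance, f, f', fun i => L (b i), hf, fun t => by simp [hp],
    fun t => by simp [hp']⟩

theorem DiffPoly.sum {κ : Type*} (S : Finset κ) {p p' : κ → ℝ → Poly d}
    (hp : ∀ k ∈ S, DiffPoly (p k) (p' k)) :
    DiffPoly (fun t => ∑ k ∈ S, p k t) fun t => ∑ k ∈ S, p' k t := by
  classical
  induction S using Finset.induction_on with
  | empty => simpa using DiffPoly.const 0
  | insert k S hk ih =>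
    simp only [Finset.sum_insert hk]
    exact (hp k (by simp)).add (ih fun i hi => hp i (by simp [hi]))

theorem DiffPoly.firstOrder {p p' : ℝ → Poly d} (hp : DiffPoly p p') {u u' v v' : ℝ → Fin d → ℂ}
    (hu : ∀ t n, HasDerivAt (fun r => u r n) (u' t n) t)
    (hv : ∀ t n, HasDerivAt (fun r => v r n) (v' t n) t) :
    DiffPoly (fun t => firstOrder (u t) (v t) (p t))
      fun t => firstOrder (u' t) (v' t) (p t) + firstOrder (u t) (v t) (p' t) := by
  have h1 := DiffPoly.sum Finset.univ fun n _ =>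
    (hp.map (LinearMap.mulLeft ℂ (X n))).smul (fun t => hu t n)
  have h2 := DiffPoly.sum Finset.univ fun n _ =>
    (hp.map (pderiv n : Derivation ℂ (Poly d) (Poly d)).toLinearMap).smul (fun t => hv t n)
  have h3 := h1.add h2
  simp only [firstOrder_apply, linForm, Finset.sum_mul, smul_mul_assoc, dirDeriv_eq_sum]
  refine h3.congr fun t => ?_
  simp only [LinearMap.mulLeft_apply, Derivation.coeFn_coe,
    Finset.sum_add_distrib]
  abel

theorem DiffPoly.hasDerivAt_eval {p p' : ℝ → Poly d} (hp : DiffPoly p p') {y : ℝ → Fin d → ℂ}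
    {y' : Fin d → ℂ} {t : ℝ} (hy : ∀ n, HasDerivAt (fun r => y r n) (y' n) t) :
    HasDerivAt (fun r => eval (y r) (p r))
      (eval (y t) (p' t) + eval (y t) (dirDeriv y' (p t))) t := by
  obtain ⟨ι, _, f, f', b, hf, hp, hp'⟩ := hp
  simp only [hp, hp', map_sum, smul_eval, Derivation.map_smul, ← Finset.sum_add_distrib]
  exact HasDerivAt.fun_sum fun i _ => (hf i t).fun_mul (Hagedorn.hasDerivAt_eval hy (b i))

end DiffPoly

/-! ### Evolution of wave packets under the quadratic Hamiltonian -/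

section Flow

variable {d : ℕ} {V : Space d → ℝ} {a η : ℝ → Space d} {A B : ℝ → Matrix (Fin d) (Fin d) ℂ}
  {S : ℝ → ℝ}

/-- The Hessian as a complex matrix. -/
noncomputable def hessianC (V : Space d → ℝ) (x : Space d) : Matrix (Fin d) (Fin d) ℂ :=
  (hessian V x).map fun r : ℝ => (r : ℂ)

theorem partialDeriv_partialDeriv (hV : ContDiff ℝ 2 V) (i j : Fin d) (x : Space d) :
    partialDeriv i (partialDeriv j V) x
      = fderiv ℝ (fderiv ℝ V) x (EuclideanSpace.single i 1) (EuclideanSpace.single j 1) := by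
  have h1 : DifferentiableAt ℝ (fderiv ℝ V) x :=
    ((hV.fderiv_right (m := 1) le_rfl).differentiable one_ne_zero) x
  unfold partialDeriv
  rw [fderiv_clm_apply h1 (differentiableAt_const _)]
  simp

theorem hessian_transpose (hV : ContDiff ℝ 2 V) (x : Space d) : (hessian V x)ᵀ = hessian V x := by
  ext i j
  simp only [transpose_apply, hessian, of_apply, partialDeriv_partialDeriv hV]
  exact (hV.contDiffAt.isSymmSndFDerivAt (by simp)) _ _

theorem hessianC_transpose (hV : ContDiff ℝ 2 V) (x : Space d) :
    (hessianC V x)ᵀ = hessianC V x := by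
  rw [hessianC, ← transpose_map, hessian_transpose hV]

theorem hessianC_conjTranspose (hV : ContDiff ℝ 2 V) (x : Space d) :
    (hessianC V x)ᴴ = hessianC V x := by
  ext i j
  have := congrFun (congrFun (hessian_transpose hV x) i) j
  rw [conjTranspose_apply, hessianC, map_apply, map_apply, ← this, transpose_apply]
  simp

theorem gradient_apply (x : Space d) (n : Fin d) : gradient V x n = partialDeriv n V x := by
  have h1 : inner ℝ (gradient V x) (EuclideanSpace.single n (1 : ℝ))
      = fderiv ℝ V x (EuclideanSpace.single n 1) := by
    rw [gradient, InnerProductSpace.toDual_symm_apply]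
  rw [partialDeriv, ← h1, EuclideanSpace.inner_single_right]
  simp

theorem IsClassicalFlow.matDeriv_A (hf : IsClassicalFlow V a η A B S) (t : ℝ) :
    MatDeriv A (Complex.I • B t) t := fun i j => hf.matrixA t i j

theorem IsClassicalFlow.matDeriv_B (hf : IsClassicalFlow V a η A B S) (t : ℝ) :
    MatDeriv B (Complex.I • (hessianC V (a t) * A t)) t := fun i j => hf.matrixB t i j

/-- The two matrix relations are conserved by the classical flow. -/
theorem IsClassicalFlow.admissible (hf : IsClassicalFlow V a η A B S) (hV : ContDiff ℝ 2 V)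
    (h0 : Admissible (A 0) (B 0)) (t : ℝ) : Admissible (A t) (B t) := by
  constructor
  · rw [← h0.1]
    refine eq_of_matDeriv_zero (F := fun t => (A t)ᵀ * B t - (B t)ᵀ * A t) (fun t => ?_) t
    have hA := hf.matDeriv_A t
    have hB := hf.matDeriv_B t
    refine ((hA.transpose.mul hB).sub (hB.transpose.mul hA)).congr_deriv ?_
    simp only [transpose_smul, transpose_mul, hessianC_transpose hV, Matrix.smul_mul,
      Matrix.mul_smul, Matrix.mul_assoc]
    abel
  · rw [← h0.2]
    refine eq_of_matDeriv_zero (F := fun t => (A t)ᴴ * B t + (B t)ᴴ * A t) (fun t => ?_) t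
    have hA := hf.matDeriv_A t
    have hB := hf.matDeriv_B t
    refine ((hA.conjTranspose.mul hB).add (hB.conjTranspose.mul hA)).congr_deriv ?_
    simp only [conjTranspose_smul, conjTranspose_mul, hessianC_conjTranspose hV, Matrix.smul_mul,
      Matrix.mul_smul, Matrix.mul_assoc, Complex.star_def, Complex.conj_I, neg_smul,
      Matrix.neg_mul]
    abel

/-- The Riccati equation for `Γ = BA⁻¹`. -/
theorem IsClassicalFlow.matDeriv_mul_inv (hf : IsClassicalFlow V a η A B S)
    (hadm : ∀ t, Admissible (A t) (B t)) (t : ℝ) :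
    MatDeriv (fun r => B r * (A r)⁻¹) (Complex.I • hessianC V (a t)
      - Complex.I • ((B t * (A t)⁻¹) * (B t * (A t)⁻¹))) t := by
  refine ((hf.matDeriv_B t).mul ((hf.matDeriv_A t).inv fun r => (hadm r).isUnit_det)).congr_deriv ?_
  simp only [Matrix.smul_mul, Matrix.mul_smul, Matrix.mul_assoc, (hadm t).mul_inv, Matrix.mul_one,
    Matrix.mul_neg, sub_eq_add_neg]

theorem IsClassicalFlow.hasDerivAt_sqrt_det (hf : IsClassicalFlow V a η A B S)
    (hadm : ∀ t, Admissible (A t) (B t)) {s : ℝ → ℂ} (hs : Continuous s)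
    (hs2 : ∀ t, s t ^ 2 = (A t).det) (t : ℝ) :
    HasDerivAt s (s t * (Complex.I / 2 * (B t * (A t)⁻¹).trace)) t := by
  have hs0 : s t ≠ 0 := fun h0 => (hadm t).det_ne_zero (by rw [← hs2, h0]; simp)
  refine (hasDerivAt_of_sq hs hs2 hs0 ((hf.matDeriv_A t).det (hadm t).isUnit_det)).congr_deriv ?_
  rw [Matrix.mul_smul, trace_smul, trace_mul_comm, ← hs2, smul_eq_mul]
  field_simp

theorem IsClassicalFlow.hasDerivAt_disp (hf : IsClassicalFlow V a η A B S) (x : Space d) (t : ℝ)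
    (n : Fin d) : HasDerivAt (fun r => disp (a r) x n) (-((η t n : ℝ) : ℂ)) t := by
  have h1 : HasDerivAt (fun r => a r n) (η t n) t :=
    (EuclideanSpace.proj (𝕜 := ℝ) n).hasFDerivAt.comp_hasDerivAt t (hf.position t)
  have h2 := (h1.const_sub (x n)).ofReal_comp
  simpa [disp] using h2

theorem IsClassicalFlow.hasDerivAt_momentum (hf : IsClassicalFlow V a η A B S) (t : ℝ)
    (n : Fin d) : HasDerivAt (fun r => ((η r n : ℝ) : ℂ)) (-((partialDeriv n V (a t) : ℝ) : ℂ)) t := by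
  have h1 : HasDerivAt (fun r => η r n) ((-gradient V (a t)) n) t :=
    (EuclideanSpace.proj (𝕜 := ℝ) n).hasFDerivAt.comp_hasDerivAt t (hf.momentum t)
  have h2 := h1.ofReal_comp
  rw [PiLp.neg_apply, gradient_apply] at h2
  simpa using h2

/-- The second-order Taylor polynomial of `V` at `a`, in the variable `x - a`. -/
noncomputable def quadPot (V : Space d → ℝ) (a : Space d) : Poly d :=
  C ((V a : ℝ) : ℂ) + linForm (fun n => ((partialDeriv n V a : ℝ) : ℂ))
    + (1 / 2 : ℂ) • ∑ n, linForm (hessianC V a n) * X n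

theorem eval_quadPot (V : Space d → ℝ) (a : Space d) (y : Fin d → ℂ) :
    eval y (quadPot V a) = ((V a : ℝ) : ℂ) + (fun n => ((partialDeriv n V a : ℝ) : ℂ)) ⬝ᵥ y
      + 1 / 2 * (y ⬝ᵥ hessianC V a *ᵥ y) := by
  simp only [quadPot, map_add, eval_C, eval_linForm, smul_eval, map_sum, map_mul, eval_X]
  congr 2
  exact Finset.sum_congr rfl fun n _ => mul_comm _ _

/-- The quadratic approximation `-(ħ²/2) Δ + V(a) + ⟨∇V(a), x - a⟩ + ⟨x - a, V''(a)(x - a)⟩ / 2` of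
the Hamiltonian, in terms of the polynomial factor of a wave packet. -/
noncomputable def quadHam (V : Space d → ℝ) (Γ : Matrix (Fin d) (Fin d) ℂ) (ħ : ℝ)
    (a η : Space d) (p : Poly d) : Poly d :=
  (-((ħ : ℂ) ^ 2 / 2)) • ∑ n, covDeriv Γ ħ η n (covDeriv Γ ħ η n p) + quadPot V a * p

theorem eval_covDeriv_covDeriv (Γ : Matrix (Fin d) (Fin d) ℂ) (ħ : ℝ) (η : Space d) (n : Fin d)
    (p : Poly d) (y : Fin d → ℂ) :
    eval y (covDeriv Γ ħ η n (covDeriv Γ ħ η n p)) = eval y (pderiv n (pderiv n p))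
      + 2 * (Complex.I * (η n : ℂ) / ħ - 1 / ħ * (Γ n ⬝ᵥ y)) * eval y (pderiv n p)
      + (-(1 / ħ) * Γ n n + (Complex.I * (η n : ℂ) / ħ - 1 / ħ * (Γ n ⬝ᵥ y)) ^ 2) * eval y p := by
  have h1 : pderiv n (linForm (Γ n)) = (C (Γ n n) : Poly d) := by
    rw [pderiv_eq_dirDeriv, dirDeriv_linForm, single_dotProduct, one_mul]
  simp only [covDeriv, logDeriv, map_add, map_sub, map_mul, Derivation.leibniz, Derivation.map_smul,
    h1, pderiv_C, eval_C, smul_eval, eval_linForm, smul_eq_mul, map_zero]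
  ring

/-- `e^{iS/ħ} p(x - a(t)) φ₀(t, x)` solves the Schrödinger equation of the quadratic
Hamiltonian up to the term coming from `p' - 𝓛p`. -/
theorem IsClassicalFlow.hasDerivAt_polyPacket (hf : IsClassicalFlow V a η A B S)
    (hadm : ∀ t, Admissible (A t) (B t)) {s : ℝ → ℂ} (hs : Continuous s)
    (hs2 : ∀ t, s t ^ 2 = (A t).det) {ħ : ℝ} (hħ : 0 < ħ) {p p' : ℝ → Poly d}
    (hp : DiffPoly p p') (hp' : ∀ t, p' t = evolGen ħ (B t * (A t)⁻¹) (p t)) (x : Space d) (t : ℝ) :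
    HasDerivAt (fun r => Complex.exp (Complex.I * (S r : ℂ) / ħ) *
        polyPacket (A r) (B r) (s r) ħ (a r) (η r) (p r) x)
      ((Complex.I * (ħ : ℂ))⁻¹ * (Complex.exp (Complex.I * (S t : ℂ) / ħ) *
        polyPacket (A t) (B t) (s t) ħ (a t) (η t)
          (quadHam V (B t * (A t)⁻¹) ħ (a t) (η t) (p t)) x)) t := by
  have hħ' : (ħ : ℂ) ≠ 0 := Complex.ofReal_ne_zero.mpr hħ.ne'
  have hs0 : s t ≠ 0 := fun h0 => (hadm t).det_ne_zero (by rw [← hs2, h0]; simp)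
  have hy := hf.hasDerivAt_disp x t
  have hq := hasDerivAt_quadForm (y := fun r => disp (a r) x) hy
    (hf.matDeriv_mul_inv hadm t) (hadm t).symm
  have hl := hasDerivAt_dotProduct (y := fun r n => ((η r n : ℝ) : ℂ)) (hf.hasDerivAt_momentum t) hy
  have hS := (((hf.action t).ofReal_comp.const_mul Complex.I).div_const (ħ : ℂ)).cexp
  have hexp := ((hq.fun_neg.div_const (2 * (ħ : ℂ))).fun_add
    ((hl.const_mul Complex.I).div_const (ħ : ℂ))).cexp
  have hsi := (hf.hasDerivAt_sqrt_det hadm hs hs2 t).fun_inv hs0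
  have hmul := hS.fun_mul ((hp.hasDerivAt_eval hy).fun_mul ((hsi.const_mul
    (((Real.pi ^ (-(d : ℝ) / 4) * ħ ^ (-(d : ℝ) / 4) : ℝ) : ℂ))).fun_mul hexp))
  simp only [polyPacket, gaussianPacket_eq]
  refine hmul.congr_deriv ?_
  set v := disp (a t) x with hv
  set Γ := B t * (A t)⁻¹ with hΓ
  set c0 : ℂ := ((Real.pi ^ (-(d : ℝ) / 4) * ħ ^ (-(d : ℝ) / 4) : ℝ) : ℂ)
  set eS := Complex.exp (Complex.I * (S t : ℂ) / ħ)
  set eG := Complex.exp (-(v ⬝ᵥ Γ *ᵥ v) / (2 * ħ) +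
    Complex.I * ((fun n => ((η t n : ℝ) : ℂ)) ⬝ᵥ v) / ħ)
  set P := eval v (p t)
  set ηc : Fin d → ℂ := fun n => ((η t n : ℝ) : ℂ) with hηc
  set dV : Fin d → ℂ := fun n => ((partialDeriv n V (a t) : ℝ) : ℂ)
  have e1 : eval v (p' t) = Complex.I * ħ / 2 * ∑ n, eval v (pderiv n (pderiv n (p t)))
      - Complex.I * ∑ n, (Γ n ⬝ᵥ v) * eval v (pderiv n (p t)) := by
    rw [hp', ← hΓ, evolGen_apply, polyLaplacian_apply, transport_eq_sum]
    simp only [map_sub, smul_eval, map_sum, map_mul, eval_linForm]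
  have e2 : eval v (dirDeriv (fun n => -((η t n : ℝ) : ℂ)) (p t))
      = -∑ n, ηc n * eval v (pderiv n (p t)) := by
    rw [dirDeriv_eq_sum]
    simp only [map_sum, smul_eval, neg_mul, Finset.sum_neg_distrib, hηc]
  have e3 : eval v (quadHam V Γ ħ (a t) (η t) (p t)) = -((ħ : ℂ) ^ 2 / 2) *
      (∑ n, eval v (pderiv n (pderiv n (p t)))
        + 2 / ħ * (Complex.I * ∑ n, ηc n * eval v (pderiv n (p t))
          - ∑ n, (Γ n ⬝ᵥ v) * eval v (pderiv n (p t)))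
        + (-(1 / ħ) * Γ.trace + 1 / ħ ^ 2 * (-(ηc ⬝ᵥ ηc) - 2 * Complex.I * (ηc ⬝ᵥ Γ *ᵥ v)
          + (Γ *ᵥ v) ⬝ᵥ (Γ *ᵥ v))) * P)
      + ((V (a t) : ℂ) + dV ⬝ᵥ v + 1 / 2 * (v ⬝ᵥ hessianC V (a t) *ᵥ v)) * P := by
    have hterm : ∀ n, eval v (covDeriv Γ ħ (η t) n (covDeriv Γ ħ (η t) n (p t)))
        = eval v (pderiv n (pderiv n (p t)))
          + (2 * Complex.I / ħ) * (ηc n * eval v (pderiv n (p t)))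
          + (-2 / ħ) * ((Γ n ⬝ᵥ v) * eval v (pderiv n (p t))) + (-P / ħ) * Γ n n
          + (-P / ħ ^ 2) * (ηc n * ηc n) + (-2 * Complex.I * P / ħ ^ 2) * (ηc n * (Γ n ⬝ᵥ v))
          + (P / ħ ^ 2) * ((Γ n ⬝ᵥ v) * (Γ n ⬝ᵥ v)) := by
      intro n
      rw [eval_covDeriv_covDeriv]
      simp only [hηc]
      linear_combination (((η t n : ℝ) : ℂ) ^ 2 / ħ ^ 2 * P) * Complex.I_sq
    have t1 : Γ.trace = ∑ n, Γ n n := rfl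
    have t2 : ηc ⬝ᵥ ηc = ∑ n, ηc n * ηc n := rfl
    have t3 : ηc ⬝ᵥ Γ *ᵥ v = ∑ n, ηc n * (Γ n ⬝ᵥ v) := rfl
    have t4 : (Γ *ᵥ v) ⬝ᵥ (Γ *ᵥ v) = ∑ n, (Γ n ⬝ᵥ v) * (Γ n ⬝ᵥ v) := rfl
    rw [quadHam, map_add, smul_eval, map_sum, map_mul, eval_quadPot, t1, t2, t3, t4]
    simp only [hterm, Finset.sum_add_distrib, ← Finset.mul_sum]
    ring
  have e4 : (Γ *ᵥ v) ⬝ᵥ (Γ *ᵥ v) = v ⬝ᵥ (Γ * Γ) *ᵥ v := by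
    have hΓs : Γᵀ = Γ := (hadm t).symm
    rw [← mulVec_mulVec v Γ Γ, dotProduct_mulVec v Γ, ← mulVec_transpose Γ, hΓs]
  have e5 : ((‖η t‖ ^ 2 / 2 - V (a t) : ℝ) : ℂ) = (ηc ⬝ᵥ ηc) / 2 - V (a t) := by
    rw [EuclideanSpace.real_norm_sq_eq]
    simp [dotProduct, hηc, sq]
  have e6 : (fun n => -((η t n : ℝ) : ℂ)) = -ηc := rfl
  have e7 : (fun n => -((partialDeriv n V (a t) : ℝ) : ℂ)) = -dV := rfl
  rw [e5, e6, e7, e3, e1, ← e6, e2, e6, e4]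
  simp only [sub_mulVec, smul_mulVec, dotProduct_sub, dotProduct_smul, neg_dotProduct,
    dotProduct_neg, smul_eq_mul]
  field_simp
  ring_nf
  simp only [Complex.I_sq]
  ring

end Flow

/-! ### Wave packets as curves in `L²` -/

section L2Curves

open MeasureTheory Filter Topology

variable {d : ℕ}

theorem inner_toLp {f g : Space d → ℂ} (hf : MemLp f 2 volume) (hg : MemLp g 2 volume) :
    inner ℂ (hf.toLp f) (hg.toLp g) = ∫ x, star (f x) * g x := by
  rw [L2.inner_def]
  refine integral_congr_ae ?_
  filter_upwards [hf.coeFn_toLp, hg.coeFn_toLp] with x h1 h2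
  rw [h1, h2, RCLike.inner_apply, mul_comm]
  rfl

/-- Dominated convergence in `L²`. -/
theorem tendsto_toLp_zero {l : Filter ℝ} [l.IsCountablyGenerated] {h : ℝ → Space d → ℂ}
    (hm : ∀ t, MemLp (h t) 2 volume) {G : Space d → ℝ} (hG : MemLp G 2 volume)
    (hb : ∀ᶠ t in l, ∀ x, ‖h t x‖ ≤ G x) (hlim : ∀ x, Tendsto (fun t => h t x) l (𝓝 0)) :
    Tendsto (fun t => (hm t).toLp (h t)) l (𝓝 0) := by
  rw [tendsto_zero_iff_norm_tendsto_zero]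
  have h1 : Tendsto (fun t => ∫ x, star (h t x) * h t x) l (𝓝 (∫ _x : Space d, (0 : ℂ))) := by
    refine tendsto_integral_filter_of_dominated_convergence (fun x => G x ^ 2) ?_ ?_ ?_ ?_
    · exact Eventually.of_forall fun t => (integrable_star_mul (hm t) (hm t)).aestronglyMeasurable
    · filter_upwards [hb] with t ht
      refine Eventually.of_forall fun x => ?_
      rw [norm_mul, norm_star, sq]
      exact mul_self_le_mul_self (norm_nonneg _) (ht x)
    · exact (memLp_two_iff_integrable_sq hG.1).mp hG
    · refine Eventually.of_forall fun x => ?_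
      have := (hlim x).star.mul (hlim x)
      simpa using this
  have h2 : ∀ t, ‖(hm t).toLp (h t)‖ = √(‖∫ x, star (h t x) * h t x‖) := by
    intro t
    rw [← inner_toLp (hm t) (hm t), inner_self_eq_norm_sq_to_K]
    simp
  simp only [h2]
  have h3 := (Real.continuous_sqrt.tendsto _).comp h1.norm
  simpa [Function.comp_def] using h3

/-- A pointwise differentiable family whose derivative has locally uniform Gaussian decay is
differentiable as a curve in `L²`. -/
theorem hasDerivAt_toLp {f f' : ℝ → Space d → ℂ} (hf : ∀ t, MemLp (f t) 2 volume)
    (hf' : ∀ t, MemLp (f' t) 2 volume) (hd : ∀ t x, HasDerivAt (fun r => f r x) (f' t x) t) (t : ℝ)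
    (hb : GaussBddOn (Set.Icc (t - 1) (t + 1)) f') :
    HasDerivAt (fun r => (hf r).toLp (f r)) ((hf' t).toLp (f' t)) t := by
  obtain ⟨C, κ, hκ, hC⟩ := hb
  set G : Space d → ℝ := fun x => C * Real.exp (-κ * ‖x‖ ^ 2)
  have hG : MemLp G 2 volume := (memLp_gaussian hκ).const_mul C
  rw [hasDerivAt_iff_tendsto_slope, tendsto_iff_norm_sub_tendsto_zero,
    ← tendsto_zero_iff_norm_tendsto_zero]
  have hm : ∀ r, MemLp (slope f t r - f' t) 2 volume := fun r => by
    rw [slope_def_module]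
    exact (((hf r).sub (hf t)).const_smul _).sub (hf' t)
  have heq : ∀ r, slope (fun r => (hf r).toLp (f r)) t r - (hf' t).toLp (f' t)
      = (hm r).toLp _ := by
    intro r
    rw [slope_def_module, ← MemLp.toLp_sub, ← MemLp.toLp_const_smul, ← MemLp.toLp_sub]
    congr 1
  simp only [heq]
  refine tendsto_toLp_zero hm (hG.const_mul 2) ?_ fun x => ?_
  · have hnear : ∀ᶠ r in 𝓝[≠] t, r ∈ Set.Icc (t - 1) (t + 1) :=
      nhdsWithin_le_nhds (Icc_mem_nhds (by linarith) (by linarith))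
    filter_upwards [hnear, self_mem_nhdsWithin] with r hr hne x
    have hmv : ‖f r x - f t x‖ ≤ G x * ‖r - t‖ :=
      (convex_Icc (t - 1) (t + 1)).norm_image_sub_le_of_norm_hasDerivWithin_le
        (f := fun r => f r x) (f' := fun r => f' r x)
        (fun y _ => (hd y x).hasDerivWithinAt) (fun y hy => hC y hy x)
        ⟨by linarith, by linarith⟩ hr
    have hpos : 0 < ‖r - t‖ := norm_pos_iff.mpr (sub_ne_zero.mpr hne)
    have h1 : ‖(slope f t r) x‖ ≤ G x := by
      rw [slope_def_module, Pi.smul_apply, Pi.sub_apply, norm_smul, norm_inv, inv_mul_le_iff₀ hpos,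
        mul_comm]
      exact hmv
    calc ‖(slope f t r - f' t) x‖ ≤ ‖(slope f t r) x‖ + ‖f' t x‖ := norm_sub_le _ _
      _ ≤ G x + G x := add_le_add h1 (hC t ⟨by linarith, by linarith⟩ x)
      _ = 2 * G x := by ring
  · have h1 := (hasDerivAt_iff_tendsto_slope.mp (hd t x)).sub_const (f' t x)
    rw [sub_self] at h1
    refine h1.congr fun r => ?_
    rw [Pi.sub_apply, slope_def_module, slope_def_module]
    rfl

end L2Curves

section PacketCurves

open MeasureTheory

variable {d : ℕ} {V : Space d → ℝ} {a η : ℝ → Space d} {A B : ℝ → Matrix (Fin d) (Fin d) ℂ}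
  {S : ℝ → ℝ}

/-- The Hermite polynomials evolve by `∂ₜ H_j = 𝓛 H_j`, because the raising operators intertwine
the evolution: `[∂ₜ - 𝓛, 𝒜ₘ*] = 0`. -/
theorem IsClassicalFlow.diffPoly_hermitePoly (hf : IsClassicalFlow V a η A B S)
    (hadm : ∀ t, Admissible (A t) (B t)) {ħ : ℝ} (hħ : 0 < ħ) (j : Fin d → ℕ) :
    DiffPoly (fun t => hermitePoly (A t) ħ j)
      fun t => evolGen ħ (B t * (A t)⁻¹) (hermitePoly (A t) ħ j) := by
  have hσ := sqrt_two_mul_ne_zero hħ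
  have hσ2 : (√(2 * ħ) : ℂ) ^ 2 = 2 * ħ := by
    rw [← Complex.ofReal_pow, Real.sq_sqrt (by positivity)]; push_cast; rfl
  induction j using multiIndex_induction with
  | h0 =>
    simp only [hermitePoly_zero]
    refine (DiffPoly.const 1).congr fun t => ?_
    rw [evolGen_apply, polyLaplacian_apply]
    simp
  | hs j m ih =>
    have hc : (((√(j m + 1) : ℝ) : ℂ)) ≠ 0 :=
      Complex.ofReal_ne_zero.mpr (Real.sqrt_ne_zero'.mpr (by positivity))
    have hH : ∀ t, hermitePoly (A t) ħ (j + Pi.single m 1)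
        = (((√(j m + 1) : ℝ) : ℂ))⁻¹ • raiseOp (A t) ħ m (hermitePoly (A t) ħ j) := fun t => by
      rw [raiseOp_hermitePoly (hadm t) hħ, smul_smul, inv_mul_cancel₀ hc, one_smul]
    set u : ℝ → Fin d → ℂ := fun t n => 2 / (√(2 * ħ) : ℂ) * (A t)⁻¹ m n with hu
    set v : ℝ → Fin d → ℂ := fun t n => -((√(2 * ħ) : ℂ) / 2) * star (A t n m) with hv
    have hu' : ∀ t n, HasDerivAt (fun r => u r n)
        ((-Complex.I • (u t ᵥ* (B t * (A t)⁻¹))) n) t := by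
      intro t n
      have h1 := (((hf.matDeriv_A t).inv fun r => (hadm r).isUnit_det) m n).const_mul
        (2 / (√(2 * ħ) : ℂ))
      refine h1.congr_deriv ?_
      have h2 : (u t ᵥ* (B t * (A t)⁻¹)) n
          = 2 / (√(2 * ħ) : ℂ) * ((A t)⁻¹ * (B t * (A t)⁻¹)) m n := by
        simp only [hu, vecMul, dotProduct, mul_apply (M := (A t)⁻¹), Finset.mul_sum, mul_assoc]
      rw [Pi.smul_apply, h2, Matrix.mul_smul, Matrix.smul_mul, Matrix.mul_assoc]
      simp only [Matrix.neg_apply, Matrix.smul_apply, smul_eq_mul]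
      ring
    have hv' : ∀ t n, HasDerivAt (fun r => v r n)
        (((Complex.I * ħ) • u t + Complex.I • ((B t * (A t)⁻¹) *ᵥ v t)) n) t := by
      intro t n
      have h1 := ((hf.matDeriv_A t) n m).star.const_mul (-((√(2 * ħ) : ℂ) / 2))
      refine h1.congr_deriv ?_
      have h2 : ((B t * (A t)⁻¹) *ᵥ v t) n
          = -((√(2 * ħ) : ℂ) / 2) * ((B t * (A t)⁻¹) * (A t)ᴴᵀ) n m := by
        simp only [hv, mulVec, dotProduct, mul_apply (N := (A t)ᴴᵀ), Finset.mul_sum,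
          transpose_apply, conjTranspose_apply]
        exact Finset.sum_congr rfl fun k _ => by ring
      have h3 := congrFun (congrFun (hadm t).symm_mul_conj_add n) m
      simp only [Matrix.add_apply, Matrix.smul_apply, transpose_apply, conjTranspose_apply, smul_eq_mul] at h3
      rw [Pi.add_apply, Pi.smul_apply, Pi.smul_apply, h2, eq_sub_of_add_eq h3]
      simp only [hu, Matrix.smul_apply, smul_eq_mul, star_mul', Complex.star_def, Complex.conj_I]
      have h4 : (ħ : ℂ) = (√(2 * ħ) : ℂ) ^ 2 / 2 := by rw [hσ2]; ring
      rw [h4]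
      field_simp
      ring
    simp only [hH]
    have h1 := (ih.firstOrder hu' hv').map (LinearMap.lsmul ℂ (Poly d) (((√(j m + 1) : ℝ) : ℂ))⁻¹)
    refine DiffPoly.congr h1 fun t => ?_
    simp only [LinearMap.lsmul_apply, map_smul]
    congr 1
    rw [raiseOp, evolGen_firstOrder, add_comm]

theorem IsClassicalFlow.continuous_position (hf : IsClassicalFlow V a η A B S) : Continuous a :=
  continuous_iff_continuousAt.mpr fun t => (hf.position t).continuousAt

theorem IsClassicalFlow.continuous_A (hf : IsClassicalFlow V a η A B S) (i j : Fin d) :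
    Continuous fun t => A t i j :=
  continuous_iff_continuousAt.mpr fun t => (hf.matrixA t i j).continuousAt

theorem ContPoly.covDeriv {p : ℝ → Poly d} (hp : ContPoly p) {ħ : ℝ}
    {Γ : ℝ → Matrix (Fin d) (Fin d) ℂ} (hΓ : ∀ i j, Continuous fun t => Γ t i j)
    (hη : ∀ n, Continuous fun t => ((η t n : ℝ) : ℂ)) (n : Fin d) :
    ContPoly fun t => covDeriv (Γ t) ħ (η t) n (p t) := by
  have h : ∀ t, Hagedorn.covDeriv (Γ t) ħ (η t) n (p t) = pderiv n (p t)
      + ((Complex.I * (η t n : ℂ) / ħ) • p t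
        + (-(1 / (ħ : ℂ))) • (linForm (Γ t n) * p t)) := by
    intro t
    rw [Hagedorn.covDeriv, logDeriv, sub_mul, smul_mul_assoc, C_mul', neg_smul, sub_eq_add_neg]
  simp only [h]
  refine (hp.map (pderiv n : Derivation ℂ (Poly d) (Poly d)).toLinearMap).add
    ((hp.smul ?_).add ((hp.linForm_mul (hΓ n)).smul continuous_const))
  exact (continuous_const.mul (hη n)).div_const _

theorem ContPoly.quadPot_mul {p : ℝ → Poly d} (hp : ContPoly p) (hV : ContDiff ℝ 2 V)
    (ha : Continuous a) : ContPoly fun t => quadPot V (a t) * p t := by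
  have h1 : ∀ n, Continuous (partialDeriv n V) := fun n =>
    (hV.continuous_fderiv two_ne_zero).clm_apply continuous_const
  have h2 : ∀ i j, Continuous fun x => hessianC V x i j := by
    intro i j
    have : Continuous fun x => fderiv ℝ (fderiv ℝ V) x (EuclideanSpace.single i 1)
        (EuclideanSpace.single j 1) :=
      (((hV.fderiv_right (m := 1) le_rfl).continuous_fderiv one_ne_zero).clm_apply
        continuous_const).clm_apply continuous_const
    simp only [hessianC, map_apply, hessian, of_apply, partialDeriv_partialDeriv hV]
    exact Complex.continuous_ofReal.comp this
  have h : ∀ t, quadPot V (a t) * p t = (((V (a t) : ℝ) : ℂ) • p t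
      + linForm (fun n => ((partialDeriv n V (a t) : ℝ) : ℂ)) * p t)
      + (1 / 2 : ℂ) • ∑ n, linForm (hessianC V (a t) n) * (X n * p t) := by
    intro t
    simp only [quadPot, add_mul, C_mul', smul_mul_assoc, Finset.sum_mul, mul_assoc]
  simp only [h]
  refine ((hp.smul ?_).add (hp.linForm_mul fun n => ?_)).add
    (ContPoly.smul (ContPoly.sum _ fun n _ => ?_) continuous_const)
  · exact Complex.continuous_ofReal.comp (hV.continuous.comp ha)
  · exact Complex.continuous_ofReal.comp ((h1 n).comp ha)
  · exact (hp.map (LinearMap.mulLeft ℂ (X n))).linForm_mul fun k => (h2 n k).comp ha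

variable {s : ℝ → ℂ} {ħ : ℝ}

/-- The wave packet `e^{iS/ħ} φ_j` as a curve in `L²` solves the Schrödinger equation of the
quadratic Hamiltonian. -/
theorem IsClassicalFlow.hasDerivAt_packet (hf : IsClassicalFlow V a η A B S)
    (hadm : ∀ t, Admissible (A t) (B t)) (hV : ContDiff ℝ 2 V) (hs : Continuous s)
    (hs2 : ∀ t, s t ^ 2 = (A t).det) (hħ : 0 < ħ) (j : Fin d → ℕ)
    (hm : ∀ t p, MemLp (fun x => Complex.exp (Complex.I * (S t : ℂ) / ħ) *
      polyPacket (A t) (B t) (s t) ħ (a t) (η t) p x) 2 volume) (t : ℝ) :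
    HasDerivAt (fun r => (hm r (hermitePoly (A r) ħ j)).toLp _)
      ((Complex.I * (ħ : ℂ))⁻¹ • (hm t (quadHam V (B t * (A t)⁻¹) ħ (a t) (η t)
        (hermitePoly (A t) ħ j))).toLp _) t := by
  have hs0 : ∀ t, s t ≠ 0 := fun t h0 => (hadm t).det_ne_zero (by rw [← hs2, h0]; simp)
  have hp := hf.diffPoly_hermitePoly hadm hħ j
  have hm' : ∀ t, MemLp ((Complex.I * (ħ : ℂ))⁻¹ • fun x =>
      (Complex.exp (Complex.I * (S t : ℂ) / ħ) * polyPacket (A t) (B t) (s t) ħ (a t) (η t)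
        (quadHam V (B t * (A t)⁻¹) ħ (a t) (η t) (hermitePoly (A t) ħ j)) x)) 2 volume :=
    fun t => (hm t _).const_smul _
  have hcη : ∀ n, Continuous fun t => ((η t n : ℝ) : ℂ) := fun n =>
    continuous_iff_continuousAt.mpr fun t => (hf.hasDerivAt_momentum t n).continuousAt
  have hcΓ : ∀ i j, Continuous fun t => (B t * (A t)⁻¹) i j := fun i j =>
    continuous_iff_continuousAt.mpr fun t => (hf.matDeriv_mul_inv hadm t i j).continuousAt
  have hq : ContPoly fun t => quadHam V (B t * (A t)⁻¹) ħ (a t) (η t) (hermitePoly (A t) ħ j) :=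
    ((ContPoly.sum _ fun n _ => (hp.contPoly.covDeriv hcΓ hcη n).covDeriv hcΓ hcη n).smul
      continuous_const).add (hp.contPoly.quadPot_mul hV hf.continuous_position)
  have hb : GaussBddOn (Set.Icc (t - 1) (t + 1)) fun t => (Complex.I * (ħ : ℂ))⁻¹ • fun x =>
      (Complex.exp (Complex.I * (S t : ℂ) / ħ) * polyPacket (A t) (B t) (s t) ħ (a t) (η t)
        (quadHam V (B t * (A t)⁻¹) ħ (a t) (η t) (hermitePoly (A t) ħ j)) x) := by
    obtain ⟨C, κ, hκ, hC⟩ := gaussBddOn_polyPacket (s := s) (η := η) hħ hadm hf.continuous_A hs hs0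
      hf.continuous_position hq (isCompact_Icc (a := t - 1) (b := t + 1))
    refine ⟨‖(Complex.I * (ħ : ℂ))⁻¹‖ * C, κ, hκ, fun r hr x => ?_⟩
    have hphase : ‖Complex.exp (Complex.I * (S r : ℂ) / ħ)‖ = 1 := by
      rw [mul_div_assoc, ← Complex.ofReal_div, mul_comm]
      exact Complex.norm_exp_ofReal_mul_I _
    dsimp only
    rw [Pi.smul_apply, norm_smul, norm_mul, hphase, one_mul, mul_assoc]
    exact mul_le_mul_of_nonneg_left (hC r hr x) (norm_nonneg _)
  have h := hasDerivAt_toLp (fun r => hm r (hermitePoly (A r) ħ j)) hm'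
    (fun t x => hf.hasDerivAt_polyPacket hadm hs hs2 hħ hp (fun _ => rfl) x t) t hb
  rw [MemLp.toLp_const_smul] at h
  exact h

end PacketCurves

/-! ### Cauchy estimates and Taylor series on a polydisc -/

section Polydisc

open Filter Topology

variable {d : ℕ}

theorem isOpen_strip (d : ℕ) (δ : ℝ) : IsOpen (strip d δ) := by
  simp only [strip, Set.ofPred_forall]
  exact isOpen_iInter_of_finite fun j =>
    isOpen_lt ((Complex.continuous_im.comp (continuous_apply j)).abs) continuous_const

theorem cons_mem_strip {δ : ℝ} {z₀ : ℂ} {z : Fin d → ℂ} :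
    Fin.cons z₀ z ∈ strip (d + 1) δ ↔ |z₀.im| < δ ∧ z ∈ strip d δ := by
  simp [strip, Fin.forall_fin_succ]

theorem isOpen_im_lt (δ : ℝ) : IsOpen {z : ℂ | |z.im| < δ} :=
  isOpen_lt Complex.continuous_im.abs continuous_const

theorem multiIterate_cons {X : Type*} (T : Fin (d + 1) → X → X) (k : ℕ) (m : Fin d → ℕ) (f : X) :
    multiIterate T (Fin.cons k m) f = (T 0)^[k] (multiIterate (fun n => T n.succ) m f) := by
  simp [multiIterate, List.finRange_succ, List.foldr_map]

/-- The complex partial derivative `∂F/∂zₙ`. -/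
noncomputable def complexPartial (n : Fin d) (F : (Fin d → ℂ) → ℂ) : (Fin d → ℂ) → ℂ :=
  fun z => fderiv ℂ F z (Pi.single n 1)

theorem analyticOnNhd_complexPartial {U : Set (Fin d → ℂ)} {F : (Fin d → ℂ) → ℂ} (n : Fin d)
    (hF : AnalyticOnNhd ℂ F U) : AnalyticOnNhd ℂ (complexPartial n F) U := fun z hz =>
  (ContinuousLinearMap.analyticAt (ContinuousLinearMap.apply ℂ ℂ (Pi.single n (1 : ℂ) : Fin d → ℂ))
    (fderiv ℂ F z)).comp (hF z hz).fderiv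

/-- A relation which is preserved by corresponding operators is preserved by their iterates. -/
theorem multiIterate_rel {X Y : Type*} {T : Fin d → X → X} {T' : Fin d → Y → Y}
    (R : X → Y → Prop) (hR : ∀ n x y, R x y → R (T n x) (T' n y)) (m : Fin d → ℕ) {x : X} {y : Y}
    (h : R x y) : R (multiIterate T m x) (multiIterate T' m y) := by
  have hit : ∀ n k x y, R x y → R ((T n)^[k] x) ((T' n)^[k] y) := by
    intro n k
    induction k with
    | zero => exact fun x y h => h
    | succ k ih => exact fun x y h => ih _ _ (hR n x y h)
  unfold multiIterate
  induction List.finRange d with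
  | nil => exact h
  | cons n L ih => exact hit n _ _ _ ih

theorem analyticOnNhd_multiIterate {δ : ℝ} {F : (Fin d → ℂ) → ℂ} {k : ℕ} (e : Fin k → Fin d)
    (m : Fin k → ℕ) (hF : AnalyticOnNhd ℂ F (strip d δ)) :
    AnalyticOnNhd ℂ (multiIterate (fun n => complexPartial (e n)) m F) (strip d δ) :=
  multiIterate_rel (T := fun n => complexPartial (e n)) (T' := fun _ => (id : Unit → Unit))
    (fun F _ => AnalyticOnNhd ℂ F (strip d δ)) (fun n _ _ h => analyticOnNhd_complexPartial (e n) h)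
    m (y := ()) hF

theorem hasFDerivAt_cons (z₀ : ℂ) (z : Fin d → ℂ) :
    HasFDerivAt (fun w : Fin d → ℂ => (Fin.cons z₀ w : Fin (d + 1) → ℂ))
      (ContinuousLinearMap.pi (Fin.cons (0 : (Fin d → ℂ) →L[ℂ] ℂ)
        fun i => ContinuousLinearMap.proj (R := ℂ) (φ := fun _ : Fin d => ℂ) i)) z := by
  refine hasFDerivAt_pi'.mpr fun i => ?_
  refine Fin.cases ?_ (fun i => ?_) i
  · exact hasFDerivAt_const z₀ z
  · exact hasFDerivAt_apply (𝕜 := ℂ) i z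

theorem complexPartial_succ_cons {F : (Fin (d + 1) → ℂ) → ℂ} {z₀ : ℂ} {z : Fin d → ℂ}
    (hF : DifferentiableAt ℂ F (Fin.cons z₀ z)) (n : Fin d) :
    complexPartial n.succ F (Fin.cons z₀ z) = complexPartial n (fun w => F (Fin.cons z₀ w)) z := by
  have h := (hF.hasFDerivAt.comp z (hasFDerivAt_cons z₀ z)).fderiv
  rw [complexPartial, complexPartial]
  change _ = fderiv ℂ (F ∘ fun w => Fin.cons z₀ w) z _
  rw [h]
  simp only [ContinuousLinearMap.comp_apply]
  congr 1
  funext i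
  refine Fin.cases ?_ (fun i => ?_) i
  · simp [(Fin.succ_ne_zero n).symm]
  · simp [Pi.single_apply]

theorem multiIterate_succ_cons {δ : ℝ} {F : (Fin (d + 1) → ℂ) → ℂ}
    (hF : AnalyticOnNhd ℂ F (strip (d + 1) δ)) {z₀ : ℂ} (hz₀ : |z₀.im| < δ) (m : Fin d → ℕ)
    {z : Fin d → ℂ} (hz : z ∈ strip d δ) :
    multiIterate (fun n => complexPartial n.succ) m F (Fin.cons z₀ z)
      = multiIterate (fun n => complexPartial n) m (fun w => F (Fin.cons z₀ w)) z := by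
  refine (multiIterate_rel (T := fun n : Fin d => complexPartial n.succ)
    (T' := fun n => complexPartial n) (fun G g => AnalyticOnNhd ℂ G (strip (d + 1) δ) ∧
      ∀ z ∈ strip d δ, G (Fin.cons z₀ z) = g z) ?_ m ⟨hF, fun z _ => rfl⟩).2 z hz
  rintro n G g ⟨hG, h⟩
  refine ⟨analyticOnNhd_complexPartial _ hG, fun z hz => ?_⟩
  rw [complexPartial_succ_cons (hG _ (cons_mem_strip.mpr ⟨hz₀, hz⟩)).differentiableAt,
    complexPartial, complexPartial]
  congr 1
  refine Filter.EventuallyEq.fderiv_eq ?_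
  filter_upwards [(isOpen_strip d δ).mem_nhds hz] with w hw using h w hw

theorem hasDerivAt_cons (z₀ : ℂ) (z : Fin d → ℂ) :
    HasDerivAt (fun w : ℂ => (Fin.cons w z : Fin (d + 1) → ℂ)) (Pi.single 0 1) z₀ := by
  refine hasDerivAt_pi.mpr fun i => ?_
  refine Fin.cases ?_ (fun i => ?_) i
  · exact (hasDerivAt_id z₀).congr_deriv (by simp)
  · exact (hasDerivAt_const z₀ (z i)).congr_deriv (by simp)

theorem analyticOnNhd_slice_zero {δ : ℝ} {F : (Fin (d + 1) → ℂ) → ℂ}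
    (hF : AnalyticOnNhd ℂ F (strip (d + 1) δ)) {z : Fin d → ℂ} (hz : z ∈ strip d δ) :
    DifferentiableOn ℂ (fun w => F (Fin.cons w z)) {w | |w.im| < δ} := fun w hw =>
  ((hF _ (cons_mem_strip.mpr ⟨hw, hz⟩)).differentiableAt.comp w
    (hasDerivAt_cons w z).differentiableAt).differentiableWithinAt

theorem analyticOnNhd_slice_succ {δ : ℝ} {F : (Fin (d + 1) → ℂ) → ℂ}
    (hF : AnalyticOnNhd ℂ F (strip (d + 1) δ)) {z₀ : ℂ} (hz₀ : |z₀.im| < δ) :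
    AnalyticOnNhd ℂ (fun w => F (Fin.cons z₀ w)) (strip d δ) := fun w hw =>
  AnalyticAt.comp (f := fun w : Fin d → ℂ => (Fin.cons z₀ w : Fin (d + 1) → ℂ))
    (hF _ (cons_mem_strip.mpr ⟨hz₀, hw⟩)) (AnalyticAt.pi fun i => by
      refine Fin.cases ?_ (fun i => ?_) i
      · exact analyticAt_const
      · exact (ContinuousLinearMap.proj (R := ℂ) (φ := fun _ : Fin d => ℂ) i).analyticAt w)

theorem iterate_zero_cons {δ : ℝ} {F : (Fin (d + 1) → ℂ) → ℂ}
    (hF : AnalyticOnNhd ℂ F (strip (d + 1) δ)) {z : Fin d → ℂ} (hz : z ∈ strip d δ) (k : ℕ)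
    {z₀ : ℂ} (hz₀ : |z₀.im| < δ) :
    (complexPartial 0)^[k] F (Fin.cons z₀ z)
      = iteratedDeriv k (fun w => F (Fin.cons w z)) z₀ := by
  have han : ∀ k, AnalyticOnNhd ℂ ((complexPartial 0)^[k] F) (strip (d + 1) δ) := by
    intro k
    induction k with
    | zero => exact hF
    | succ k ih => rw [Function.iterate_succ_apply']; exact analyticOnNhd_complexPartial _ ih
  induction k generalizing z₀ with
  | zero => simp
  | succ k ih =>
    rw [Function.iterate_succ_apply', iteratedDeriv_succ]
    have h1 : iteratedDeriv k (fun w => F (Fin.cons w z)) =ᶠ[𝓝 z₀]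
        fun w => (complexPartial 0)^[k] F (Fin.cons w z) := by
      filter_upwards [(isOpen_im_lt δ).mem_nhds hz₀] with w hw using (ih hw).symm
    rw [h1.deriv_eq]
    exact ((han k _ (cons_mem_strip.mpr ⟨hz₀, hz⟩)).differentiableAt.hasFDerivAt.comp_hasDerivAt z₀
      (hasDerivAt_cons z₀ z)).deriv.symm

theorem multiFactorial_cons (k : ℕ) (m : Fin d → ℕ) :
    multiFactorial (Fin.cons k m : Fin (d + 1) → ℕ) = k.factorial * multiFactorial m := by
  simp [multiFactorial, Fin.prod_univ_succ]

theorem abs_im_lt_of_norm_sub_le {δ r a : ℝ} {z : ℂ} (hr : r < δ) (h : ‖z - (a : ℂ)‖ ≤ r) :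
    |z.im| < δ := by
  have := Complex.abs_im_le_norm (z - a)
  simp only [Complex.sub_im, Complex.ofReal_im, sub_zero] at this
  linarith

/-- Cauchy's estimates on a polydisc. -/
theorem norm_multiIterate_complexPartial_le {δ r C : ℝ} (hr : 0 < r) (hrδ : r < δ)
    {F : (Fin d → ℂ) → ℂ} (hF : AnalyticOnNhd ℂ F (strip d δ)) (a : Fin d → ℝ)
    (hC : ∀ z : Fin d → ℂ, (∀ j, ‖z j - a j‖ ≤ r) → ‖F z‖ ≤ C) (m : Fin d → ℕ) :
    ‖multiIterate (fun n => complexPartial n) m F (fun j => (a j : ℂ))‖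
      ≤ multiFactorial m * (C / r ^ ∑ i, m i) := by
  induction d with
  | zero =>
    have : multiIterate (fun n => complexPartial n) m F = F := by simp [multiIterate]
    rw [this]
    simp [multiFactorial, hC]
  | succ d ih =>
    obtain ⟨k, m, rfl⟩ : ∃ k m', m = Fin.cons k m' := ⟨m 0, Fin.tail m, (Fin.cons_self_tail m).symm⟩
    have hδ : 0 < δ := hr.trans hrδ
    have ha : (fun j => ((a j : ℝ) : ℂ)) = Fin.cons ((a 0 : ℝ) : ℂ) (fun j => ((a j.succ : ℝ) : ℂ)) := by
      funext j; refine Fin.cases rfl (fun _ => rfl) j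
    have hmem : (fun j : Fin d => ((a j.succ : ℝ) : ℂ)) ∈ strip d δ := fun j => by simpa using hδ
    have hG := analyticOnNhd_multiIterate Fin.succ m hF
    rw [multiIterate_cons, ha, iterate_zero_cons hG hmem k (by simpa using hδ), multiFactorial_cons]
    have hb : ∀ z₀ ∈ Metric.closedBall ((a 0 : ℝ) : ℂ) r,
        ‖multiIterate (fun n : Fin d => complexPartial n.succ) m F
          (Fin.cons z₀ fun j => ((a j.succ : ℝ) : ℂ))‖ ≤ multiFactorial m * (C / r ^ ∑ i, m i) := by
      intro z₀ hz₀
      rw [mem_closedBall_iff_norm] at hz₀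
      have him := abs_im_lt_of_norm_sub_le hrδ hz₀
      rw [multiIterate_succ_cons hF him m hmem]
      refine ih (analyticOnNhd_slice_succ hF him) (fun j => a j.succ) (fun z hz => hC _ fun j => ?_) m
      refine Fin.cases ?_ (fun j => ?_) j
      · simpa using hz₀
      · simpa using hz j
    have hsub : Metric.closedBall ((a 0 : ℝ) : ℂ) r ⊆ {w | |w.im| < δ} := fun w hw =>
      abs_im_lt_of_norm_sub_le hrδ (mem_closedBall_iff_norm.mp hw)
    have hd := (analyticOnNhd_slice_zero hG hmem).mono hsub
    refine (Complex.norm_iteratedDeriv_le_of_forall_mem_sphere_norm_le k hr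
      (hd.diffContOnCl_ball subset_rfl)
      fun z hz => hb z (Metric.sphere_subset_closedBall hz)).trans (le_of_eq ?_)
    rw [Fin.sum_univ_succ]
    simp only [Fin.cons_zero, Fin.cons_succ, pow_add]
    push_cast
    field_simp

theorem hasSum_cons_iff {E : Type*} [AddCommMonoid E] [TopologicalSpace E]
    {f : (Fin (d + 1) → ℕ) → E} {x : E} :
    HasSum (fun p : (Fin d → ℕ) × ℕ => f (Fin.cons p.2 p.1)) x ↔ HasSum f x :=
  ((Equiv.prodComm _ _).trans (Fin.consEquiv fun _ => ℕ)).hasSum_iff (f := f)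

theorem hasSum_multi_geometric_two (d : ℕ) :
    HasSum (fun m : Fin d → ℕ => ∏ i, (1 / 2 : ℝ) ^ m i) (2 ^ d) := by
  induction d with
  | zero => simp [hasSum_unique]
  | succ d ih =>
    rw [← hasSum_cons_iff, pow_succ]
    have h := ih.mul hasSum_geometric_two (ih.summable.mul_of_nonneg summable_geometric_two
      (fun _ => Finset.prod_nonneg fun _ _ => by positivity) (fun _ => by positivity))
    refine h.congr_fun fun p => ?_
    rw [Fin.prod_univ_succ, mul_comm]
    rfl

/-- The Taylor series on a polydisc. -/
theorem hasSum_multiIterate_complexPartial {δ r C : ℝ} (hr : 0 < r) (hrδ : r < δ)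
    {F : (Fin d → ℂ) → ℂ} (hF : AnalyticOnNhd ℂ F (strip d δ)) (a : Fin d → ℝ)
    (hC : ∀ z : Fin d → ℂ, (∀ j, ‖z j - a j‖ ≤ r) → ‖F z‖ ≤ C) (z : Fin d → ℂ)
    (hz : ∀ j, ‖z j - a j‖ ≤ r / 2) :
    HasSum (fun m : Fin d → ℕ => multiIterate (fun n => complexPartial n) m F (fun j => (a j : ℂ))
      / multiFactorial m * ∏ i, (z i - a i) ^ m i) (F z) := by
  induction d with
  | zero =>
    have : ∀ m, multiIterate (fun n => complexPartial n) m F = F := by simp [multiIterate]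
    simp only [this, multiFactorial]
    have h := hasSum_unique (fun m : Fin 0 → ℕ => F fun j => (a j : ℂ))
    rw [Subsingleton.elim z fun j => (a j : ℂ)]
    simp only [Finset.univ_eq_empty, Finset.prod_empty, Nat.cast_one, div_one, mul_one]
    exact h
  | succ d ih =>
    have hδ : 0 < δ := hr.trans hrδ
    have hmem : (fun j : Fin d => ((a j.succ : ℝ) : ℂ)) ∈ strip d δ := fun j => by simpa using hδ
    have ha : (fun j => ((a j : ℝ) : ℂ)) = Fin.cons ((a 0 : ℝ) : ℂ) (fun j => ((a j.succ : ℝ) : ℂ)) := by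
      funext j; refine Fin.cases rfl (fun _ => rfl) j
    have hsum : Summable fun m : Fin (d + 1) → ℕ =>
        multiIterate (fun n => complexPartial n) m F (fun j => (a j : ℂ))
          / multiFactorial m * ∏ i, (z i - a i) ^ m i := by
      refine Summable.of_norm_bounded ((hasSum_multi_geometric_two (d + 1)).summable.mul_left C)
        fun m => ?_
      have h1 := norm_multiIterate_complexPartial_le hr hrδ hF a hC m
      have hf : (0 : ℝ) < multiFactorial m := by exact_mod_cast multiFactorial_pos m
      have hC0 : 0 ≤ C := (norm_nonneg _).trans (hC (fun j => (a j : ℂ)) fun j => by simpa using hr.le)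
      rw [norm_mul, norm_div, norm_prod, Complex.norm_natCast]
      calc _ ≤ (C / r ^ ∑ i, m i) * ∏ i, (r / 2) ^ m i := by
            refine mul_le_mul ?_ ?_ (Finset.prod_nonneg fun _ _ => norm_nonneg _) (by positivity)
            · rw [div_le_iff₀ hf, mul_comm]; exact h1
            · refine Finset.prod_le_prod (fun _ _ => norm_nonneg _) fun i _ => ?_
              rw [norm_pow]
              exact pow_le_pow_left₀ (norm_nonneg _) (hz i) _
        _ = _ := by
            rw [Finset.prod_pow_eq_pow_sum, Finset.prod_pow_eq_pow_sum, div_pow, div_pow, one_pow]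
            field_simp
    have htot := hasSum_cons_iff.mpr hsum.hasSum
    have hz0 : ‖z 0 - a 0‖ ≤ r := (hz 0).trans (by linarith)
    have him := abs_im_lt_of_norm_sub_le hrδ hz0
    have hfib : ∀ m : Fin d → ℕ, HasSum (fun k : ℕ =>
        multiIterate (fun n => complexPartial n) (Fin.cons k m : Fin (d + 1) → ℕ) F
          (fun j => (a j : ℂ)) / multiFactorial (Fin.cons k m : Fin (d + 1) → ℕ) *
          ∏ i, (z i - a i) ^ (Fin.cons k m : Fin (d + 1) → ℕ) i)
        (multiIterate (fun n => complexPartial n) m (fun w => F (Fin.cons (z 0) w))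
          (fun j => ((a j.succ : ℝ) : ℂ)) / multiFactorial m * ∏ i, (z i.succ - a i.succ) ^ m i) := by
      intro m
      have hG := analyticOnNhd_multiIterate Fin.succ m hF
      have hd := (analyticOnNhd_slice_zero hG hmem).mono (s := Metric.ball ((a 0 : ℝ) : ℂ) r)
        fun w hw => abs_im_lt_of_norm_sub_le hrδ (mem_ball_iff_norm.mp hw).le
      have h := (Complex.hasSum_taylorSeries_on_ball hd (z := z 0)
        (mem_ball_iff_norm.mpr ((hz 0).trans_lt (by linarith)))).mul_right
          ((multiFactorial m : ℂ)⁻¹ * ∏ i, (z i.succ - a i.succ) ^ m i)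
      rw [multiIterate_succ_cons hF him m hmem] at h
      rw [div_eq_mul_inv, mul_assoc]
      refine h.congr_fun fun k => ?_
      rw [multiIterate_cons, ha, iterate_zero_cons hG hmem k (by simpa using hδ),
        multiFactorial_cons, Fin.prod_univ_succ]
      simp only [Fin.cons_zero, Fin.cons_succ, smul_eq_mul]
      push_cast
      rw [div_eq_mul_inv, mul_inv]
      ring
    have h2 := htot.prod_fiberwise hfib
    have h3 := ih (analyticOnNhd_slice_succ hF him) (fun j => a j.succ) (fun w hw => hC _ fun j => by
      refine Fin.cases ?_ (fun j => ?_) j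
      · simpa using hz0
      · simpa using hw j) (fun j => z j.succ) fun j => hz j.succ
    have hzc : (Fin.cons (z 0) fun j => z j.succ : Fin (d + 1) → ℂ) = z := Fin.cons_self_tail z
    rw [← hzc, h3.unique h2, hzc]
    exact hsum.hasSum

end Polydisc

/-! ### Taylor expansion of the potential -/

section Taylor

open Filter Topology

variable {d : ℕ}

/-- The inclusion `ℝᵈ → ℂᵈ`. -/
noncomputable def complexify (d : ℕ) : Space d →L[ℝ] (Fin d → ℂ) :=
  ContinuousLinearMap.pi fun j => Complex.ofRealCLM.comp (EuclideanSpace.proj j)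

theorem complexify_apply (x : Space d) : complexify d x = fun j => ((x j : ℝ) : ℂ) := rfl

theorem complexify_mem_strip {δ : ℝ} (hδ : 0 < δ) (x : Space d) : complexify d x ∈ strip d δ :=
  fun j => by simpa [complexify_apply] using hδ

theorem hasFDerivAt_of_complexify {F : (Fin d → ℂ) → ℂ} {f : Space d → ℝ}
    (h : ∀ x, F (complexify d x) = f x) {x : Space d}
    (hF : DifferentiableAt ℂ F (complexify d x)) :
    HasFDerivAt f (Complex.reCLM.comp (((fderiv ℂ F (complexify d x)).restrictScalars ℝ).comp
      (complexify d))) x := by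
  have h1 := Complex.reCLM.hasFDerivAt.comp x
    ((hF.hasFDerivAt.restrictScalars ℝ).comp x (complexify d).hasFDerivAt)
  refine h1.congr_of_eventuallyEq (Eventually.of_forall fun y => ?_)
  simp [h]

theorem complexPartial_complexify {F : (Fin d → ℂ) → ℂ} {f : Space d → ℝ}
    (h : ∀ x, F (complexify d x) = f x) {x : Space d}
    (hF : DifferentiableAt ℂ F (complexify d x)) (n : Fin d) :
    complexPartial n F (complexify d x) = ((partialDeriv n f x : ℝ) : ℂ) := by
  have h1 := (hF.hasFDerivAt.restrictScalars ℝ).comp x (complexify d).hasFDerivAt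
  have h2 := Complex.ofRealCLM.hasFDerivAt.comp x
    (hasFDerivAt_of_complexify h hF).differentiableAt.hasFDerivAt
  have h3 : F ∘ complexify d = Complex.ofRealCLM ∘ f := funext fun y => by simp [h]
  rw [h3] at h1
  have h4 := congrArg (fun L => L (EuclideanSpace.single n (1 : ℝ))) (h1.unique h2)
  have h5 : complexify d (EuclideanSpace.single n (1 : ℝ)) = Pi.single n 1 := by
    funext j
    rw [complexify_apply]
    by_cases hj : j = n
    · subst hj; simp
    · simp [hj]
  simpa [complexPartial, partialDeriv, h5] using h4

/-- The complex partial derivatives of the continuation restrict to the real ones on `ℝᵈ`. -/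
theorem multiIterate_complexify {δ : ℝ} (hδ : 0 < δ) {F : (Fin d → ℂ) → ℂ} {f : Space d → ℝ}
    (hF : AnalyticOnNhd ℂ F (strip d δ)) (h : ∀ x, F (complexify d x) = f x) (m : Fin d → ℕ)
    (x : Space d) :
    multiIterate (fun n => complexPartial n) m F (complexify d x)
      = ((multiDeriv m f x : ℝ) : ℂ) := by
  refine (multiIterate_rel (T := fun n : Fin d => complexPartial n)
    (T' := fun n => partialDeriv n) (fun G g => AnalyticOnNhd ℂ G (strip d δ) ∧
      ∀ x, G (complexify d x) = ((g x : ℝ) : ℂ)) ?_ m ⟨hF, h⟩).2 x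
  rintro n G g ⟨hG, h⟩
  exact ⟨analyticOnNhd_complexPartial n hG, fun x =>
    complexPartial_complexify h (hG _ (complexify_mem_strip hδ x)).differentiableAt n⟩

theorem HasStripContinuation.contDiff {V : Space d → ℝ} {δ M τ : ℝ} (hδ : 0 < δ)
    (h : HasStripContinuation V δ M τ) : ContDiff ℝ 2 V := by
  obtain ⟨F, hF, hV, -⟩ := h
  refine contDiff_iff_contDiffAt.mpr fun x => ?_
  have h1 : ContDiffAt ℝ 2 (F ∘ complexify d) x :=
    ((hF _ (complexify_mem_strip hδ x)).contDiffAt.restrict_scalars ℝ).comp x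
      (complexify d).contDiff.contDiffAt
  have h2 : V = Complex.reCLM ∘ F ∘ complexify d := funext fun y => by
    rw [Function.comp_apply, Function.comp_apply, complexify_apply, hV, Complex.reCLM_apply,
      Complex.ofReal_re]
  rw [h2]
  exact Complex.reCLM.contDiff.contDiffAt.comp x h1

/-- The growth of `V` on `ℝᵈ`. -/
theorem HasStripContinuation.abs_le {V : Space d → ℝ} {δ M τ : ℝ} (hδ : 0 < δ)
    (h : HasStripContinuation V δ M τ) (x : Space d) : |V x| ≤ M * Real.exp (τ * ‖x‖ ^ 2) := by
  obtain ⟨F, -, hV, hb⟩ := h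
  have h1 := hb _ (complexify_mem_strip hδ x)
  rw [complexify_apply, hV, Complex.norm_real, Real.norm_eq_abs] at h1
  simpa [EuclideanSpace.norm_sq_eq] using h1

/-- Near a bounded set of base points the Taylor coefficients of `V` satisfy uniform Cauchy
estimates, and `V` is approximated by its Taylor polynomials. -/
theorem HasStripContinuation.exists_taylor {V : Space d → ℝ} {δ M τ : ℝ} (hδ : 0 < δ)
    (hM : 0 < M) (hτ : 0 < τ) (h : HasStripContinuation V δ M τ) (R : ℝ) :
    ∃ CV r : ℝ, 0 < CV ∧ 0 < r ∧ ∀ a : Space d, ‖a‖ ≤ R →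
      (∀ m, |multiDeriv m V a / multiFactorial m| ≤ CV / r ^ ∑ i, m i) ∧
      ∀ (x : Space d) (N : ℕ) (q : ℝ), 0 ≤ q → q ≤ 1 → (∀ i, |x i - a i| ≤ q * (r / 2)) →
        |V x - ∑ m ∈ multiIndices d N,
          multiDeriv m V a / multiFactorial m * ∏ i, (x i - a i) ^ m i| ≤ CV * q ^ (N + 1) := by
  obtain ⟨F, hF, hV, hb⟩ := h
  obtain ⟨r, hr0, hrδ⟩ : ∃ r, 0 < r ∧ r < δ := ⟨δ / 2, by positivity, by linarith⟩
  set C := M * Real.exp (τ * (d * (|R| + r) ^ 2)) with hCdef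
  have hC0 : 0 < C := by positivity
  refine ⟨C * 2 ^ d, r, by positivity, hr0, fun a ha => ?_⟩
  have hC : ∀ z : Fin d → ℂ, (∀ j, ‖z j - ((a j : ℝ) : ℂ)‖ ≤ r) → ‖F z‖ ≤ C := by
    intro z hz
    refine (hb z fun j => abs_im_lt_of_norm_sub_le hrδ (hz j)).trans ?_
    refine mul_le_mul_of_nonneg_left (Real.exp_le_exp.mpr (mul_le_mul_of_nonneg_left ?_ hτ.le)) hM.le
    have : ∀ j ∈ Finset.univ, ‖z j‖ ^ 2 ≤ (|R| + r) ^ 2 := by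
      intro j _
      refine pow_le_pow_left₀ (norm_nonneg _) ?_ 2
      have h1 : ‖z j‖ ≤ ‖((a j : ℝ) : ℂ)‖ + ‖z j - ((a j : ℝ) : ℂ)‖ := norm_le_norm_add_norm_sub' _ _
      have h2 : ‖((a j : ℝ) : ℂ)‖ ≤ |R| := by
        rw [Complex.norm_real]
        exact (PiLp.norm_apply_le a j).trans (ha.trans (le_abs_self R))
      linarith [hz j]
    simpa using Finset.sum_le_card_nsmul _ _ _ this
  have hmf : ∀ m : Fin d → ℕ, (0 : ℝ) < multiFactorial m := fun m => by
    exact_mod_cast multiFactorial_pos m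
  have hco : ∀ m, |multiDeriv m V a / multiFactorial m| ≤ C / r ^ ∑ i, m i := by
    intro m
    have h1 := norm_multiIterate_complexPartial_le hr0 hrδ hF (fun j => a j) hC m
    rw [← complexify_apply, multiIterate_complexify hδ hF hV, Complex.norm_real,
      Real.norm_eq_abs] at h1
    rwa [abs_div, abs_of_pos (hmf m), div_le_iff₀ (hmf m), mul_comm]
  refine ⟨fun m => (hco m).trans ?_, fun x N q hq0 hq1 hx => ?_⟩
  · exact div_le_div_of_nonneg_right (le_mul_of_one_le_right hC0.le (one_le_pow₀ one_le_two))
      (by positivity)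
  set term : (Fin d → ℕ) → ℝ := fun m =>
    multiDeriv m V a / multiFactorial m * ∏ i, (x i - a i) ^ m i with hterm
  have hs : HasSum term (V x) := by
    have h1 := hasSum_multiIterate_complexPartial hr0 hrδ hF (fun j => a j) hC (complexify d x)
      fun j => by
        rw [complexify_apply, ← Complex.ofReal_sub, Complex.norm_real, Real.norm_eq_abs]
        refine (hx j).trans (mul_le_of_le_one_left (by positivity) hq1)
    rw [← complexify_apply] at h1
    simp only [multiIterate_complexify hδ hF hV] at h1
    rw [complexify_apply, hV] at h1
    refine Complex.hasSum_ofReal.mp (h1.congr_fun fun m => ?_)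
    simp only [hterm]
    push_cast
    rfl
  have hfin := hasSum_sum_of_ne_finset_zero (L := .unconditional _)
    (f := fun m => if m ∈ multiIndices d N then term m else 0)
    (s := multiIndices d N) fun m hm => if_neg hm
  rw [Finset.sum_congr rfl fun m hm => if_pos hm] at hfin
  rw [← Real.norm_eq_abs]
  refine (hs.sub hfin).norm_le_of_bounded
    ((hasSum_multi_geometric_two d).mul_left (C * q ^ (N + 1))) (fun m => ?_) |>.trans_eq (by ring)
  split_ifs with hm
  · rw [sub_self, norm_zero]
    exact mul_nonneg (by positivity) (Finset.prod_nonneg fun _ _ => by positivity)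
  · rw [mem_multiIndices, not_le] at hm
    rw [sub_zero, hterm, norm_mul, norm_prod, Real.norm_eq_abs]
    calc _ ≤ C / r ^ (∑ i, m i) * ∏ i, (q * (r / 2)) ^ m i := by
          refine mul_le_mul (hco m) (Finset.prod_le_prod (fun _ _ => norm_nonneg _) fun i _ => ?_)
            (Finset.prod_nonneg fun _ _ => norm_nonneg _) (by positivity)
          rw [norm_pow, Real.norm_eq_abs]
          exact pow_le_pow_left₀ (abs_nonneg _) (hx i) _
      _ = C * q ^ (∑ i, m i) * ∏ i, (1 / 2 : ℝ) ^ m i := by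
          rw [Finset.prod_pow_eq_pow_sum, Finset.prod_pow_eq_pow_sum, mul_pow, div_pow, div_pow,
            one_pow]
          field_simp
      _ ≤ _ := by
          refine mul_le_mul_of_nonneg_right (mul_le_mul_of_nonneg_left
            (pow_le_pow_of_le_one hq0 hq1 hm) hC0.le)
            (Finset.prod_nonneg fun _ _ => by positivity)

/-- A function of one variable which is `O(t³)` at `0` has vanishing Taylor coefficients up to
order two. -/
theorem eq_zero_of_abs_le_cube {f f' : ℝ → ℝ} {k C : ℝ} (hf : ∀ t, HasDerivAt f (f' t) t)
    (hf' : HasDerivAt f' k 0) (hb : ∀ᶠ t in 𝓝 (0 : ℝ), |f t| ≤ C * |t| ^ 3) :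
    f 0 = 0 ∧ f' 0 = 0 ∧ k = 0 := by
  have h0 : f 0 = 0 := by simpa using hb.self_of_nhds
  have hb' : ∀ᶠ t in 𝓝[≠] (0 : ℝ), |f t| ≤ C * |t| ^ 3 := nhdsWithin_le_nhds hb
  have hne : ∀ᶠ t in 𝓝[≠] (0 : ℝ), t ≠ 0 := self_mem_nhdsWithin
  have hsmall : ∀ n : ℕ, n ≠ 0 → Tendsto (fun t : ℝ => C * |t| ^ n) (𝓝[≠] 0) (𝓝 0) := by
    intro n hn
    have : Continuous fun t : ℝ => C * |t| ^ n := by fun_prop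
    have h := (this.tendsto 0).mono_left (nhdsWithin_le_nhds (s := {0}ᶜ))
    simpa [hn] using h
  have h1 : f' 0 = 0 := by
    have hs := hasDerivAt_iff_tendsto_slope.mp (hf 0)
    refine tendsto_nhds_unique hs (squeeze_zero_norm' ?_ (hsmall 2 two_ne_zero))
    filter_upwards [hb', hne] with t ht hne
    rw [slope_def_field, h0, sub_zero, sub_zero, norm_div, Real.norm_eq_abs, Real.norm_eq_abs,
      div_le_iff₀ (abs_pos.mpr hne)]
    linarith [ht, show C * |t| ^ 2 * |t| = C * |t| ^ 3 by ring]
  refine ⟨h0, h1, ?_⟩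
  have hlim : Tendsto (fun t => f t / t ^ 2) (𝓝[≠] 0) (𝓝 (k / 2)) := by
    refine HasDerivAt.lhopital_zero_nhdsNE (f' := f') (g' := fun t => 2 * t)
      (Eventually.of_forall hf) (Eventually.of_forall fun t => ?_) ?_ ?_ ?_ ?_
    · simpa using hasDerivAt_pow 2 t
    · filter_upwards [hne] with t ht using mul_ne_zero two_ne_zero ht
    · have := (hf 0).continuousAt.tendsto
      rw [h0] at this
      exact this.mono_left nhdsWithin_le_nhds
    · have : Continuous fun t : ℝ => t ^ 2 := by fun_prop
      have h := (this.tendsto 0).mono_left (nhdsWithin_le_nhds (s := {0}ᶜ))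
      simpa using h
    · have hs := (hasDerivAt_iff_tendsto_slope.mp hf').div_const 2
      refine hs.congr' ?_
      filter_upwards [hne] with t ht
      rw [slope_def_field, h1]
      field_simp
      ring
  have h0' : Tendsto (fun t => f t / t ^ 2) (𝓝[≠] 0) (𝓝 0) := by
    refine squeeze_zero_norm' ?_ (hsmall 1 one_ne_zero)
    filter_upwards [hb', hne] with t ht hne
    have h2 : 0 < |t| ^ 2 := by positivity
    rw [norm_div, norm_pow, Real.norm_eq_abs, Real.norm_eq_abs, div_le_iff₀ h2]
    linarith [ht, show C * |t| ^ 1 * |t| ^ 2 = C * |t| ^ 3 by ring]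
  linarith [tendsto_nhds_unique hlim h0']

/-- A quadratic polynomial which approximates `V` to third order is the second order Taylor
polynomial. -/
theorem sum_multiIndices_two_eq {V : Space d → ℝ} (hV : ContDiff ℝ 2 V) (a : Space d)
    (c : (Fin d → ℕ) → ℝ) {C ρ : ℝ} (hρ : 0 < ρ)
    (hb : ∀ (x : Space d) (q : ℝ), 0 ≤ q → q ≤ 1 → (∀ i, |x i - a i| ≤ q * ρ) →
      |V x - ∑ m ∈ multiIndices d 2, c m * ∏ i, (x i - a i) ^ m i| ≤ C * q ^ 3) (x : Space d) :
    ∑ m ∈ multiIndices d 2, c m * ∏ i, (x i - a i) ^ m i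
      = V a + fderiv ℝ V a (x - a) + 1 / 2 * fderiv ℝ (fderiv ℝ V) a (x - a) (x - a) := by
  set h := x - a with hh
  set w : (Fin d → ℕ) → ℝ := fun m => c m * ∏ i, h i ^ m i with hw
  set deg : (Fin d → ℕ) → ℕ := fun m => ∑ i, m i with hdeg
  have hline : ∀ t : ℝ, HasDerivAt (fun t : ℝ => a + t • h) h t := fun t => by
    simpa using ((hasDerivAt_id t).smul_const h).const_add a
  have hV1 : Differentiable ℝ V := hV.differentiable two_ne_zero
  have hV2 : Differentiable ℝ (fderiv ℝ V) :=
    (hV.fderiv_right (m := 1) le_rfl).differentiable one_ne_zero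
  have hf : ∀ t, HasDerivAt (fun t => V (a + t • h) - ∑ m ∈ multiIndices d 2, w m * t ^ deg m)
      (fderiv ℝ V (a + t • h) h
        - ∑ m ∈ multiIndices d 2, w m * (deg m * t ^ (deg m - 1))) t := fun t =>
    ((hV1 _).hasFDerivAt.comp_hasDerivAt t (hline t)).sub
      (HasDerivAt.fun_sum fun m _ => (hasDerivAt_pow (deg m) t).const_mul (w m))
  have hf' : HasDerivAt (fun t => fderiv ℝ V (a + t • h) h
        - ∑ m ∈ multiIndices d 2, w m * (deg m * t ^ (deg m - 1)))
      (fderiv ℝ (fderiv ℝ V) (a + (0 : ℝ) • h) h h - ∑ m ∈ multiIndices d 2,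
        w m * (deg m * ((deg m - 1 : ℕ) * 0 ^ (deg m - 1 - 1)))) 0 :=
    (((hV2 _).hasFDerivAt.comp_hasDerivAt (0 : ℝ) (hline 0)).clm_apply
      (hasDerivAt_const _ h) |>.congr_deriv (by simp)).sub
      (HasDerivAt.fun_sum fun m _ =>
        ((hasDerivAt_pow (deg m - 1) (0 : ℝ)).const_mul ((deg m : ℝ))).const_mul (w m))
  set K := ‖h‖ / ρ + 1 with hK
  have hK0 : 0 < K := by positivity
  have hcube : ∀ᶠ t in 𝓝 (0 : ℝ),
      |V (a + t • h) - ∑ m ∈ multiIndices d 2, w m * t ^ deg m| ≤ C * K ^ 3 * |t| ^ 3 := by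
    have hev : ∀ᶠ t in 𝓝 (0 : ℝ), |t| < 1 / K := by
      have := Metric.ball_mem_nhds (0 : ℝ) (one_div_pos.mpr hK0)
      filter_upwards [this] with t ht
      simpa using ht
    filter_upwards [hev] with t ht
    have h1 := hb (a + t • h) (K * |t|) (by positivity)
      (by rw [lt_div_iff₀ hK0] at ht; linarith) fun i => ?_
    · have h2 : ∑ m ∈ multiIndices d 2, c m * ∏ i, ((a + t • h) i - a i) ^ m i
          = ∑ m ∈ multiIndices d 2, w m * t ^ deg m := by
        refine Finset.sum_congr rfl fun m _ => ?_
        simp only [hw, hdeg, PiLp.add_apply, PiLp.smul_apply, smul_eq_mul, add_sub_cancel_left,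
          mul_pow, Finset.prod_mul_distrib, Finset.prod_pow_eq_pow_sum]
        ring
      rw [h2] at h1
      refine h1.trans_eq (by ring)
    · simp only [PiLp.add_apply, PiLp.smul_apply, smul_eq_mul, add_sub_cancel_left, abs_mul]
      have h3 : |h i| ≤ ‖h‖ := PiLp.norm_apply_le h i
      have h4 : K * ρ = ‖h‖ + ρ := by rw [hK]; field_simp
      nlinarith [abs_nonneg t, mul_le_mul_of_nonneg_left h3 (abs_nonneg t),
        mul_nonneg (abs_nonneg t) hρ.le]
  obtain ⟨e0, e1, e2⟩ := eq_zero_of_abs_le_cube hf hf' hcube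
  simp only [zero_smul, add_zero] at e0 e1 e2
  have key : ∀ m ∈ multiIndices d 2, w m = w m * 0 ^ deg m + w m * (deg m * 0 ^ (deg m - 1))
      + 1 / 2 * (w m * (deg m * ((deg m - 1 : ℕ) * 0 ^ (deg m - 1 - 1)))) := by
    intro m hm
    have hm' : deg m ≤ 2 := mem_multiIndices.mp hm
    interval_cases hdm : deg m <;> norm_num
    ring
  have hsum : ∑ m ∈ multiIndices d 2, c m * ∏ i, (x i - a i) ^ m i = ∑ m ∈ multiIndices d 2, w m :=
    Finset.sum_congr rfl fun m _ => by simp [hw, hh]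
  rw [hsum, Finset.sum_congr rfl key, Finset.sum_add_distrib, Finset.sum_add_distrib,
    ← Finset.mul_sum]
  linarith

theorem bilin_eq_sum {V : Space d → ℝ} (hV : ContDiff ℝ 2 V) (a x : Space d) :
    ((fderiv ℝ V a (x - a) : ℝ) : ℂ) = (fun n => ((partialDeriv n V a : ℝ) : ℂ)) ⬝ᵥ disp a x ∧
    ((fderiv ℝ (fderiv ℝ V) a (x - a) (x - a) : ℝ) : ℂ)
      = disp a x ⬝ᵥ hessianC V a *ᵥ disp a x := by
  have hx : x - a = ∑ n, (x n - a n) • EuclideanSpace.single n (1 : ℝ) := by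
    ext i
    simp [Finset.sum_apply, Pi.single_apply]
  constructor
  · rw [hx]
    simp only [map_sum, map_smul, smul_eq_mul, dotProduct, disp, partialDeriv]
    push_cast
    exact Finset.sum_congr rfl fun n _ => mul_comm _ _
  · rw [hx]
    simp only [map_sum, map_smul, smul_eq_mul, dotProduct, disp, mulVec, hessianC, hessian,
      Matrix.map_apply, of_apply, partialDeriv_partialDeriv hV, _root_.sum_apply,
      _root_.smul_apply]
    push_cast
    simp only [Finset.mul_sum]
    rw [Finset.sum_comm]
    exact Finset.sum_congr rfl fun n _ => Finset.sum_congr rfl fun k _ => by ring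

/-- The Taylor polynomial of degree `l + 1` is the sum of the quadratic part, which drives the
classical motion, and of the higher part `Z`. -/
theorem sum_multiIndices_eq_quadPot_add_taylorTail {V : Space d → ℝ} (hV : ContDiff ℝ 2 V)
    {a : Space d} {C ρ : ℝ} (hρ : 0 < ρ)
    (hb : ∀ (x : Space d) (q : ℝ), 0 ≤ q → q ≤ 1 → (∀ i, |x i - a i| ≤ q * ρ) →
      |V x - ∑ m ∈ multiIndices d 2, multiDeriv m V a / multiFactorial m
        * ∏ i, (x i - a i) ^ m i| ≤ C * q ^ 3) {l : ℕ} (hl : 1 ≤ l) (x : Space d) :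
    ((∑ m ∈ multiIndices d (l + 1), multiDeriv m V a / multiFactorial m
        * ∏ i, (x i - a i) ^ m i : ℝ) : ℂ)
      = eval (disp a x) (quadPot V a) + (taylorTail V l a x : ℂ) := by
  rw [← Finset.sum_filter_add_sum_filter_not _ (fun m : Fin d → ℕ => 3 ≤ ∑ i, m i), add_comm]
  have hset : (multiIndices d (l + 1)).filter (fun m => ¬ 3 ≤ ∑ i, m i) = multiIndices d 2 := by
    ext m
    simp only [Finset.mem_filter, mem_multiIndices]
    omega
  rw [hset, sum_multiIndices_two_eq hV a _ hρ hb x, eval_quadPot]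
  push_cast
  rw [(bilin_eq_sum hV a x).1, (bilin_eq_sum hV a x).2, taylorTail]
  push_cast
  rfl

end Taylor

/-! ### Weighted sizes of Hermite expansions -/

section HermiteSize

variable {d : ℕ}

/-- `p = ∑_{|j| ≤ N} f_j H_j` with `∑ θ^{|j|} |f_j| ≤ κ`. -/
def HasSize (A : Matrix (Fin d) (Fin d) ℂ) (ħ θ : ℝ) (p : Poly d) (N : ℕ) (κ : ℝ) : Prop :=
  ∃ f : (Fin d → ℕ) → ℂ, p = ∑ j ∈ multiIndices d N, f j • hermitePoly A ħ j ∧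
    ∑ j ∈ multiIndices d N, θ ^ (∑ i, j i) * ‖f j‖ ≤ κ

variable {A B : Matrix (Fin d) (Fin d) ℂ} {ħ θ κ κ' : ℝ} {p q : Poly d} {N N' : ℕ}

theorem HasSize.nonneg (h : HasSize A ħ θ p N κ) (hθ : 0 ≤ θ) : 0 ≤ κ := by
  obtain ⟨f, -, hf⟩ := h
  exact (Finset.sum_nonneg fun j _ => by positivity).trans hf

theorem multiIndices_mono (h : N ≤ N') : multiIndices d N ⊆ multiIndices d N' := fun _ hj =>
  mem_multiIndices.mpr ((mem_multiIndices.mp hj).trans h)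

theorem HasSize.mono (h : HasSize A ħ θ p N κ) (hN : N ≤ N') (hκ : κ ≤ κ') :
    HasSize A ħ θ p N' κ' := by
  obtain ⟨f, hp, hf⟩ := h
  refine ⟨fun j => if j ∈ multiIndices d N then f j else 0, ?_, ?_⟩
  · rw [hp]
    refine Finset.sum_subset_zero_on_sdiff (multiIndices_mono hN) (fun j hj => ?_) fun j hj => ?_
    · simp [(Finset.mem_sdiff.mp hj).2]
    · simp [hj]
  · refine le_trans (le_of_eq (Eq.symm ?_)) (hf.trans hκ)
    refine Finset.sum_subset_zero_on_sdiff (multiIndices_mono hN) (fun j hj => ?_) fun j hj => ?_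
    · simp [(Finset.mem_sdiff.mp hj).2]
    · simp [hj]

theorem HasSize.add (hp : HasSize A ħ θ p N κ) (hq : HasSize A ħ θ q N κ') (hθ : 0 ≤ θ) :
    HasSize A ħ θ (p + q) N (κ + κ') := by
  obtain ⟨f, hp, hf⟩ := hp
  obtain ⟨g, hq, hg⟩ := hq
  refine ⟨f + g, by simp only [hp, hq, Pi.add_apply, add_smul, Finset.sum_add_distrib], ?_⟩
  refine le_trans ?_ (add_le_add hf hg)
  rw [← Finset.sum_add_distrib]
  refine Finset.sum_le_sum fun j _ => ?_
  rw [← mul_add]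
  exact mul_le_mul_of_nonneg_left (norm_add_le _ _) (by positivity)

theorem HasSize.smul (hp : HasSize A ħ θ p N κ) (c : ℂ) : HasSize A ħ θ (c • p) N (‖c‖ * κ) := by
  obtain ⟨f, hp, hf⟩ := hp
  refine ⟨c • f, by simp only [hp, Finset.smul_sum, Pi.smul_apply, smul_eq_mul, smul_smul], ?_⟩
  refine le_trans (le_of_eq ?_) (mul_le_mul_of_nonneg_left hf (norm_nonneg c))
  rw [Finset.mul_sum]
  refine Finset.sum_congr rfl fun j _ => ?_
  rw [Pi.smul_apply, norm_smul]
  ring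

theorem HasSize.sum {ι : Type*} {S : Finset ι} {p : ι → Poly d} {κ : ι → ℝ} (hθ : 0 ≤ θ)
    (h : ∀ i ∈ S, HasSize A ħ θ (p i) N (κ i)) : HasSize A ħ θ (∑ i ∈ S, p i) N (∑ i ∈ S, κ i) := by
  classical
  induction S using Finset.induction_on with
  | empty => exact ⟨0, by simp, by simp⟩
  | insert i S hi ih =>
    rw [Finset.sum_insert hi, Finset.sum_insert hi]
    exact (h i (Finset.mem_insert_self i S)).add
      (ih fun k hk => h k (Finset.mem_insert_of_mem hk)) hθ

theorem hasSize_hermitePoly {j : Fin d → ℕ} (hj : ∑ i, j i ≤ N) :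
    HasSize A ħ θ (hermitePoly A ħ j) N (θ ^ ∑ i, j i) := by
  classical
  refine ⟨Pi.single j 1, ?_, ?_⟩
  · rw [Finset.sum_eq_single_of_mem j (mem_multiIndices.mpr hj) fun k _ hk => by
      rw [Pi.single_eq_of_ne hk, zero_smul]]
    simp
  · rw [Finset.sum_eq_single_of_mem j (mem_multiIndices.mpr hj) fun k _ hk => by
      rw [Pi.single_eq_of_ne hk, norm_zero, mul_zero]]
    simp

/-- The size of the image under a linear map is controlled by the images of the `H_j`. -/
theorem HasSize.map (hp : HasSize A ħ θ p N κ) (hθ : 0 ≤ θ) {L : Poly d →ₗ[ℂ] Poly d} {K : ℝ}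
    (hK : 0 ≤ K) (hL : ∀ j, ∑ i, j i ≤ N →
      HasSize A ħ θ (L (hermitePoly A ħ j)) N' (K * θ ^ ∑ i, j i)) :
    HasSize A ħ θ (L p) N' (K * κ) := by
  obtain ⟨f, hp, hf⟩ := hp
  rw [hp, map_sum]
  refine (HasSize.sum hθ (κ := fun j => ‖f j‖ * (K * θ ^ ∑ i, j i)) fun j hj => ?_).mono le_rfl
    (le_trans (le_of_eq ?_) (mul_le_mul_of_nonneg_left hf hK))
  · rw [map_smul]
    exact (hL j (mem_multiIndices.mp hj)).smul (f j)
  · rw [Finset.mul_sum]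
    exact Finset.sum_congr rfl fun j _ => by ring

theorem HasSize.raiseOp (h : Admissible A B) (hħ : 0 < ħ) (hθ : 1 ≤ θ) (hp : HasSize A ħ θ p N κ)
    (m : Fin d) : HasSize A ħ θ (raiseOp A ħ m p) (N + 1) (θ * √(N + 1) * κ) := by
  have hθ0 : 0 ≤ θ := zero_le_one.trans hθ
  refine hp.map hθ0 (by positivity) fun j hj => ?_
  rw [raiseOp_hermitePoly h hħ]
  have hs : ∑ i, (j + Pi.single m 1 : Fin d → ℕ) i ≤ N + 1 := by rw [sum_add_single]; omega
  refine ((hasSize_hermitePoly hs).smul _).mono le_rfl ?_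
  rw [sum_add_single, pow_succ, Complex.norm_real, Real.norm_of_nonneg (Real.sqrt_nonneg _)]
  have hjm : (j m : ℝ) ≤ N := by
    exact_mod_cast (Finset.single_le_sum (fun i _ => Nat.zero_le (j i)) (Finset.mem_univ m)).trans hj
  calc √(j m + 1) * (θ ^ (∑ i, j i) * θ) ≤ √(N + 1) * (θ ^ (∑ i, j i) * θ) := by gcongr
    _ = _ := by ring

theorem HasSize.lowerOp (h : Admissible A B) (hħ : 0 < ħ) (hθ : 1 ≤ θ) (hp : HasSize A ħ θ p N κ)
    (m : Fin d) : HasSize A ħ θ (lowerOp A ħ m p) (N + 1) (√(N + 1) * κ) := by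
  have hθ0 : 0 ≤ θ := zero_le_one.trans hθ
  refine hp.map hθ0 (by positivity) fun j hj => ?_
  by_cases hjm : j m = 0
  · rw [lowerOp_hermitePoly_of_eq_zero h hħ hjm]
    exact ⟨0, by simp, by simp; positivity⟩
  obtain ⟨k, rfl⟩ : ∃ k, j = k + Pi.single m 1 := by
    refine ⟨j - Pi.single m 1, (tsub_add_cancel_of_le fun i => ?_).symm⟩
    by_cases hi : i = m
    · subst hi; simpa using Nat.one_le_iff_ne_zero.mpr hjm
    · simp [hi]
  rw [lowerOp_hermitePoly_add h hħ]
  rw [sum_add_single] at hj ⊢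
  refine ((hasSize_hermitePoly (N := N + 1) (by omega)).smul _).mono le_rfl ?_
  rw [Complex.norm_real, Real.norm_of_nonneg (Real.sqrt_nonneg _)]
  have hkm : (k m : ℝ) ≤ N := by
    have := Finset.single_le_sum (fun i _ => Nat.zero_le (k i)) (Finset.mem_univ m)
    exact_mod_cast this.trans (by omega)
  gcongr
  exact Nat.le_succ _

/-- Multiplication by a coordinate costs a factor `√ħ` and a square root of the degree. -/
theorem HasSize.X_mul (h : Admissible A B) (hħ : 0 < ħ) (hθ : 1 ≤ θ) {CA K : ℝ}
    (hA : ∀ n m, ‖A n m‖ ≤ CA) (hK : d * CA * (θ + 1) ≤ K) (hp : HasSize A ħ θ p N κ) (n : Fin d) :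
    HasSize A ħ θ (X n * p) (N + 1) (K * √(ħ * (N + 1)) * κ) := by
  have hθ0 : 0 ≤ θ := zero_le_one.trans hθ
  have hκ := hp.nonneg hθ0
  rw [X_mul_eq_ladder h hħ]
  refine ((HasSize.sum hθ0 fun m _ => ((hp.raiseOp h hħ hθ m).smul (A n m)).add
    ((hp.lowerOp h hħ hθ m).smul (star (A n m))) hθ0).smul _).mono le_rfl ?_
  have h1 : ∑ m, (‖A n m‖ * (θ * √(N + 1) * κ) + ‖star (A n m)‖ * (√(N + 1) * κ))
      ≤ K * (√(N + 1) * κ) := by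
    calc _ ≤ ∑ _m : Fin d, CA * (θ + 1) * (√(N + 1) * κ) := by
          refine Finset.sum_le_sum fun m _ => ?_
          rw [norm_star]
          calc _ = ‖A n m‖ * ((θ + 1) * (√(N + 1) * κ)) := by ring
            _ ≤ CA * ((θ + 1) * (√(N + 1) * κ)) := by gcongr; exact hA n m
            _ = _ := by ring
      _ = d * CA * (θ + 1) * (√(N + 1) * κ) := by simp; ring
      _ ≤ _ := by gcongr
  have h2 : ‖(√(2 * ħ) : ℂ) / 2‖ ≤ √ħ := by
    rw [norm_div, Complex.norm_real, Real.norm_of_nonneg (Real.sqrt_nonneg _), RCLike.norm_ofNat,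
      div_le_iff₀ two_pos]
    have : √(2 * ħ) ≤ √(4 * ħ) := Real.sqrt_le_sqrt (by linarith)
    rwa [show (4 : ℝ) * ħ = ħ * 2 ^ 2 by ring, Real.sqrt_mul hħ.le, Real.sqrt_sq two_pos.le] at this
  calc _ ≤ √ħ * (K * (√(N + 1) * κ)) :=
        mul_le_mul h2 h1 (Finset.sum_nonneg fun m _ => by positivity) (Real.sqrt_nonneg _)
    _ = _ := by rw [Real.sqrt_mul hħ.le]; ring

theorem HasSize.monomial_mul (h : Admissible A B) (hħ : 0 < ħ) (hθ : 1 ≤ θ) {CA K b : ℝ}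
    (hCA : 0 ≤ CA) (hA : ∀ n m, ‖A n m‖ ≤ CA) (hK : d * CA * (θ + 1) ≤ K)
    (hp : HasSize A ħ θ p N κ) {L : ℕ} (hb : K * √(ħ * (N + L)) ≤ b) (m : Fin d → ℕ)
    (hm : ∑ i, m i ≤ L) :
    HasSize A ħ θ ((∏ i, X i ^ m i) * p) (N + ∑ i, m i) (b ^ (∑ i, m i) * κ) := by
  have hθ0 : 0 ≤ θ := zero_le_one.trans hθ
  have hκ := hp.nonneg hθ0
  have hK0 : 0 ≤ K := le_trans (by positivity) hK
  have hb0 : 0 ≤ b := le_trans (by positivity) hb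
  induction m using multiIndex_induction with
  | h0 => simpa using hp
  | hs m n ih =>
    rw [sum_add_single] at hm ⊢
    have h1 : (∏ i, X i ^ (m + Pi.single n 1 : Fin d → ℕ) i : Poly d) * p
        = X n * ((∏ i, X i ^ m i) * p) := by
      simp only [Pi.add_apply, pow_add, Finset.prod_mul_distrib]
      have : (∏ i, X i ^ (Pi.single n 1 : Fin d → ℕ) i : Poly d) = X n := by
        rw [Finset.prod_eq_single n (fun i _ hi => by simp [hi]) (by simp)]
        simp
      rw [this]; ring
    rw [h1]
    refine ((ih (by omega)).X_mul h hħ hθ hA hK n).mono le_rfl ?_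
    rw [pow_succ', mul_assoc b]
    refine mul_le_mul_of_nonneg_right (le_trans ?_ hb) (by positivity)
    have : (((N + ∑ i, m i : ℕ) : ℝ) + 1) ≤ N + L := by exact_mod_cast (by omega)
    gcongr

/-- Multiplication by `|y|^{2k}`. The rising factorial records the growth of the degree along the
`2k` multiplications by coordinates. -/
theorem HasSize.normSq_pow_mul (h : Admissible A B) (hħ : 0 < ħ) (hθ : 1 ≤ θ) {CA K : ℝ}
    (hCA : 0 ≤ CA) (hA : ∀ n m, ‖A n m‖ ≤ CA) (hK : d * CA * (θ + 1) ≤ K)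
    (hp : HasSize A ħ θ p N κ) (k : ℕ) :
    HasSize A ħ θ ((∑ n, X n * X n) ^ k * p) (N + 2 * k)
      ((2 * d * K ^ 2 * ħ) ^ k * (N + 1).ascFactorial k * κ) := by
  have hθ0 : 0 ≤ θ := zero_le_one.trans hθ
  have hK0 : 0 ≤ K := le_trans (by positivity) hK
  induction k with
  | zero => simpa using hp
  | succ k ih =>
    rw [pow_succ', mul_assoc, Finset.sum_mul]
    set κ₁ := (2 * d * K ^ 2 * ħ) ^ k * (N + 1).ascFactorial k * κ with hκ₁
    have hκ₁0 : 0 ≤ κ₁ := ih.nonneg hθ0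
    refine (HasSize.sum hθ0 (N := N + 2 * (k + 1))
      (κ := fun _ => K ^ 2 * ħ * (2 * (N + 1 + k)) * κ₁) fun n _ => ?_).mono le_rfl (le_of_eq ?_)
    · rw [mul_assoc]
      refine ((ih.X_mul h hħ hθ hA hK n).X_mul h hħ hθ hA hK n).mono (by omega) ?_
      push_cast
      set M : ℝ := 2 * (N + 1 + k) with hM
      have h1 : √(ħ * ((N : ℝ) + 2 * k + 1)) ≤ √(ħ * M) := by gcongr; rw [hM]; linarith [N.cast_nonneg (α := ℝ)]
      have h2 : √(ħ * ((N : ℝ) + 2 * k + 1 + 1)) ≤ √(ħ * M) := by gcongr; rw [hM]; linarith [N.cast_nonneg (α := ℝ)]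
      calc _ = K ^ 2 * (√(ħ * ((N : ℝ) + 2 * k + 1 + 1)) * √(ħ * ((N : ℝ) + 2 * k + 1))) * κ₁ := by ring
        _ ≤ K ^ 2 * (√(ħ * M) * √(ħ * M)) * κ₁ := by gcongr
        _ = _ := by rw [Real.mul_self_sqrt (by positivity)]; ring
    · rw [Finset.sum_const, Finset.card_univ, Fintype.card_fin, nsmul_eq_mul, Nat.ascFactorial_succ,
        hκ₁, pow_succ]
      push_cast
      ring

/-- The truncated exponential series of `ν |y|² / ħ`. -/
noncomputable def expSeries (d : ℕ) (ħ ν : ℝ) (n : ℕ) : Poly d :=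
  ∑ k ∈ Finset.range n, (((ν / ħ) ^ k / k.factorial : ℝ) : ℂ) • (∑ i, X i * X i) ^ k

/-- The growth in `k` of the sizes of `|y|^{2k} H_j` is beaten by `k!`. -/
theorem HasSize.expSeries_mul (h : Admissible A B) (hħ : 0 < ħ) {CA K ν : ℝ} (hCA : 0 ≤ CA)
    (hA : ∀ n m, ‖A n m‖ ≤ CA) (hK : d * CA * (1 + 1) ≤ K) (hν : 0 ≤ ν)
    (hνK : 2 * d * K ^ 2 * ν ≤ 1 / 4) (hp : HasSize A ħ 1 p N κ) (n : ℕ) :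
    HasSize A ħ 1 (expSeries d ħ ν n * p) (N + 2 * n) (2 ^ N * κ * 2) := by
  have hκ := hp.nonneg zero_le_one
  have hK0 : 0 ≤ K := le_trans (by positivity) hK
  rw [expSeries, Finset.sum_mul]
  refine (HasSize.sum zero_le_one (κ := fun k => 2 ^ N * κ * (1 / 2) ^ k) fun k hk => ?_).mono
    le_rfl ?_
  · rw [smul_mul_assoc]
    have hk' := Finset.mem_range.mp hk
    refine ((hp.normSq_pow_mul h hħ le_rfl hCA hA hK k).smul _).mono (by omega) ?_
    rw [Complex.norm_real, Real.norm_of_nonneg (by positivity), Nat.ascFactorial_eq_factorial_mul_choose]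
    push_cast
    have hfac : (k.factorial : ℝ) ≠ 0 := by positivity
    have h1 : ((N + k).choose k : ℝ) ≤ 2 ^ (N + k) := by exact_mod_cast Nat.choose_le_two_pow _ _
    calc _ = (2 * d * K ^ 2 * ν) ^ k * ((N + k).choose k : ℝ) * κ := by
          rw [div_pow, mul_pow (2 * (d : ℝ) * K ^ 2) ħ, mul_pow (2 * (d : ℝ) * K ^ 2) ν]
          field_simp
      _ ≤ (1 / 4) ^ k * 2 ^ (N + k) * κ := by gcongr
      _ = _ := by
          rw [pow_add, show (1 / 4 : ℝ) = 1 / 2 * (1 / 2) by norm_num, mul_pow]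
          have : (1 / 2 : ℝ) ^ k * 2 ^ k = 1 := by rw [← mul_pow]; norm_num
          linear_combination (1 / 2 : ℝ) ^ k * 2 ^ N * κ * this
  · rw [← Finset.mul_sum]
    exact mul_le_mul_of_nonneg_left (sum_geometric_two_le n) (by positivity)

/-- The polynomial in `y` of the Taylor tail `Z`. -/
noncomputable def tailPoly (V : Space d → ℝ) (l : ℕ) (a : Space d) : Poly d :=
  ∑ m ∈ (multiIndices d (l + 1)).filter (fun m => 3 ≤ ∑ i, m i),
    ((multiDeriv m V a / (multiFactorial m : ℝ) : ℝ) : ℂ) • ∏ i, X i ^ m i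

theorem eval_tailPoly (V : Space d → ℝ) (l : ℕ) (a x : Space d) :
    eval (disp a x) (tailPoly V l a) = (taylorTail V l a x : ℂ) := by
  simp only [tailPoly, taylorTail, map_sum, smul_eval, map_prod, map_pow, eval_X, disp]
  push_cast
  rfl

theorem sum_prod_half_le (S : Finset (Fin d → ℕ)) : ∑ m ∈ S, (1 / 2 : ℝ) ^ (∑ i, m i) ≤ 2 ^ d := by
  simp only [← Finset.prod_pow_eq_pow_sum]
  exact sum_le_hasSum S (fun m _ => Finset.prod_nonneg fun _ _ => by positivity)
    (hasSum_multi_geometric_two d)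

/-- On functions of moderate degree the Taylor tail acts as a small bounded operator: all its
monomials have degree at least three, and each coordinate costs at most `ρ r`. -/
theorem HasSize.tailPoly_mul (h : Admissible A B) (hħ : 0 < ħ) (hθ : 1 ≤ θ) {CA K r ρ CV : ℝ}
    (hCA : 0 ≤ CA) (hA : ∀ n m, ‖A n m‖ ≤ CA) (hK : d * CA * (θ + 1) ≤ K) (hr : 0 < r)
    {V : Space d → ℝ} {a : Space d} {l : ℕ} (hCV : 0 ≤ CV)
    (hV : ∀ m, |multiDeriv m V a / multiFactorial m| ≤ CV / r ^ ∑ i, m i)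
    (hρ : 2 * ρ ≤ 1) (hp : HasSize A ħ θ p N κ) (hb : K * √(ħ * (N + (l + 1 : ℕ))) ≤ ρ * r) :
    HasSize A ħ θ (tailPoly V l a * p) (N + (l + 1)) (CV * 2 ^ d * (2 * ρ) ^ 3 * κ) := by
  have hθ0 : 0 ≤ θ := zero_le_one.trans hθ
  have hκ := hp.nonneg hθ0
  have hK0 : 0 ≤ K := le_trans (by positivity) hK
  have hρ0 : 0 ≤ ρ := by
    by_contra hneg
    have : ρ * r < 0 := mul_neg_of_neg_of_pos (not_le.mp hneg) hr
    linarith [mul_nonneg hK0 (Real.sqrt_nonneg (ħ * (N + (l + 1 : ℕ))))]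
  rw [tailPoly, Finset.sum_mul]
  refine (HasSize.sum hθ0 (κ := fun m => CV * (2 * ρ) ^ 3 * κ * (1 / 2) ^ (∑ i, m i))
    fun m hm => ?_).mono le_rfl ?_
  · obtain ⟨hm1, hm3⟩ := Finset.mem_filter.mp hm
    rw [mem_multiIndices] at hm1
    rw [smul_mul_assoc]
    refine ((hp.monomial_mul h hħ hθ hCA hA hK hb m hm1).smul _).mono (by omega) ?_
    rw [Complex.norm_real, Real.norm_eq_abs]
    calc _ ≤ CV / r ^ (∑ i, m i) * ((ρ * r) ^ (∑ i, m i) * κ) :=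
          mul_le_mul_of_nonneg_right (hV m) (by positivity)
      _ = CV * ((2 * ρ) ^ (∑ i, m i) * (1 / 2) ^ (∑ i, m i)) * κ := by
          rw [← mul_pow, mul_pow ρ r, show 2 * ρ * (1 / 2) = ρ by ring]
          field_simp
      _ ≤ CV * ((2 * ρ) ^ 3 * (1 / 2) ^ (∑ i, m i)) * κ := by
          have := pow_le_pow_of_le_one (by positivity : 0 ≤ 2 * ρ) hρ hm3
          gcongr
      _ = _ := by ring
  · rw [← Finset.mul_sum]
    calc _ ≤ CV * (2 * ρ) ^ 3 * κ * 2 ^ d :=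
          mul_le_mul_of_nonneg_left (sum_prod_half_le _) (by positivity)
      _ = _ := by ring

end HermiteSize

/-! ### Wave packets in `L²` -/

section L2Packets

open MeasureTheory Filter Topology

variable {d : ℕ} {A B : Matrix (Fin d) (Fin d) ℂ} {s : ℂ} {ħ : ℝ}

theorem Admissible.sqrt_ne_zero (h : Admissible A B) (hs : s ^ 2 = A.det) : s ≠ 0 := by
  rintro rfl
  exact h.det_ne_zero (by rw [← hs]; simp)

theorem continuous_polyPacket (A B : Matrix (Fin d) (Fin d) ℂ) (s : ℂ) (ħ : ℝ) (a η : Space d)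
    (p : Poly d) : Continuous (polyPacket A B s ħ a η p) :=
  (contDiff_polyPacket A B s ħ a η p (k := 0)).continuous

/-- The wave packet with polynomial factor `p`, as an element of `L²`. -/
noncomputable def packetL2 (h : Admissible A B) (hħ : 0 < ħ) (hs : s ^ 2 = A.det) (a η : Space d) :
    Poly d →ₗ[ℂ] L2 d where
  toFun p := (memLp_polyPacket (a := a) (η := η) hħ h (h.sqrt_ne_zero hs) p).toLp
  map_add' p q := by
    rw [← MemLp.toLp_add]
    congr 1
    exact funext fun x => polyPacket_add A B s ħ a η p q x
  map_smul' c p := by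
    rw [RingHom.id_apply, ← MemLp.toLp_const_smul]
    congr 1
    exact funext fun x => polyPacket_smul A B s ħ a η c p x

variable (h : Admissible A B) (hħ : 0 < ħ) (hs : s ^ 2 = A.det) (a η : Space d)

theorem packetL2_apply (p : Poly d) : packetL2 h hħ hs a η p
    = (memLp_polyPacket (a := a) (η := η) hħ h (h.sqrt_ne_zero hs) p).toLp := rfl

theorem coeFn_packetL2 (p : Poly d) :
    packetL2 h hħ hs a η p =ᵐ[volume] polyPacket A B s ħ a η p :=
  MemLp.coeFn_toLp (memLp_polyPacket hħ h (h.sqrt_ne_zero hs) p)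

theorem inner_packetL2 (p q : Poly d) :
    inner ℂ (packetL2 h hħ hs a η p) (packetL2 h hħ hs a η q)
      = ∫ x, star (polyPacket A B s ħ a η p x) * polyPacket A B s ħ a η q x :=
  inner_toLp (memLp_polyPacket hħ h (h.sqrt_ne_zero hs) p)
    (memLp_polyPacket hħ h (h.sqrt_ne_zero hs) q)

theorem inner_packetL2_hermitePoly (k j : Fin d → ℕ) :
    inner ℂ (packetL2 h hħ hs a η (hermitePoly A ħ k)) (packetL2 h hħ hs a η (hermitePoly A ħ j))
      = if k = j then 1 else 0 := by
  rw [inner_packetL2, integral_hermitePoly h hħ hs]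

theorem norm_packetL2_hermitePoly (j : Fin d → ℕ) :
    ‖packetL2 h hħ hs a η (hermitePoly A ħ j)‖ = 1 := by
  have h1 := inner_self_eq_norm_sq_to_K (𝕜 := ℂ) (packetL2 h hħ hs a η (hermitePoly A ħ j))
  rw [inner_packetL2_hermitePoly, if_pos rfl] at h1
  have h2 : ‖packetL2 h hħ hs a η (hermitePoly A ħ j)‖ ^ 2 = 1 := Complex.ofReal_injective (by simpa using h1.symm)
  exact (pow_eq_one_iff_of_nonneg (norm_nonneg _) two_ne_zero).mp h2

theorem inner_packetL2_sum (k : Fin d → ℕ) (S : Finset (Fin d → ℕ)) (f : (Fin d → ℕ) → ℂ) :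
    inner ℂ (packetL2 h hħ hs a η (hermitePoly A ħ k))
      (packetL2 h hħ hs a η (∑ j ∈ S, f j • hermitePoly A ħ j)) = if k ∈ S then f k else 0 := by
  simp only [map_sum, map_smul, inner_sum, inner_smul_right, inner_packetL2_hermitePoly]
  simp

theorem norm_packetL2_sum_le (S : Finset (Fin d → ℕ)) (f : (Fin d → ℕ) → ℂ) :
    ‖packetL2 h hħ hs a η (∑ j ∈ S, f j • hermitePoly A ħ j)‖ ≤ ∑ j ∈ S, ‖f j‖ := by
  simp only [map_sum, map_smul]
  refine norm_sum_le_of_le _ fun j _ => ?_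
  rw [norm_smul, norm_packetL2_hermitePoly, mul_one]

theorem HasSize.norm_packetL2_le {θ κ : ℝ} {p : Poly d} {N : ℕ} (hp : HasSize A ħ θ p N κ)
    (hθ : 1 ≤ θ) : ‖packetL2 h hħ hs a η p‖ ≤ κ := by
  obtain ⟨f, rfl, hf⟩ := hp
  refine (norm_packetL2_sum_le h hħ hs a η _ f).trans (le_trans ?_ hf)
  exact Finset.sum_le_sum fun j _ => le_mul_of_one_le_left (norm_nonneg _) (one_le_pow₀ hθ)

/-- The coupling matrix consists of the Hermite coefficients of `Z H_j`. -/
theorem couplingMatrix_eq_inner (V : Space d → ℝ) (l : ℕ) (k j : Fin d → ℕ) :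
    couplingMatrix V l A B s ħ a η k j
      = inner ℂ (packetL2 h hħ hs a η (hermitePoly A ħ k))
        (packetL2 h hħ hs a η (tailPoly V l a * hermitePoly A ħ j)) := by
  rw [inner_packetL2, couplingMatrix]
  refine integral_congr_ae (Eventually.of_forall fun x => ?_)
  dsimp only
  rw [wavePacket_eq_polyPacket h hħ, wavePacket_eq_polyPacket h hħ, polyPacket_mul, eval_tailPoly]

theorem eLpNorm_polyPacket (p : Poly d) :
    eLpNorm (polyPacket A B s ħ a η p) 2 volume = ENNReal.ofReal ‖packetL2 h hħ hs a η p‖ := by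
  rw [packetL2_apply, Lp.norm_toLp, ENNReal.ofReal_toReal]
  exact (memLp_polyPacket hħ h (h.sqrt_ne_zero hs) p).2.ne

theorem eval_normSq (a x : Space d) :
    eval (disp a x) (∑ i, X i * X i : Poly d) = ((‖x - a‖ ^ 2 : ℝ) : ℂ) := by
  rw [norm_sub_sq_eq]
  simp only [map_sum, map_mul, eval_X, disp, Complex.norm_real, Real.norm_eq_abs, sq_abs]
  push_cast
  exact Finset.sum_congr rfl fun i _ => (sq _).symm

/-- Wave packets decay like a Gaussian of width `√ħ`, uniformly in the weighted size. -/
theorem eLpNorm_exp_mul_hermitePoly_le (h : Admissible A B) (hħ : 0 < ħ) (hs : s ^ 2 = A.det)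
    (a η : Space d) {CA K ν : ℝ} (hCA : 0 ≤ CA)
    (hA : ∀ n m, ‖A n m‖ ≤ CA) (hK : d * CA * (1 + 1) ≤ K) (hν : 0 ≤ ν)
    (hνK : 2 * d * K ^ 2 * ν ≤ 1 / 4) (j : Fin d → ℕ) :
    eLpNorm (fun x => ((Real.exp (ν / ħ * ‖x - a‖ ^ 2) : ℝ) : ℂ) *
      polyPacket A B s ħ a η (hermitePoly A ħ j) x) 2 volume
      ≤ ENNReal.ofReal (2 * 2 ^ ∑ i, j i) := by
  set p := hermitePoly A ħ j with hp
  have hsize : HasSize A ħ 1 p (∑ i, j i) 1 := by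
    simpa using hasSize_hermitePoly (A := A) (ħ := ħ) (θ := 1) (le_refl (∑ i, j i))
  refine (Lp.eLpNorm_lim_le_liminf_eLpNorm
    (f := fun n => polyPacket A B s ħ a η (expSeries d ħ ν n * p))
    (fun n => (continuous_polyPacket A B s ħ a η _).aestronglyMeasurable) _
    (Eventually.of_forall fun x => ?_)).trans ?_
  · simp only [polyPacket_mul]
    refine Tendsto.mul_const _ ?_
    have h1 : ∀ n, eval (disp a x) (expSeries d ħ ν n) = ((∑ k ∈ Finset.range n,
        (ν / ħ * ‖x - a‖ ^ 2) ^ k / k.factorial : ℝ) : ℂ) := by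
      intro n
      rw [expSeries, map_sum, Complex.ofReal_sum]
      refine Finset.sum_congr rfl fun k _ => ?_
      rw [smul_eval, map_pow, eval_normSq]
      push_cast
      rw [mul_pow]
      ring
    simp only [h1]
    refine (Complex.continuous_ofReal.tendsto _).comp ?_
    have h2 := NormedSpace.expSeries_div_hasSum_exp (𝔸 := ℝ) (ν / ħ * ‖x - a‖ ^ 2)
    rw [← Real.exp_eq_exp_ℝ] at h2
    exact h2.tendsto_sum_nat
  · refine liminf_le_of_le (by isBoundedDefault) fun b hb => ?_
    obtain ⟨n, hn⟩ := hb.exists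
    refine hn.trans ?_
    rw [eLpNorm_polyPacket h hħ hs]
    refine ENNReal.ofReal_le_ofReal (((hsize.expSeries_mul h hħ hCA hA hK hν hνK n).norm_packetL2_le
      h hħ hs a η le_rfl).trans_eq (by ring))

theorem HasSize.eLpNorm_exp_mul_le (h : Admissible A B) (hħ : 0 < ħ) (hs : s ^ 2 = A.det)
    (a η : Space d) {CA K ν κ : ℝ} (hCA : 0 ≤ CA)
    (hA : ∀ n m, ‖A n m‖ ≤ CA) (hK : d * CA * (1 + 1) ≤ K) (hν : 0 ≤ ν)
    (hνK : 2 * d * K ^ 2 * ν ≤ 1 / 4) {p : Poly d} {N : ℕ} (hp : HasSize A ħ 2 p N κ) :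
    eLpNorm (fun x => ((Real.exp (ν / ħ * ‖x - a‖ ^ 2) : ℝ) : ℂ) * polyPacket A B s ħ a η p x) 2 volume
      ≤ ENNReal.ofReal (2 * κ) := by
  obtain ⟨f, rfl, hf⟩ := hp
  set F : (Fin d → ℕ) → Space d → ℂ := fun j x => ((Real.exp (ν / ħ * ‖x - a‖ ^ 2) : ℝ) : ℂ) *
      polyPacket A B s ħ a η (hermitePoly A ħ j) x with hF
  have hFc : ∀ j, Continuous (F j) := fun j =>
    (Complex.continuous_ofReal.comp (by fun_prop)).mul (continuous_polyPacket _ _ _ _ _ _ _)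
  have heq : (fun x => ((Real.exp (ν / ħ * ‖x - a‖ ^ 2) : ℝ) : ℂ) *
      polyPacket A B s ħ a η (∑ j ∈ multiIndices d N, f j • hermitePoly A ħ j) x)
      = ∑ j ∈ multiIndices d N, f j • F j := by
    funext x
    rw [polyPacket_sum, Finset.mul_sum, Finset.sum_apply]
    refine Finset.sum_congr rfl fun j _ => ?_
    rw [polyPacket_smul, Pi.smul_apply, smul_eq_mul, hF]
    ring
  rw [heq]
  refine (eLpNorm_sum_le (fun j _ => ((hFc j).const_smul (f j)).aestronglyMeasurable)
    one_le_two).trans ?_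
  calc ∑ j ∈ multiIndices d N, eLpNorm (f j • F j) 2 volume
      ≤ ∑ j ∈ multiIndices d N, ENNReal.ofReal (2 * (2 ^ (∑ i, j i) * ‖f j‖)) := by
        refine Finset.sum_le_sum fun j _ => ?_
        rw [eLpNorm_const_smul]
        refine (mul_le_mul_right (eLpNorm_exp_mul_hermitePoly_le h hħ hs a η hCA hA hK hν hνK j)
          _).trans_eq ?_
        rw [← ofReal_norm, ← ENNReal.ofReal_mul (norm_nonneg _)]
        congr 1
        ring
    _ = ENNReal.ofReal (∑ j ∈ multiIndices d N, 2 * (2 ^ (∑ i, j i) * ‖f j‖)) :=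
        (ENNReal.ofReal_sum_of_nonneg fun j _ => by positivity).symm
    _ ≤ ENNReal.ofReal (2 * κ) := by
        rw [← Finset.mul_sum]
        exact ENNReal.ofReal_le_ofReal (mul_le_mul_of_nonneg_left hf two_pos.le)

end L2Packets

/-! ### Growth of the coefficients -/

section Coefficients

variable {d : ℕ}

/-- Grönwall's inequality in both directions of time. -/
theorem norm_le_gronwallBound_abs {E : Type*} [NormedAddCommGroup E] [NormedSpace ℝ E]
    {u u' : ℝ → E} {K ε T : ℝ} (hu : ∀ t, HasDerivAt u (u' t) t)
    (hb : ∀ t, |t| ≤ T → ‖u' t‖ ≤ K * ‖u t‖ + ε) {t : ℝ} (ht : |t| ≤ T) :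
    ‖u t‖ ≤ gronwallBound ‖u 0‖ K ε |t| := by
  have hcont : Continuous u := continuous_iff_continuousAt.mpr fun t => (hu t).continuousAt
  rcases le_total 0 t with h0 | h0
  · rw [abs_of_nonneg h0] at ht ⊢
    have := norm_le_gronwallBound_of_norm_deriv_right_le (f := u) (f' := u') (a := 0) (b := T)
      (K := K) (ε := ε) hcont.continuousOn (fun x _ => (hu x).hasDerivWithinAt) le_rfl
      (fun x hx => hb x (by rw [abs_of_nonneg hx.1]; exact hx.2.le)) t ⟨h0, ht⟩
    simpa using this
  · rw [abs_of_nonpos h0] at ht ⊢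
    have hneg : ∀ x, HasDerivAt (fun r => u (-r)) (-u' (-x)) x := fun x => by
      simpa [Function.comp_def] using (hu (-x)).scomp x (hasDerivAt_neg x)
    have := norm_le_gronwallBound_of_norm_deriv_right_le (f := fun r => u (-r))
      (f' := fun r => -u' (-r)) (a := 0) (b := T) (K := K) (ε := ε) (δ := ‖u 0‖)
      (hcont.comp continuous_neg).continuousOn (fun x _ => (hneg x).hasDerivWithinAt) (by simp)
      (fun x hx => by
        rw [norm_neg]
        exact hb (-x) (by rw [abs_neg, abs_of_nonneg hx.1]; exact hx.2.le)) (-t) ⟨by linarith, ht⟩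
    simpa using this

/-- The weighted `ℓ¹` norm `∑_{|k| ≤ N} 2^{|k|} |c_k|`. -/
noncomputable def weight (d N : ℕ) (c : (Fin d → ℕ) → ℂ) : ℝ :=
  ∑ k ∈ multiIndices d N, 2 ^ (∑ i, k i) * ‖c k‖

theorem hasSize_sum (A : Matrix (Fin d) (Fin d) ℂ) (ħ : ℝ) (N : ℕ) (c : (Fin d → ℕ) → ℂ) :
    HasSize A ħ 2 (∑ k ∈ multiIndices d N, c k • hermitePoly A ħ k) N (weight d N c) :=
  ⟨c, rfl, le_rfl⟩

/-- Grönwall's inequality in the weighted `ℓ¹` norm. -/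
theorem weight_le_of_hasDerivAt {N : ℕ} {c c' : ℝ → (Fin d → ℕ) → ℂ} {K T : ℝ}
    (hc : ∀ t, ∀ k ∈ multiIndices d N, HasDerivAt (fun r => c r k) (c' t k) t)
    (hb : ∀ t, |t| ≤ T → weight d N (c' t) ≤ K * weight d N (c t)) {t : ℝ} (ht : |t| ≤ T) :
    weight d N (c t) ≤ weight d N (c 0) * Real.exp (K * |t|) := by
  set e : ((Fin d → ℕ) → ℂ) → PiLp 1 (fun _ : multiIndices d N => ℂ) := fun f =>
    WithLp.toLp 1 fun k => ((2 ^ (∑ i, (k : Fin d → ℕ) i) : ℝ) : ℂ) * f k with he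
  have hnorm : ∀ f, ‖e f‖ = weight d N f := by
    intro f
    rw [PiLp.norm_eq_of_L1, weight, ← Finset.sum_coe_sort (multiIndices d N)]
    refine Finset.sum_congr rfl fun k _ => ?_
    rw [he, norm_mul, Complex.norm_real, Real.norm_of_nonneg (by positivity)]
  have hd : ∀ t, HasDerivAt (fun r => e (c r)) (e (c' t)) t := by
    intro t
    have h1 : HasDerivAt (fun r (k : multiIndices d N) =>
        ((2 ^ (∑ i, (k : Fin d → ℕ) i) : ℝ) : ℂ) * c r k)
        (fun k : multiIndices d N => ((2 ^ (∑ i, (k : Fin d → ℕ) i) : ℝ) : ℂ) * c' t k) t :=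
      hasDerivAt_pi.mpr fun k => (hc t k k.2).const_mul _
    exact (PiLp.continuousLinearEquiv 1 ℝ
      (fun _ : multiIndices d N => ℂ)).symm.hasFDerivAt.comp_hasDerivAt t h1
  have := norm_le_gronwallBound_abs (ε := 0) hd
    (fun t ht => by rw [hnorm, hnorm, add_zero]; exact hb t ht) ht
  rwa [gronwallBound_ε0, hnorm, hnorm] at this

variable {V : Space d → ℝ} {a η : ℝ → Space d} {A B : ℝ → Matrix (Fin d) (Fin d) ℂ}
  {s : ℝ → ℂ} {ħ : ℝ} {c₀ : (Fin d → ℕ) → ℂ} {c : ℝ → (Fin d → ℕ) → ℂ} {J l : ℕ}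

/-- The right-hand side of the coefficient equation is the truncation of `Z ψ`. -/
theorem sum_couplingMatrix_mul (hadm : ∀ t, Admissible (A t) (B t))
    (hs : ∀ t, s t ^ 2 = (A t).det) (hħ : 0 < ħ) (t : ℝ) {N M : ℕ}
    {f : (Fin d → ℕ) → ℂ} (hf : tailPoly V l (a t) * ∑ j ∈ multiIndices d N,
      c t j • hermitePoly (A t) ħ j = ∑ j ∈ multiIndices d M, f j • hermitePoly (A t) ħ j)
    {k : Fin d → ℕ} (hk : k ∈ multiIndices d M) :
    ∑ j ∈ multiIndices d N, couplingMatrix V l (A t) (B t) (s t) ħ (a t) (η t) k j * c t j = f k := by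
  have h1 := inner_packetL2_sum (hadm t) hħ (hs t) (a t) (η t) k (multiIndices d M) f
  rw [if_pos hk, ← hf, Finset.mul_sum, map_sum, inner_sum] at h1
  rw [← h1]
  refine Finset.sum_congr rfl fun j _ => ?_
  rw [couplingMatrix_eq_inner (hadm t) hħ (hs t), mul_smul_comm, map_smul, inner_smul_right, mul_comm]

/-- If `Z` acts with norm at most `Ω` on the weighted space, the coefficients grow at most like
`exp (Ω |t| / ħ)`. -/
theorem IsCoefficientSolution.weight_le
    (hsol : IsCoefficientSolution V J l ħ a η A B s c₀ c) (hadm : ∀ t, Admissible (A t) (B t))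
    (hs : ∀ t, s t ^ 2 = (A t).det) (hħ : 0 < ħ) {Ω T : ℝ}
    (hZ : ∀ t, |t| ≤ T → ∀ p κ, HasSize (A t) ħ 2 p (truncLevel J l) κ →
      HasSize (A t) ħ 2 (tailPoly V l (a t) * p) (truncLevel J l + (l + 1)) (Ω * κ))
    {t : ℝ} (ht : |t| ≤ T) :
    weight d (truncLevel J l) (c t)
      ≤ weight d (truncLevel J l) (c 0) * Real.exp (Ω / ħ * |t|) := by
  refine weight_le_of_hasDerivAt (fun t k hk => hsol.ode t k hk) (fun t ht => ?_) ht
  obtain ⟨f, hf, hfb⟩ := hZ t ht _ _ (hasSize_sum (A t) ħ (truncLevel J l) (c t))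
  have hsub : multiIndices d (truncLevel J l) ⊆ multiIndices d (truncLevel J l + (l + 1)) :=
    multiIndices_mono (by omega)
  calc weight d (truncLevel J l) _
      = ∑ k ∈ multiIndices d (truncLevel J l), ħ⁻¹ * (2 ^ (∑ i, k i) * ‖f k‖) := by
        refine Finset.sum_congr rfl fun k hk => ?_
        dsimp only
        rw [sum_couplingMatrix_mul hadm hs hħ t hf (hsub hk), norm_mul, norm_inv, norm_mul,
          Complex.norm_I, Complex.norm_real, Real.norm_of_nonneg hħ.le, one_mul]
        ring
    _ ≤ ħ⁻¹ * (Ω * weight d (truncLevel J l) (c t)) := by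
        rw [← Finset.mul_sum]
        refine mul_le_mul_of_nonneg_left (le_trans ?_ hfb) (by positivity)
        exact Finset.sum_le_sum_of_subset_of_nonneg hsub fun k _ _ => by positivity
    _ = _ := by ring

theorem IsCoefficientSolution.weight_zero_le
    (hsol : IsCoefficientSolution V J l ħ a η A B s c₀ c) :
    weight d (truncLevel J l) (c 0) ≤ weight d J c₀ := by
  have h1 : ∀ k ∈ multiIndices d (truncLevel J l), 2 ^ (∑ i, k i) * ‖c 0 k‖
      = if k ∈ multiIndices d J then (2 : ℝ) ^ (∑ i, k i) * ‖c₀ k‖ else 0 := by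
    intro k hk
    rw [hsol.initial k hk]
    simp only [mem_multiIndices]
    split_ifs <;> simp
  rw [weight, Finset.sum_congr rfl h1, ← Finset.sum_filter, weight]
  refine Finset.sum_le_sum_of_subset_of_nonneg (fun k hk => (Finset.mem_filter.mp hk).2)
    fun k _ _ => by positivity

end Coefficients

/-! ### Symmetry of the Hamiltonian and the energy estimate -/

section Energy

open MeasureTheory Filter Topology

variable {d : ℕ}

theorem laplacian_eq_sum {u : Space d → ℂ} (hu : ContDiff ℝ 2 u) (x : Space d) :
    Laplacian.laplacian u x = ∑ n, partialDeriv n (partialDeriv n u) x := by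
  rw [InnerProductSpace.laplacian_eq_iteratedFDeriv_orthonormalBasis u
    (EuclideanSpace.basisFun (Fin d) ℝ)]
  refine Finset.sum_congr rfl fun n _ => ?_
  have h1 : DifferentiableAt ℝ (fderiv ℝ u) x :=
    ((hu.fderiv_right (m := 1) le_rfl).differentiable one_ne_zero) x
  rw [iteratedFDeriv_two_apply]
  unfold partialDeriv
  rw [fderiv_clm_apply h1 (differentiableAt_const _)]
  simp

/-- The Schrödinger operator `-(ħ²/2) Δ + V` on twice differentiable functions. -/
noncomputable def schrodinger (V : Space d → ℝ) (ħ : ℝ) (u : Space d → ℂ) (x : Space d) : ℂ :=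
  -((ħ ^ 2 / 2 : ℝ) : ℂ) * Laplacian.laplacian u x + (V x : ℂ) * u x

/-- `u` is a `C²` function for which the terms of the Schrödinger operator, and the first
derivatives, are square integrable. -/
structure IsRegular (V : Space d → ℝ) (u : Space d → ℂ) : Prop where
  contDiff : ContDiff ℝ 2 u
  memLp : MemLp u 2 volume
  memLp_deriv : ∀ n, MemLp (partialDeriv n u) 2 volume
  memLp_deriv_deriv : ∀ n, MemLp (partialDeriv n (partialDeriv n u)) 2 volume
  memLp_potential : MemLp (fun x => (V x : ℂ) * u x) 2 volume

variable {V : Space d → ℝ} {u v : Space d → ℂ} {ħ : ℝ}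

theorem ContDiff.partialDeriv {n k : WithTop ℕ∞} {u : Space d → ℂ} (hu : ContDiff ℝ n u)
    (hk : k + 1 ≤ n) (i : Fin d) : ContDiff ℝ k (partialDeriv i u) :=
  (hu.fderiv_right hk).clm_apply contDiff_const

theorem schrodinger_eq (hu : ContDiff ℝ 2 u) : schrodinger V ħ u = fun x =>
    -((ħ ^ 2 / 2 : ℝ) : ℂ) * ∑ n, partialDeriv n (partialDeriv n u) x + (V x : ℂ) * u x :=
  funext fun x => by rw [schrodinger, laplacian_eq_sum hu]

theorem IsRegular.memLp_schrodinger (hu : IsRegular V u) (ħ : ℝ) :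
    MemLp (schrodinger V ħ u) 2 volume := by
  rw [schrodinger_eq hu.contDiff]
  exact ((memLp_finsetSum _ fun n _ => hu.memLp_deriv_deriv n).const_mul _).add hu.memLp_potential

theorem IsRegular.integral_star_deriv_deriv_mul (hu : IsRegular V u) (hv : IsRegular V v)
    (n : Fin d) :
    ∫ x, star (partialDeriv n (partialDeriv n u) x) * v x
      = ∫ x, star (u x) * partialDeriv n (partialDeriv n v) x := by
  have hdu := hu.contDiff.differentiable two_ne_zero
  have hdv := hv.contDiff.differentiable two_ne_zero
  have hdu' := (ContDiff.partialDeriv (k := 1) hu.contDiff le_rfl n).differentiable one_ne_zero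
  have hdv' := (ContDiff.partialDeriv (k := 1) hv.contDiff le_rfl n).differentiable one_ne_zero
  rw [integral_star_partialDeriv_mul n hdu' hdv (hu.memLp_deriv n) hv.memLp
    (hu.memLp_deriv_deriv n) (hv.memLp_deriv n), integral_star_partialDeriv_mul n hdu hdv' hu.memLp
    (hv.memLp_deriv n) (hu.memLp_deriv n) (hv.memLp_deriv_deriv n), neg_neg]

theorem IsRegular.integral_schrodinger (hu : IsRegular V u) (hv : IsRegular V v) :
    ∫ x, star (schrodinger V ħ u x) * v x = ∫ x, star (u x) * schrodinger V ħ v x := by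
  have h1 : ∀ x, star (schrodinger V ħ u x) * v x
      = -((ħ ^ 2 / 2 : ℝ) : ℂ) * ∑ n, star (partialDeriv n (partialDeriv n u) x) * v x
        + star (u x) * ((V x : ℂ) * v x) := by
    intro x
    rw [schrodinger_eq hu.contDiff]
    simp only [star_add, star_mul', star_neg, star_sum, Complex.star_def, Complex.conj_ofReal,
      ← Finset.sum_mul]
    ring
  have h2 : ∀ x, star (u x) * schrodinger V ħ v x
      = -((ħ ^ 2 / 2 : ℝ) : ℂ) * ∑ n, star (u x) * partialDeriv n (partialDeriv n v) x
        + star (u x) * ((V x : ℂ) * v x) := by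
    intro x
    rw [schrodinger_eq hv.contDiff]
    simp only [← Finset.mul_sum]
    ring
  have i1 : ∀ n, Integrable (fun x => star (partialDeriv n (partialDeriv n u) x) * v x) volume :=
    fun n => integrable_star_mul (hu.memLp_deriv_deriv n) hv.memLp
  have i2 : ∀ n, Integrable (fun x => star (u x) * partialDeriv n (partialDeriv n v) x) volume :=
    fun n => integrable_star_mul hu.memLp (hv.memLp_deriv_deriv n)
  have i3 := integrable_star_mul hu.memLp hv.memLp_potential
  simp only [h1, h2]
  rw [integral_add ((integrable_finsetSum _ fun n _ => i1 n).const_mul _) i3,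
    integral_add ((integrable_finsetSum _ fun n _ => i2 n).const_mul _) i3, integral_const_mul,
    integral_const_mul, integral_finsetSum _ fun n _ => i1 n,
    integral_finsetSum _ fun n _ => i2 n]
  simp only [hu.integral_star_deriv_deriv_mul hv]

theorem isRegular_of_hasCompactSupport (hV : Continuous V)
    (hu : ContDiff ℝ ((⊤ : ℕ∞) : WithTop ℕ∞) u) (hc : HasCompactSupport u) : IsRegular V u := by
  have hd : ∀ {w : Space d → ℂ}, HasCompactSupport w → ∀ n, HasCompactSupport (partialDeriv n w) :=
    fun hw n => (hw.fderiv (𝕜 := ℝ)).comp_left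
      (g := fun L : Space d →L[ℝ] ℂ => L (EuclideanSpace.single n (1 : ℝ))) rfl
  have h1 : ∀ n, ContDiff ℝ ((⊤ : ℕ∞) : WithTop ℕ∞) (partialDeriv n u) := fun n =>
    ContDiff.partialDeriv hu (by simp) n
  have h2 : ∀ n, ContDiff ℝ ((⊤ : ℕ∞) : WithTop ℕ∞) (partialDeriv n (partialDeriv n u)) := fun n =>
    ContDiff.partialDeriv (h1 n) (by simp) n
  refine ⟨contDiff_infty.mp hu 2, hu.continuous.memLp_of_hasCompactSupport hc,
    fun n => (h1 n).continuous.memLp_of_hasCompactSupport (hd hc n),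
    fun n => (h2 n).continuous.memLp_of_hasCompactSupport (hd (hd hc n) n), ?_⟩
  exact ((Complex.continuous_ofReal.comp hV).mul hu.continuous).memLp_of_hasCompactSupport
    hc.mul_left

/-- The test functions defining `H(ħ)` are regular, so that the symmetry computation covers both
them and the wave packets. -/
theorem exists_isRegular_of_mem_core (hV : Continuous V) {P : L2 d × L2 d}
    (hP : P ∈ hamiltonianCore V ħ) : ∃ (u : Space d → ℂ) (hu : IsRegular V u),
      P.1 = hu.memLp.toLp ∧ P.2 = (hu.memLp_schrodinger ħ).toLp := by
  obtain ⟨f, hf, hc, h1, h2⟩ := hP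
  have hu := isRegular_of_hasCompactSupport hV hf hc
  refine ⟨f, hu, ?_, ?_⟩
  · exact Lp.ext (h1.trans hu.memLp.coeFn_toLp.symm)
  · exact Lp.ext (h2.trans (hu.memLp_schrodinger ħ).coeFn_toLp.symm)

/-- Regular functions are in the domain of the adjoint of `H(ħ)`. -/
theorem inner_hamiltonianGraph (hV : Continuous V) (hu : IsRegular V u) {P : L2 d × L2 d}
    (hP : P ∈ hamiltonianGraph V ħ) :
    inner ℂ P.2 hu.memLp.toLp = inner ℂ P.1 (hu.memLp_schrodinger ħ).toLp := by
  have hclosed : IsClosed {P : L2 d × L2 d |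
      inner ℂ P.2 hu.memLp.toLp = inner ℂ P.1 (hu.memLp_schrodinger ħ).toLp} :=
    isClosed_eq (by fun_prop) (by fun_prop)
  refine closure_minimal (fun P hP => ?_) hclosed hP
  obtain ⟨v, hv, h1, h2⟩ := exists_isRegular_of_mem_core hV hP
  change inner ℂ P.2 _ = inner ℂ P.1 _
  rw [h1, h2, inner_toLp, inner_toLp, hv.integral_schrodinger hu]

/-- `H(ħ)` is symmetric: `⟨u, H u⟩` is real on its domain. -/
theorem im_inner_hamiltonianGraph (hV : Continuous V) {P : L2 d × L2 d}
    (hP : P ∈ hamiltonianGraph V ħ) : (inner ℂ P.1 P.2).im = 0 := by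
  have hclosed : IsClosed {P : L2 d × L2 d | inner ℂ P.2 P.1 = inner ℂ P.1 P.2} :=
    isClosed_eq (by fun_prop) (by fun_prop)
  have h : inner ℂ P.2 P.1 = inner ℂ P.1 P.2 := by
    refine closure_minimal (fun P hP => ?_) hclosed hP
    obtain ⟨v, hv, h1, h2⟩ := exists_isRegular_of_mem_core hV hP
    change inner ℂ P.2 P.1 = inner ℂ P.1 P.2
    rw [h1, h2, inner_toLp, inner_toLp, hv.integral_schrodinger hv]
  rw [← inner_conj_symm] at h
  exact Complex.conj_eq_iff_im.mp h

/-- An approximate solution of the Schrödinger equation with residual at most `ε` stays within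
distance `(ε/ħ) √(e^{|t|} - 1)` of the exact solution. -/
theorem norm_sub_sq_le_of_residual (hV : Continuous V) (hħ : 0 < ħ) {Ψ ψ ψ' ζ : ℝ → L2 d}
    {Ψ₀ : Space d → ℂ} (hΨ : IsSchrodingerSolution V ħ Ψ₀ Ψ) {u : ℝ → Space d → ℂ} {T ε : ℝ}
    (hu : ∀ t, |t| ≤ T → IsRegular V (u t)) (hψu : ∀ t ht, ψ t = (hu t ht).memLp.toLp)
    (hψ : ∀ t, HasDerivAt ψ (ψ' t) t) (heq : ∀ t ht,
      ψ' t = (Complex.I * (ħ : ℂ))⁻¹ • (((hu t ht).memLp_schrodinger ħ).toLp + ζ t))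
    (h0 : ψ 0 = Ψ 0) (hζ : ∀ t, |t| ≤ T → ‖ζ t‖ ≤ ε) {t : ℝ} (ht : |t| ≤ T) :
    ‖ψ t - Ψ t‖ ^ 2 ≤ (ε / ħ) ^ 2 * (Real.exp |t| - 1) := by
  choose Ψ' hΨ' hgraph using hΨ.equation
  have hħ' : (Complex.I * (ħ : ℂ)) ≠ 0 :=
    mul_ne_zero Complex.I_ne_zero (Complex.ofReal_ne_zero.mpr hħ.ne')
  have hd : ∀ t, HasDerivAt (fun r => ‖ψ r - Ψ r‖ ^ 2)
      (2 * (inner ℂ (ψ t - Ψ t) (ψ' t - Ψ' t)).re) t := by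
    intro t
    have h1 := (hψ t).sub (hΨ' t)
    have h2 := (h1.inner ℂ h1)
    have h3 := (Complex.reCLM.hasFDerivAt.comp_hasDerivAt t h2)
    refine (h3.congr_of_eventuallyEq (Eventually.of_forall fun r => ?_)).congr_deriv ?_
    · change _ = (inner ℂ (ψ r - Ψ r) (ψ r - Ψ r)).re
      rw [inner_self_eq_norm_sq_to_K]
      norm_cast
    · rw [Complex.reCLM_apply, Complex.add_re, ← inner_conj_symm (ψ' t - Ψ' t), Complex.conj_re]
      simp only [Pi.sub_apply]
      ring
  have hb : ∀ t, |t| ≤ T → ‖2 * (inner ℂ (ψ t - Ψ t) (ψ' t - Ψ' t)).re‖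
      ≤ 1 * ‖(‖ψ t - Ψ t‖ ^ 2 : ℝ)‖ + (ε / ħ) ^ 2 := by
    intro t ht
    set h := ((hu t ht).memLp_schrodinger ħ).toLp with hh
    set g := (Complex.I * (ħ : ℂ)) • Ψ' t with hg
    have hΨ'g : Ψ' t = (Complex.I * (ħ : ℂ))⁻¹ • g := by
      rw [hg, smul_smul, inv_mul_cancel₀ hħ', one_smul]
    have e1 : (inner ℂ (ψ t) h).im = 0 := by
      have : inner ℂ h (ψ t) = inner ℂ (ψ t) h := by
        rw [hψu t ht, hh, inner_toLp, inner_toLp, (hu t ht).integral_schrodinger (hu t ht)]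
      rw [← inner_conj_symm] at this
      exact Complex.conj_eq_iff_im.mp this
    have e2 : (inner ℂ (Ψ t) g).im = 0 := im_inner_hamiltonianGraph hV (hgraph t)
    have e3 : (inner ℂ (ψ t) g).im = -(inner ℂ (Ψ t) h).im := by
      have : inner ℂ g (ψ t) = inner ℂ (Ψ t) h := by
        rw [hψu t ht]; exact inner_hamiltonianGraph hV (hu t ht) (hgraph t)
      rw [← this, ← inner_conj_symm, Complex.conj_im]
    have e4 : (inner ℂ (ψ t - Ψ t) (ψ' t - Ψ' t)).re
        = ħ⁻¹ * (inner ℂ (ψ t - Ψ t) (ζ t)).im := by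
      rw [heq t ht, hΨ'g, ← smul_sub, inner_smul_right, mul_inv, Complex.inv_I, neg_mul, neg_mul,
        Complex.neg_re, mul_assoc, Complex.I_mul_re, neg_neg, ← Complex.ofReal_inv,
        Complex.im_ofReal_mul]
      congr 1
      rw [add_sub_right_comm, inner_add_right, Complex.add_im]
      simp only [inner_sub_left, inner_sub_right, Complex.sub_im]
      rw [← hh, e1, e2, e3]
      ring
    have e5 : |(inner ℂ (ψ t - Ψ t) (ζ t)).im| ≤ ‖ψ t - Ψ t‖ * ε :=
      (Complex.abs_im_le_norm _).trans ((norm_inner_le_norm _ _).trans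
        (mul_le_mul_of_nonneg_left (hζ t ht) (norm_nonneg _)))
    rw [e4, Real.norm_eq_abs, Real.norm_of_nonneg (by positivity), abs_mul, abs_mul, abs_two,
      abs_of_pos (inv_pos.mpr hħ)]
    calc _ ≤ 2 * (ħ⁻¹ * (‖ψ t - Ψ t‖ * ε)) := by gcongr
      _ = 2 * ‖ψ t - Ψ t‖ * (ε / ħ) := by ring
      _ ≤ _ := by linarith [two_mul_le_add_sq ‖ψ t - Ψ t‖ (ε / ħ)]
  have := norm_le_gronwallBound_abs hd hb ht
  rw [h0, sub_self, norm_zero, gronwallBound_of_K_ne_0 one_ne_zero,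
    Real.norm_of_nonneg (by positivity)] at this
  simpa using this

end Energy

/-! ### The residual of the truncated approximation -/

section Residual

open MeasureTheory Filter Topology

variable {d : ℕ} {V : Space d → ℝ} {ħ : ℝ}

theorem covDeriv_sum_smul (Γ : Matrix (Fin d) (Fin d) ℂ) (ħ : ℝ) (η : Space d) (n : Fin d)
    {ι : Type*} (S : Finset ι) (c : ι → ℂ) (p : ι → Poly d) :
    covDeriv Γ ħ η n (∑ j ∈ S, c j • p j) = ∑ j ∈ S, c j • covDeriv Γ ħ η n (p j) := by
  simp only [covDeriv, map_sum, Derivation.map_smul, Finset.mul_sum, mul_smul_comm, smul_add,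
    Finset.sum_add_distrib]

theorem quadHam_sum_smul (V : Space d → ℝ) (Γ : Matrix (Fin d) (Fin d) ℂ) (ħ : ℝ) (a η : Space d)
    {ι : Type*} (S : Finset ι) (c : ι → ℂ) (p : ι → Poly d) :
    quadHam V Γ ħ a η (∑ j ∈ S, c j • p j) = ∑ j ∈ S, c j • quadHam V Γ ħ a η (p j) := by
  simp only [quadHam, covDeriv_sum_smul, Finset.mul_sum, mul_smul_comm, smul_add,
    Finset.sum_add_distrib, Finset.smul_sum]
  congr 1
  rw [Finset.sum_comm]
  exact Finset.sum_congr rfl fun j _ => Finset.sum_congr rfl fun n _ => smul_comm _ _ _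

theorem quadHam_smul (V : Space d → ℝ) (Γ : Matrix (Fin d) (Fin d) ℂ) (ħ : ℝ) (a η : Space d)
    (c : ℂ) (p : Poly d) : quadHam V Γ ħ a η (c • p) = c • quadHam V Γ ħ a η p := by
  simpa using quadHam_sum_smul V Γ ħ a η (Finset.univ : Finset Unit) (fun _ => c) fun _ => p

section Fixed

variable {A B : Matrix (Fin d) (Fin d) ℂ} {s : ℂ}

/-- On a wave packet `H(ħ)` acts as the quadratic Hamiltonian, up to the difference between `V` and
its second-order Taylor polynomial. -/
theorem schrodinger_polyPacket (h : Admissible A B) (a η : Space d) (p : Poly d) (x : Space d) :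
    schrodinger V ħ (polyPacket A B s ħ a η p) x
      = polyPacket A B s ħ a η (quadHam V (B * A⁻¹) ħ a η p) x
        + ((V x : ℂ) - eval (disp a x) (quadPot V a)) * polyPacket A B s ħ a η p x := by
  rw [schrodinger_eq (contDiff_polyPacket A B s ħ a η p), quadHam, polyPacket_add, polyPacket_smul,
    polyPacket_sum, polyPacket_mul]
  simp only [partialDeriv_polyPacket h]
  push_cast
  ring

theorem isRegular_polyPacket (h : Admissible A B) (hħ : 0 < ħ) (hs : s ^ 2 = A.det) (a η : Space d)
    (p : Poly d) (hV : MemLp (fun x => (V x : ℂ) * polyPacket A B s ħ a η p x) 2 volume) :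
    IsRegular V (polyPacket A B s ħ a η p) := by
  have hm : ∀ p, MemLp (polyPacket A B s ħ a η p) 2 volume :=
    memLp_polyPacket hħ h (h.sqrt_ne_zero hs)
  refine ⟨contDiff_polyPacket A B s ħ a η p, hm p, fun n => ?_, fun n => ?_, hV⟩
  · rw [partialDeriv_polyPacket h]; exact hm _
  · rw [partialDeriv_polyPacket h, partialDeriv_polyPacket h]; exact hm _

/-- Multiplication by a function growing more slowly than the Gaussian decay of the packets. -/
theorem HasSize.eLpNorm_mul_le (h : Admissible A B) (hħ : 0 < ħ) (hs : s ^ 2 = A.det)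
    (a η : Space d) {CA K ν κ β : ℝ} (hCA : 0 ≤ CA) (hA : ∀ n m, ‖A n m‖ ≤ CA)
    (hK : d * CA * (1 + 1) ≤ K) (hν : 0 ≤ ν) (hνK : 2 * d * K ^ 2 * ν ≤ 1 / 4) {p : Poly d} {N : ℕ}
    (hp : HasSize A ħ 2 p N κ) (hβ : 0 ≤ β) {f : Space d → ℂ}
    (hf : ∀ x, ‖f x‖ ≤ β * Real.exp (ν / ħ * ‖x - a‖ ^ 2)) :
    eLpNorm (fun x => f x * polyPacket A B s ħ a η p x) 2 volume
      ≤ ENNReal.ofReal (β * (2 * κ)) := by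
  rw [ENNReal.ofReal_mul hβ]
  refine (eLpNorm_le_mul_eLpNorm_of_ae_le_mul (c := β) (Eventually.of_forall fun x => ?_) 2).trans
    (mul_le_mul_right (hp.eLpNorm_exp_mul_le h hħ hs a η hCA hA hK hν hνK) _)
  rw [norm_mul, norm_mul, Complex.norm_real, Real.norm_of_nonneg (Real.exp_pos _).le, ← mul_assoc]
  exact mul_le_mul_of_nonneg_right (hf x) (norm_nonneg _)

end Fixed

variable {a η : ℝ → Space d} {A B : ℝ → Matrix (Fin d) (Fin d) ℂ} {S : ℝ → ℝ} {s : ℝ → ℂ}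

/-- The polynomial factor of the approximate solution. -/
noncomputable def approxPoly (A : ℝ → Matrix (Fin d) (Fin d) ℂ) (S : ℝ → ℝ) (ħ : ℝ) (N : ℕ)
    (c : ℝ → (Fin d → ℕ) → ℂ) (t : ℝ) : Poly d :=
  Complex.exp (Complex.I * (S t : ℂ) / (ħ : ℂ)) • ∑ j ∈ multiIndices d N, c t j • hermitePoly (A t) ħ j

theorem norm_phase (x ħ : ℝ) : ‖Complex.exp (Complex.I * (x : ℂ) / (ħ : ℂ))‖ = 1 := by
  rw [mul_div_assoc, ← Complex.ofReal_div, mul_comm]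
  exact Complex.norm_exp_ofReal_mul_I _

theorem approxSolution_eq_polyPacket (hadm : ∀ t, Admissible (A t) (B t)) (hħ : 0 < ħ) (J l : ℕ)
    (c : ℝ → (Fin d → ℕ) → ℂ) (t : ℝ) :
    approxSolution J l ħ a η A B S s c t = polyPacket (A t) (B t) (s t) ħ (a t) (η t)
      (approxPoly A S ħ (truncLevel J l) c t) := by
  funext x
  rw [approxSolution, approxPoly, polyPacket_smul, polyPacket_sum]
  congr 1
  refine Finset.sum_congr rfl fun j _ => ?_
  rw [polyPacket_smul, wavePacket_eq_polyPacket (hadm t) hħ]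

/-- The time derivative of the approximate solution as a curve in `L²`. -/
theorem IsClassicalFlow.hasDerivAt_approx (hf : IsClassicalFlow V a η A B S)
    (hadm : ∀ t, Admissible (A t) (B t)) (hV : ContDiff ℝ 2 V) (hs : Continuous s)
    (hs2 : ∀ t, s t ^ 2 = (A t).det) (hħ : 0 < ħ) {N : ℕ} {c c' : ℝ → (Fin d → ℕ) → ℂ}
    (hc : ∀ t, ∀ k ∈ multiIndices d N,
      HasDerivAt (fun r => c r k) ((Complex.I * (ħ : ℂ))⁻¹ * c' t k) t) (t : ℝ) :
    HasDerivAt (fun r => packetL2 (hadm r) hħ (hs2 r) (a r) (η r) (approxPoly A S ħ N c r))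
      ((Complex.I * (ħ : ℂ))⁻¹ • packetL2 (hadm t) hħ (hs2 t) (a t) (η t)
        (quadHam V (B t * (A t)⁻¹) ħ (a t) (η t) (approxPoly A S ħ N c t)
          + approxPoly A S ħ N c' t)) t := by
  have hm : ∀ t p, MemLp (fun x => Complex.exp (Complex.I * (S t : ℂ) / ħ) *
      polyPacket (A t) (B t) (s t) ħ (a t) (η t) p x) 2 volume := fun t p =>
    (memLp_polyPacket hħ (hadm t) ((hadm t).sqrt_ne_zero (hs2 t)) p).const_mul _
  have htoLp : ∀ t p, (hm t p).toLp _ = Complex.exp (Complex.I * (S t : ℂ) / ħ) •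
      packetL2 (hadm t) hħ (hs2 t) (a t) (η t) p := fun t p => by
    rw [packetL2_apply, ← MemLp.toLp_const_smul]
    rfl
  have h1 := HasDerivAt.fun_sum fun k (hk : k ∈ multiIndices d N) =>
    (hc t k hk).fun_smul (hf.hasDerivAt_packet hadm hV hs hs2 hħ k hm t)
  simp only [htoLp] at h1
  refine (h1.congr_of_eventuallyEq (Eventually.of_forall fun r => ?_)).congr_deriv ?_
  · simp only [approxPoly, map_smul, map_sum, Finset.smul_sum]
    exact Finset.sum_congr rfl fun k _ => smul_comm _ _ _
  · rw [approxPoly, approxPoly, quadHam_smul, quadHam_sum_smul]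
    simp only [map_add, map_smul, map_sum, Finset.smul_sum, smul_add, smul_smul,
      Finset.sum_add_distrib]
    congr 1
    · exact Finset.sum_congr rfl fun k _ => by congr 1; ring
    · exact Finset.sum_congr rfl fun k _ => by congr 1; ring

/-- The error made in the Schrödinger equation consists of the part of `Z ψ` of degree above the
truncation level, and of the remainder of the Taylor expansion of `V`. -/
theorem norm_residual_le (hadm : ∀ t, Admissible (A t) (B t)) (hs2 : ∀ t, s t ^ 2 = (A t).det)
    (hħ : 0 < ħ) {l N : ℕ} {c c' : ℝ → (Fin d → ℕ) → ℂ} {t : ℝ}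
    (hc' : ∀ k ∈ multiIndices d N, c' t k = ∑ j ∈ multiIndices d N,
      couplingMatrix V l (A t) (B t) (s t) ħ (a t) (η t) k j * c t j)
    {CA K ν W Ω β : ℝ} (hCA : 0 ≤ CA) (hA : ∀ n m, ‖A t n m‖ ≤ CA)
    (hK : d * CA * (1 + 1) ≤ K) (hν : 0 ≤ ν) (hνK : 2 * d * K ^ 2 * ν ≤ 1 / 4)
    (hW : weight d N (c t) ≤ W) (hβ : 0 ≤ β)
    (hZ : HasSize (A t) ħ 2
      (tailPoly V l (a t) * ∑ j ∈ multiIndices d N, c t j • hermitePoly (A t) ħ j)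
      (N + (l + 1)) (Ω * W))
    (hrem : ∀ x, ‖(V x : ℂ) - (eval (disp (a t) x) (quadPot V (a t)) + (taylorTail V l (a t) x : ℂ))‖
      ≤ β * Real.exp (ν / ħ * ‖x - a t‖ ^ 2))
    (hu : IsRegular V (polyPacket (A t) (B t) (s t) ħ (a t) (η t) (approxPoly A S ħ N c t))) :
    ‖packetL2 (hadm t) hħ (hs2 t) (a t) (η t)
        (quadHam V (B t * (A t)⁻¹) ħ (a t) (η t) (approxPoly A S ħ N c t)
          + approxPoly A S ħ N c' t) - (hu.memLp_schrodinger ħ).toLp‖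
      ≤ Ω * W * (1 / 2) ^ (N + 1) + β * (2 * W) := by
  classical
  set P := packetL2 (hadm t) hħ (hs2 t) (a t) (η t) with hP
  set ph := Complex.exp (Complex.I * (S t : ℂ) / (ħ : ℂ)) with hph
  have hph1 : ‖ph‖ = 1 := norm_phase _ _
  set p := ∑ j ∈ multiIndices d N, c t j • hermitePoly (A t) ħ j with hp
  obtain ⟨f, hfp, hfb⟩ := hZ
  have hsub : multiIndices d N ⊆ multiIndices d (N + (l + 1)) := multiIndices_mono (by omega)
  set Q := ∑ j ∈ multiIndices d (N + (l + 1)) \ multiIndices d N, f j • hermitePoly (A t) ħ j with hQ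
  have hc'f : ∑ j ∈ multiIndices d N, c' t j • hermitePoly (A t) ħ j = tailPoly V l (a t) * p - Q := by
    rw [hfp, ← Finset.sum_sdiff hsub, hQ, add_sub_cancel_left]
    refine Finset.sum_congr rfl fun k hk => ?_
    rw [hc' k hk, sum_couplingMatrix_mul hadm hs2 hħ t hfp (hsub hk)]
  set R : Space d → ℂ := fun x => ((V x : ℂ) - (eval (disp (a t) x) (quadPot V (a t))
    + (taylorTail V l (a t) x : ℂ))) *
      polyPacket (A t) (B t) (s t) ħ (a t) (η t) (approxPoly A S ħ N c t) x with hR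
  have hRb : eLpNorm R 2 volume ≤ ENNReal.ofReal (β * (2 * W)) := by
    have hsize : HasSize (A t) ħ 2 (approxPoly A S ħ N c t) N W := by
      refine ((hasSize_sum (A t) ħ N (c t)).smul ph).mono le_rfl ?_
      rw [hph1, one_mul]; exact hW
    exact hsize.eLpNorm_mul_le (hadm t) hħ (hs2 t) (a t) (η t) hCA hA hK hν hνK hβ hrem
  have hW0 : 0 ≤ W := (Finset.sum_nonneg fun k _ => by positivity).trans hW
  have hRm : AEStronglyMeasurable R volume := by
    have h1 : R = fun x => (V x : ℂ) * polyPacket (A t) (B t) (s t) ħ (a t) (η t)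
        (approxPoly A S ħ N c t) x - polyPacket (A t) (B t) (s t) ħ (a t) (η t)
          ((quadPot V (a t) + tailPoly V l (a t)) * approxPoly A S ħ N c t) x := by
      funext x
      rw [polyPacket_mul, map_add, eval_tailPoly, hR]
      ring
    rw [h1]
    exact hu.memLp_potential.1.sub (continuous_polyPacket _ _ _ _ _ _ _).aestronglyMeasurable
  have hRL : MemLp R 2 volume := ⟨hRm, hRb.trans_lt ENNReal.ofReal_lt_top⟩
  have hdecomp : P (quadHam V (B t * (A t)⁻¹) ħ (a t) (η t) (approxPoly A S ħ N c t)
      + approxPoly A S ħ N c' t) - (hu.memLp_schrodinger ħ).toLp = -(ph • P Q) - hRL.toLp := by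
    rw [← map_smul, ← map_neg, hP, packetL2_apply, packetL2_apply, ← MemLp.toLp_sub,
      ← MemLp.toLp_sub]
    congr 1
    funext x
    rw [Pi.sub_apply, Pi.sub_apply, schrodinger_polyPacket (hadm t), polyPacket_add]
    dsimp only [R]
    have h1 : approxPoly A S ħ N c' t = tailPoly V l (a t) * approxPoly A S ħ N c t - ph • Q := by
      rw [approxPoly, approxPoly, hc'f, ← hph, ← hp, smul_sub, mul_smul_comm]
    have h2 : -(ph • Q) = (-ph) • Q := (neg_smul ph Q).symm
    rw [h1, sub_eq_add_neg (tailPoly V l (a t) * _), h2, polyPacket_add, polyPacket_mul, eval_tailPoly]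
    ring
  rw [hdecomp]
  refine (norm_sub_le _ _).trans (add_le_add ?_ ?_)
  · rw [norm_neg, norm_smul, hph1, one_mul]
    refine (norm_packetL2_sum_le (hadm t) hħ (hs2 t) (a t) (η t) _ f).trans ?_
    have h1 : ∀ k ∈ multiIndices d (N + (l + 1)) \ multiIndices d N,
        ‖f k‖ ≤ (1 / 2) ^ (N + 1) * (2 ^ (∑ i, k i) * ‖f k‖) := by
      intro k hk
      have hk' : N + 1 ≤ ∑ i, k i := by
        have := (Finset.mem_sdiff.mp hk).2
        rw [mem_multiIndices] at this; omega
      have h2 : (1 : ℝ) ≤ (1 / 2) ^ (N + 1) * 2 ^ (∑ i, k i) := by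
        calc (1 : ℝ) = (1 / 2) ^ (N + 1) * 2 ^ (N + 1) := by rw [← mul_pow]; norm_num
          _ ≤ _ := by gcongr; norm_num
      calc ‖f k‖ = 1 * ‖f k‖ := (one_mul _).symm
        _ ≤ (1 / 2) ^ (N + 1) * 2 ^ (∑ i, k i) * ‖f k‖ := by gcongr
        _ = _ := mul_assoc _ _ _
    refine (Finset.sum_le_sum h1).trans ?_
    rw [← Finset.mul_sum, mul_comm]
    refine mul_le_mul_of_nonneg_right (le_trans ?_ hfb) (by positivity)
    exact Finset.sum_le_sum_of_subset_of_nonneg Finset.sdiff_subset fun k _ _ => by positivity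
  · rw [Lp.norm_toLp]
    exact ENNReal.toReal_le_of_le_ofReal (by positivity) hRb

end Residual

/-! ### Exponentially small residuals -/

section Exponential

open MeasureTheory Filter Topology

variable {d : ℕ} {V : Space d → ℝ}

/-- Powers of the distance are absorbed into a Gaussian weight, with a gain of `2⁻ⁿ`. -/
theorem pow_le_half_pow_mul_exp {n : ℕ} {b r σ : ℝ} (hr : 0 < r) (hσ : 0 ≤ σ)
    (hn : 16 * n ≤ b * r ^ 2) : (2 * σ / r) ^ n ≤ (1 / 2) ^ n * Real.exp (b * σ ^ 2) := by
  rcases Nat.eq_zero_or_pos n with rfl | hn0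
  · have hb : 0 ≤ b := by
      by_contra hneg
      have := mul_neg_of_neg_of_pos (not_le.mp hneg) (pow_pos hr 2)
      simp at hn; linarith
    simpa using mul_nonneg hb (sq_nonneg σ)
  have hn0' : (0 : ℝ) < n := by exact_mod_cast hn0
  have h1 : 4 * σ / r ≤ Real.exp (b * σ ^ 2 / n) := by
    have h2 : 4 * σ / r ≤ (4 * σ / r) ^ 2 + 1 := by nlinarith [sq_nonneg (4 * σ / r - 1)]
    refine (h2.trans (Real.add_one_le_exp _)).trans (Real.exp_le_exp.mpr ?_)
    rw [div_pow, div_le_div_iff₀ (by positivity) hn0']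
    nlinarith [mul_le_mul_of_nonneg_right hn (sq_nonneg σ)]
  calc (2 * σ / r) ^ n = (1 / 2) ^ n * (4 * σ / r) ^ n := by
        rw [← mul_pow]; congr 1; ring
    _ ≤ (1 / 2) ^ n * Real.exp (b * σ ^ 2 / n) ^ n := by gcongr
    _ = _ := by rw [← Real.exp_nat_mul]; congr 2; field_simp

theorem HasStripContinuation.abs_le_exp {δ M τ b R : ℝ} (hδ : 0 < δ) (hM : 0 < M) (hτ : 0 < τ)
    (hV : HasStripContinuation V δ M τ) {a : Space d} (ha : ‖a‖ ≤ R) (hb : 4 * τ ≤ b) (x : Space d) :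
    |V x| ≤ M * Real.exp (2 * τ * R ^ 2) * Real.exp (b * ‖x - a‖ ^ 2 - b / 2 * ‖x - a‖ ^ 2) := by
  refine (hV.abs_le hδ x).trans ?_
  rw [mul_assoc, ← Real.exp_add]
  refine mul_le_mul_of_nonneg_left (Real.exp_le_exp.mpr ?_) hM.le
  have h1 : ‖x‖ ≤ R + ‖x - a‖ := (norm_le_norm_add_norm_sub' x a).trans (by linarith)
  have h2 : ‖x‖ ^ 2 ≤ 2 * R ^ 2 + 2 * ‖x - a‖ ^ 2 := by
    nlinarith [sq_nonneg (R - ‖x - a‖), norm_nonneg x, norm_nonneg (x - a)]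
  nlinarith [mul_le_mul_of_nonneg_left h2 hτ.le, sq_nonneg ‖x - a‖,
    mul_le_mul_of_nonneg_right hb (sq_nonneg ‖x - a‖)]

/-- The Taylor remainder of `V`, relative to a Gaussian weight: within the disc of convergence it
is bounded by a power of the distance, outside of it the Gaussian weight is already huge. -/
theorem abs_sub_taylor_le {δ M τ b r CV R : ℝ} (hδ : 0 < δ) (hM : 0 < M) (hτ : 0 < τ)
    (hV : HasStripContinuation V δ M τ) (hr : 0 < r) (hCV : 0 < CV) {a : Space d} (ha : ‖a‖ ≤ R)
    (hco : ∀ m, |multiDeriv m V a / multiFactorial m| ≤ CV / r ^ ∑ i, m i)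
    (hrem : ∀ (x : Space d) (N : ℕ) (q : ℝ), 0 ≤ q → q ≤ 1 → (∀ i, |x i - a i| ≤ q * (r / 2)) →
        |V x - ∑ m ∈ multiIndices d N,
          multiDeriv m V a / multiFactorial m * ∏ i, (x i - a i) ^ m i| ≤ CV * q ^ (N + 1))
    {N : ℕ} (hN : 16 * (N + 1 : ℕ) ≤ b * r ^ 2) (hb : 4 * τ ≤ b) (x : Space d) :
    |V x - ∑ m ∈ multiIndices d N,
        multiDeriv m V a / multiFactorial m * ∏ i, (x i - a i) ^ m i|
      ≤ (CV * 2 ^ d * (1 / 2) ^ (N + 1)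
          + M * Real.exp (2 * τ * R ^ 2) * Real.exp (-(b * r ^ 2 / 8)))
        * Real.exp (b * ‖x - a‖ ^ 2) := by
  set σ := ‖x - a‖ with hσ
  have hσ0 : 0 ≤ σ := norm_nonneg _
  have hxi : ∀ i, |x i - a i| ≤ σ := fun i => PiLp.norm_apply_le (x - a) i
  have hpow := pow_le_half_pow_mul_exp (b := b) hr hσ0 hN
  have h2d : (1 : ℝ) ≤ 2 ^ d := one_le_pow₀ one_le_two
  have hq0 : 0 ≤ 2 * σ / r := by positivity
  rw [add_mul]
  rcases le_or_gt (2 * σ / r) 1 with h1 | h1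
  · refine le_trans (hrem x N (2 * σ / r) hq0 h1 fun i => (hxi i).trans_eq (by field_simp)) ?_
    calc CV * (2 * σ / r) ^ (N + 1) ≤ CV * 2 ^ d * (2 * σ / r) ^ (N + 1) := by
          gcongr; exact le_mul_of_one_le_right hCV.le h2d
      _ ≤ CV * 2 ^ d * ((1 / 2) ^ (N + 1) * Real.exp (b * σ ^ 2)) := by gcongr
      _ = CV * 2 ^ d * (1 / 2) ^ (N + 1) * Real.exp (b * σ ^ 2) := by ring
      _ ≤ _ := le_add_of_nonneg_right (by positivity)
  · rw [add_comm]
    refine (abs_sub _ _).trans (add_le_add ?_ ?_)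
    · refine (hV.abs_le_exp hδ hM hτ ha hb x).trans ?_
      rw [mul_assoc (M * Real.exp (2 * τ * R ^ 2)) (Real.exp (-(b * r ^ 2 / 8))), ← Real.exp_add]
      have h3 : r ≤ 2 * σ := by rw [lt_div_iff₀ hr] at h1; linarith
      have h4 : r ^ 2 ≤ 4 * σ ^ 2 := by nlinarith
      have hb0 : 0 < b := by linarith
      gcongr
      nlinarith [mul_le_mul_of_nonneg_left h4 hb0.le]
    · refine (Finset.abs_sum_le_sum_abs _ _).trans ?_
      calc _ ≤ ∑ m ∈ multiIndices d N, CV * (2 * σ / r) ^ (N + 1) * (1 / 2) ^ (∑ i, m i) := by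
            refine Finset.sum_le_sum fun m hm => ?_
            rw [abs_mul, Finset.abs_prod]
            calc _ ≤ CV / r ^ (∑ i, m i) * ∏ i, σ ^ m i := by
                  refine mul_le_mul (hco m) (Finset.prod_le_prod (fun _ _ => abs_nonneg _) fun i _ => ?_)
                    (Finset.prod_nonneg fun _ _ => abs_nonneg _) (by positivity)
                  rw [abs_pow]
                  exact pow_le_pow_left₀ (abs_nonneg _) (hxi i) _
              _ = CV * (2 * σ / r) ^ (∑ i, m i) * (1 / 2) ^ (∑ i, m i) := by
                  rw [Finset.prod_pow_eq_pow_sum, mul_assoc, ← mul_pow,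
                    show 2 * σ / r * (1 / 2) = σ / r by ring, div_pow]
                  ring
              _ ≤ _ := by
                  have := pow_le_pow_right₀ h1.le (Nat.le_succ_of_le (mem_multiIndices.mp hm))
                  gcongr
        _ ≤ CV * (2 * σ / r) ^ (N + 1) * 2 ^ d := by
            rw [← Finset.mul_sum]
            exact mul_le_mul_of_nonneg_left (sum_prod_half_le _) (by positivity)
        _ ≤ CV * ((1 / 2) ^ (N + 1) * Real.exp (b * σ ^ 2)) * 2 ^ d := by gcongr
        _ = _ := by ring

theorem half_pow_floor_le {x : ℝ} : (1 / 2 : ℝ) ^ ⌊x⌋₊ ≤ 2 * Real.exp (-(x / 2)) := by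
  have h1 : x < ⌊x⌋₊ + 1 := Nat.lt_floor_add_one x
  have h2 : (1 / 2 : ℝ) ≤ Real.exp (-(1 / 2)) := by
    have := Real.add_one_le_exp (-(1 / 2 : ℝ))
    linarith
  calc (1 / 2 : ℝ) ^ ⌊x⌋₊ ≤ Real.exp (-(1 / 2)) ^ ⌊x⌋₊ := by gcongr
    _ = Real.exp (-(⌊x⌋₊ / 2)) := by rw [← Real.exp_nat_mul]; congr 1; ring
    _ ≤ Real.exp (1 / 2 + -(x / 2)) := by gcongr; linarith
    _ = Real.exp (1 / 2) * Real.exp (-(x / 2)) := Real.exp_add _ _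
    _ ≤ _ := by
        gcongr
        have := Real.exp_bound_div_one_sub_of_interval (x := 1 / 2) (by norm_num) (by norm_num)
        linarith [show (1 : ℝ) / (1 - 1 / 2) = 2 by norm_num]

end Exponential

/-! ### Comparison with the exact solution -/

section Comparison

open MeasureTheory Filter Topology

variable {d : ℕ} {V : Space d → ℝ} {a η : ℝ → Space d} {A B : ℝ → Matrix (Fin d) (Fin d) ℂ}
  {S : ℝ → ℝ} {s : ℝ → ℂ} {ħ : ℝ} {c₀ : (Fin d → ℕ) → ℂ} {c : ℝ → (Fin d → ℕ) → ℂ} {J l : ℕ}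

/-- The approximation starts from the given initial state. -/
theorem approxSolution_zero (hf : IsClassicalFlow V a η A B S)
    (hsol : IsCoefficientSolution V J l ħ a η A B s c₀ c) (hl : 1 ≤ l) (x : Space d) :
    approxSolution J l ħ a η A B S s c 0 x = ∑ j ∈ multiIndices d J,
      c₀ j * wavePacket (A 0) (B 0) (s 0) ħ (a 0) (η 0) j x := by
  rw [approxSolution, hf.action_zero]
  simp only [Complex.ofReal_zero, mul_zero, zero_div, Complex.exp_zero, one_mul]
  symm
  have hsub : multiIndices d J ⊆ multiIndices d (truncLevel J l) :=
    multiIndices_mono (by unfold truncLevel; omega)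
  refine Finset.sum_subset_zero_on_sdiff hsub (fun j hj => ?_) fun j hj => ?_
  · obtain ⟨h1, h2⟩ := Finset.mem_sdiff.mp hj
    rw [hsol.initial j h1, if_neg (by rwa [mem_multiIndices] at h2), zero_mul]
  · rw [hsol.initial j (hsub hj), if_pos (mem_multiIndices.mp hj)]

theorem exists_bound_of_continuous {E : Type*} [SeminormedAddCommGroup E] {f : ℝ → E}
    (hf : Continuous f) (T : ℝ) : ∃ C, ∀ t, |t| ≤ T → ‖f t‖ ≤ C := by
  obtain ⟨C, hC⟩ := (isCompact_Icc (a := -T) (b := T)).exists_bound_of_continuousOn hf.continuousOn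
  exact ⟨C, fun t ht => hC t (abs_le.mp ht)⟩

theorem IsClassicalFlow.exists_bound_A (hf : IsClassicalFlow V a η A B S) (T : ℝ) :
    ∃ CA, 0 ≤ CA ∧ ∀ t, |t| ≤ T → ∀ n m, ‖A t n m‖ ≤ CA := by
  choose C hC using fun n m => exists_bound_of_continuous (hf.continuous_A n m) T
  refine ⟨∑ n, ∑ m, |C n m|, by positivity, fun t ht n m => ?_⟩
  calc ‖A t n m‖ ≤ |C n m| := (hC n m t ht).trans (le_abs_self _)
    _ ≤ ∑ m, |C n m| := Finset.single_le_sum (f := fun m => |C n m|) (fun _ _ => abs_nonneg _)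
        (Finset.mem_univ m)
    _ ≤ _ := Finset.single_le_sum (f := fun n => ∑ m, |C n m|)
        (fun _ _ => Finset.sum_nonneg fun _ _ => abs_nonneg _) (Finset.mem_univ n)

/-- The distance of the approximation from the exact solution, in terms of the size `W` of the
coefficients, the norm `Ω` of `Z` and the relative Taylor remainder `β`. -/
theorem norm_approx_sub_le (hf : IsClassicalFlow V a η A B S)
    (hadm : ∀ t, Admissible (A t) (B t)) (hV : ContDiff ℝ 2 V) (hs : Continuous s)
    (hs2 : ∀ t, s t ^ 2 = (A t).det) (hħ : 0 < ħ) (hl : 1 ≤ l)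
    (hsol : IsCoefficientSolution V J l ħ a η A B s c₀ c) {Ψ : ℝ → L2 d}
    (hΨ : IsSchrodingerSolution V ħ (fun x => ∑ j ∈ multiIndices d J,
      c₀ j * wavePacket (A 0) (B 0) (s 0) ħ (a 0) (η 0) j x) Ψ)
    {T CA K ν W Ω β CM : ℝ} (hCA : 0 ≤ CA) (hA : ∀ t, |t| ≤ T → ∀ n m, ‖A t n m‖ ≤ CA)
    (hK : d * CA * (1 + 1) ≤ K) (hν : 0 ≤ ν) (hνK : 2 * d * K ^ 2 * ν ≤ 1 / 4)
    (hΩ : 0 ≤ Ω) (hW : weight d J c₀ * Real.exp (Ω / ħ * T) ≤ W) (hβ : 0 ≤ β) (hCM : 0 ≤ CM)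
    (hZ : ∀ t, |t| ≤ T → ∀ p κ, HasSize (A t) ħ 2 p (truncLevel J l) κ →
      HasSize (A t) ħ 2 (tailPoly V l (a t) * p) (truncLevel J l + (l + 1)) (Ω * κ))
    (hrem : ∀ t, |t| ≤ T → ∀ x,
      ‖(V x : ℂ) - (eval (disp (a t) x) (quadPot V (a t)) + (taylorTail V l (a t) x : ℂ))‖
      ≤ β * Real.exp (ν / ħ * ‖x - a t‖ ^ 2))
    (hVb : ∀ t, |t| ≤ T → ∀ x, |V x| ≤ CM * Real.exp (ν / ħ * ‖x - a t‖ ^ 2))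
    {t : ℝ} (ht : |t| ≤ T) :
    eLpNorm (fun x => approxSolution J l ħ a η A B S s c t x - Ψ t x) 2 volume
      ≤ ENNReal.ofReal ((Ω * W * (1 / 2) ^ (truncLevel J l + 1) + β * (2 * W)) / ħ * Real.exp T) := by
  set N := truncLevel J l with hN
  set ε := Ω * W * (1 / 2) ^ (N + 1) + β * (2 * W) with hε
  have hweight : ∀ t, |t| ≤ T → weight d N (c t) ≤ W := by
    intro t ht
    refine (hsol.weight_le hadm hs2 hħ hZ ht).trans (le_trans ?_ hW)
    have h0 : 0 ≤ weight d J c₀ := Finset.sum_nonneg fun k _ => by positivity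
    refine mul_le_mul hsol.weight_zero_le (Real.exp_le_exp.mpr ?_) (Real.exp_pos _).le h0
    exact mul_le_mul_of_nonneg_left ht (by positivity)
  have hsize : ∀ t, |t| ≤ T → HasSize (A t) ħ 2 (approxPoly A S ħ N c t) N W := by
    intro t ht
    refine ((hasSize_sum (A t) ħ N (c t)).smul _).mono le_rfl ?_
    rw [norm_phase, one_mul]
    exact hweight t ht
  have hreg : ∀ t, |t| ≤ T → IsRegular V
      (polyPacket (A t) (B t) (s t) ħ (a t) (η t) (approxPoly A S ħ N c t)) := by
    intro t ht
    refine isRegular_polyPacket (hadm t) hħ (hs2 t) (a t) (η t) _ ⟨?_, ?_⟩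
    · exact ((Complex.continuous_ofReal.comp hV.continuous).mul
        (continuous_polyPacket _ _ _ _ _ _ _)).aestronglyMeasurable
    · refine ((hsize t ht).eLpNorm_mul_le (hadm t) hħ (hs2 t) (a t) (η t) hCA (hA t ht) hK hν hνK hCM
        (f := fun x => (V x : ℂ)) fun x => ?_).trans_lt ENNReal.ofReal_lt_top
      rw [Complex.norm_real]
      exact hVb t ht x
  have hW0 : 0 ≤ W := (mul_nonneg (Finset.sum_nonneg fun k _ => by positivity)
    (Real.exp_pos _).le).trans hW
  have hε0 : 0 ≤ ε := by positivity
  set c' : ℝ → (Fin d → ℕ) → ℂ := fun t k => ∑ j ∈ multiIndices d N,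
    couplingMatrix V l (A t) (B t) (s t) ħ (a t) (η t) k j * c t j with hc'
  set ψ : ℝ → L2 d := fun r =>
    packetL2 (hadm r) hħ (hs2 r) (a r) (η r) (approxPoly A S ħ N c r) with hψ
  have hcoe : ∀ t, ψ t =ᵐ[volume] approxSolution J l ħ a η A B S s c t := by
    intro t
    rw [approxSolution_eq_polyPacket hadm hħ]
    exact coeFn_packetL2 (hadm t) hħ (hs2 t) (a t) (η t) _
  have hT : 0 ≤ T := (abs_nonneg t).trans ht
  have hmain := norm_sub_sq_le_of_residual (ψ := ψ) (ε := ε) (T := T)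
    (ψ' := fun t => (Complex.I * (ħ : ℂ))⁻¹ • packetL2 (hadm t) hħ (hs2 t) (a t) (η t)
        (quadHam V (B t * (A t)⁻¹) ħ (a t) (η t) (approxPoly A S ħ N c t)
          + approxPoly A S ħ N c' t))
    (ζ := fun t => if ht : |t| ≤ T then packetL2 (hadm t) hħ (hs2 t) (a t) (η t)
        (quadHam V (B t * (A t)⁻¹) ħ (a t) (η t) (approxPoly A S ħ N c t)
          + approxPoly A S ħ N c' t) - ((hreg t ht).memLp_schrodinger ħ).toLp else 0)
    hV.continuous hħ hΨ hreg (fun _ _ => rfl)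
    (fun t => hf.hasDerivAt_approx hadm hV hs hs2 hħ (fun t k hk => hsol.ode t k hk) t)
    (fun t ht => by rw [dif_pos ht, add_sub_cancel]) ?_ (fun t ht => ?_) ht
  · have hnorm : ‖ψ t - Ψ t‖ ≤ ε / ħ * Real.exp T := by
      refine le_of_sq_le_sq (hmain.trans ?_) (by positivity)
      rw [mul_pow]
      refine mul_le_mul_of_nonneg_left ?_ (by positivity)
      have h1 : Real.exp |t| ≤ Real.exp T := Real.exp_le_exp.mpr ht
      have h2 : (1 : ℝ) ≤ Real.exp T := Real.one_le_exp hT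
      nlinarith
    calc _ = eLpNorm (ψ t - Ψ t : L2 d) 2 volume := by
          refine eLpNorm_congr_ae ?_
          filter_upwards [hcoe t, Lp.coeFn_sub (ψ t) (Ψ t)] with x h1 h2
          rw [h2, Pi.sub_apply, h1]
      _ = ENNReal.ofReal ‖ψ t - Ψ t‖ := by
          rw [Lp.norm_def, ENNReal.ofReal_toReal (Lp.eLpNorm_ne_top _)]
      _ ≤ _ := ENNReal.ofReal_le_ofReal hnorm
  · refine Lp.ext ((hcoe 0).trans ?_)
    refine EventuallyEq.trans ?_ hΨ.initial.symm
    exact Eventually.of_forall fun x => approxSolution_zero hf hsol hl x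
  · rw [dif_pos ht]
    exact norm_residual_le hadm hs2 hħ (fun k _ => rfl) hCA (hA t ht) hK hν hνK (hweight t ht) hβ
      ((hZ t ht _ _ (hasSize_sum (A t) ħ N (c t))).mono le_rfl
        (mul_le_mul_of_nonneg_left (hweight t ht) hΩ)) (hrem t ht) (hreg t ht)

end Comparison

end Hagedorn

theorem theorem1p1 (d : ℕ) (V : Hagedorn.Space d → ℝ)
    (hVbelow : ∃ b : ℝ, ∀ x, b ≤ V x)
    (δ M τ : ℝ) (hδ : 0 < δ) (hM : 0 < M) (hτ : 0 < τ)
    (hVan : Hagedorn.HasStripContinuation V δ M τ)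
    (J : ℕ) (c₀ : (Fin d → ℕ) → ℂ)
    (hc₀ : ∑ j ∈ Hagedorn.multiIndices d J, ‖c₀ j‖ ^ 2 = 1)
    (a η : ℝ → Hagedorn.Space d) (A B : ℝ → Matrix (Fin d) (Fin d) ℂ) (S : ℝ → ℝ)
    (hflow : Hagedorn.IsClassicalFlow V a η A B S)
    (hadm : Hagedorn.Admissible (A 0) (B 0))
    -- a continuous branch of the square root of `det A(t)`
    (s : ℝ → ℂ) (hs : Continuous s) (hs2 : ∀ t, s t ^ 2 = (A t).det)
    (T : ℝ) (hT : 0 < T) :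
    ∃ gstar : ℝ, 0 < gstar ∧ ∀ g : ℝ, 0 < g → g < gstar →
      ∃ C γ : ℝ, 0 < C ∧ 0 < γ ∧
        ∀ ħ : ℝ, 0 < ħ → ħ ≤ g →
        ∀ c : ℝ → (Fin d → ℕ) → ℂ,
          Hagedorn.IsCoefficientSolution V J ⌊g / ħ⌋₊ ħ a η A B s c₀ c →
        ∀ Ψ : ℝ → Hagedorn.L2 d,
          Hagedorn.IsSchrodingerSolution V ħ
            (fun x => ∑ j ∈ Hagedorn.multiIndices d J,
              c₀ j * Hagedorn.wavePacket (A 0) (B 0) (s 0) ħ (a 0) (η 0) j x) Ψ →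
        ∀ t : ℝ, |t| ≤ T →
          MeasureTheory.eLpNorm
            (fun x => Hagedorn.approxSolution J ⌊g / ħ⌋₊ ħ a η A B S s c t x - Ψ t x)
            2 MeasureTheory.volume ≤ ENNReal.ofReal (C * Real.exp (-γ / ħ)) := by
  have hV := hVan.contDiff hδ
  have hadmt : ∀ t, Hagedorn.Admissible (A t) (B t) := hflow.admissible hV hadm
  obtain ⟨R, hR⟩ := Hagedorn.exists_bound_of_continuous hflow.continuous_position T
  obtain ⟨CA, hCA, hA⟩ := hflow.exists_bound_A T
  obtain ⟨CV, r, hCV, hr, htaylor⟩ := hVan.exists_taylor hδ hM hτ R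
  -- a coordinate costs `K √(ħ · degree)`; the factor `3` is `θ + 1` with `θ = 2`
  set K : ℝ := 3 * d * CA + 1 with hK
  have hdCA : 0 ≤ d * CA := by positivity
  have hK0 : 0 < K := by positivity
  -- small enough for multiplication by `exp (ν |x - a|² / ħ)` to be bounded on wave packets
  set ν : ℝ := 1 / (8 * (d + 1) * K ^ 2) with hν
  have hν0 : 0 < ν := by positivity
  have hνK : 2 * d * K ^ 2 * ν ≤ 1 / 4 := by
    rw [hν, mul_one_div, div_le_div_iff₀ (by positivity) (by norm_num)]
    linarith [sq_nonneg K]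
  set D : ℝ := CV * 2 ^ d * 8 * K ^ 2 * (J + 4) / r ^ 2 with hD
  have hD0 : 0 < D := by positivity
  set ρ₀ : ℝ := min (1 / 2) (1 / (4 * D * T)) with hρ₀
  have hρ₀0 : 0 < ρ₀ := by positivity
  set W₀ : ℝ := Hagedorn.weight d J c₀ with hW₀
  have hW₀0 : 0 ≤ W₀ := Finset.sum_nonneg fun k _ => by positivity
  set M' : ℝ := M * Real.exp (2 * τ * R ^ 2) with hM'
  have hM'0 : 0 < M' := by positivity
  -- the three bounds on `g` serve the growth of the coefficients, the Taylor remainder near `a(t)`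
  -- and the growth of `V` at infinity
  refine ⟨min ((ρ₀ * r / K) ^ 2 / (J + 4)) (min (ν * r ^ 2 / 48) (ν / (4 * τ))), by positivity,
    fun g hg hglt => ?_⟩
  obtain ⟨hg1, hg2, hg3⟩ : g < (ρ₀ * r / K) ^ 2 / (J + 4) ∧ g < ν * r ^ 2 / 48 ∧ g < ν / (4 * τ) := by
    simpa only [lt_min_iff] using hglt
  set ρ : ℝ := K * √(g * (J + 4)) / r with hρ
  have hρ0 : 0 ≤ ρ := by positivity
  have hρle : ρ ≤ ρ₀ := by
    rw [lt_div_iff₀ (by positivity)] at hg1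
    have h1 : √(g * (J + 4)) ≤ ρ₀ * r / K := Real.sqrt_le_iff.mpr ⟨by positivity, hg1.le⟩
    rw [le_div_iff₀ hK0] at h1
    rw [hρ, div_le_iff₀ hr]
    linarith
  have hρ2 : 2 * ρ ≤ 1 := by linarith [min_le_left (1 / 2 : ℝ) (1 / (4 * D * T))]
  set Ω : ℝ := CV * 2 ^ d * (2 * ρ) ^ 3 with hΩ
  have hΩ0 : 0 ≤ Ω := by positivity
  -- `Z` is of order `g ρ`, and `ρ` tends to zero with `g`
  have hΩT : Ω * T ≤ g / 4 := by
    have h1 : ρ ^ 2 = K ^ 2 * (g * (J + 4)) / r ^ 2 := by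
      rw [hρ, div_pow, mul_pow, Real.sq_sqrt (by positivity)]
    have h2 : Ω = g * (D * ρ) := by
      rw [hΩ, mul_pow, pow_succ ρ, h1, hD]
      ring
    have h3 : ρ * (4 * D * T) ≤ 1 := by
      rw [← le_div_iff₀ (by positivity)]
      exact hρle.trans (min_le_right _ _)
    rw [h2]
    linarith [mul_le_mul_of_nonneg_left h3 hg.le]
  set C₁ : ℝ := W₀ * (2 * Ω + 4 * (CV * 2 ^ d) + 2 * M') with hC₁
  have hC₁0 : 0 ≤ C₁ := by positivity
  refine ⟨C₁ * (8 / g) * Real.exp T + 1, g / 8, by positivity, by positivity,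
    fun ħ hħ hħg c hsol Ψ hΨ t ht => ?_⟩
  set l : ℕ := ⌊g / ħ⌋₊ with hl
  have hl1 : 1 ≤ l := Nat.one_le_floor_iff _ |>.mpr ((one_le_div hħ).mpr hħg)
  have hlħ : ħ * l ≤ g := by
    have := Nat.floor_le (div_pos hg hħ).le
    rw [le_div_iff₀ hħ] at this
    linarith
  set E : ℝ := Real.exp (-(g / ħ / 2)) with hE
  have hhalf : (1 / 2 : ℝ) ^ l ≤ 2 * E := Hagedorn.half_pow_floor_le
  have hb : 4 * τ ≤ ν / ħ := by
    rw [lt_div_iff₀ (by positivity)] at hg3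
    rw [le_div_iff₀ hħ]
    linarith [mul_le_mul_of_nonneg_right hħg (by positivity : 0 ≤ 4 * τ)]
  have hN : 16 * ((l + 1 + 1 : ℕ) : ℝ) ≤ ν / ħ * r ^ 2 := by
    rw [div_mul_eq_mul_div, le_div_iff₀ hħ]
    push_cast
    linarith
  set β : ℝ := CV * 2 ^ d * (1 / 2) ^ (l + 1 + 1) + M' * Real.exp (-(ν / ħ * r ^ 2 / 8)) with hβ
  have hβ0 : 0 ≤ β := by positivity
  have hβle : β ≤ (2 * (CV * 2 ^ d) + M') * E := by
    have h1 : (1 / 2 : ℝ) ^ (l + 1 + 1) ≤ 2 * E :=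
      (pow_le_pow_of_le_one (by norm_num) (by norm_num) (by omega)).trans hhalf
    have h2 : Real.exp (-(ν / ħ * r ^ 2 / 8)) ≤ E := by
      refine Real.exp_le_exp.mpr (neg_le_neg ?_)
      rw [div_mul_eq_mul_div, div_div, div_div, div_le_div_iff₀ (by positivity) (by positivity)]
      linarith [mul_le_mul_of_nonneg_right hg2.le hħ.le, mul_pos hg hħ]
    calc β ≤ CV * 2 ^ d * (2 * E) + M' * E := by rw [hβ]; gcongr
      _ = _ := by ring
  have hest := Hagedorn.norm_approx_sub_le (β := β) (CM := M') (W := W₀ * Real.exp (g / ħ / 4))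
    hflow hadmt hV hs hs2 hħ hl1 hsol hΨ hCA hA (by linarith) hν0.le hνK hΩ0 ?_ hβ0 hM'0.le
    ?_ ?_ ?_ ht
  · refine hest.trans (ENNReal.ofReal_le_ofReal ?_)
    have hhalf' : (1 / 2 : ℝ) ^ (Hagedorn.truncLevel J l + 1) ≤ 2 * E :=
      (pow_le_pow_of_le_one (by norm_num) (by norm_num)
        (by unfold Hagedorn.truncLevel; omega)).trans hhalf
    have hexp : Real.exp (g / ħ / 4) * E = Real.exp (-(g / ħ / 8)) * Real.exp (-(g / ħ / 8)) := by
      rw [hE, ← Real.exp_add, ← Real.exp_add]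
      congr 1
      ring
    -- half of the exponential decay absorbs the factor `1 / ħ`
    have hinv : Real.exp (-(g / ħ / 8)) / ħ ≤ 8 / g := by
      have h1 : g / ħ / 8 ≤ Real.exp (g / ħ / 8) := by linarith [Real.add_one_le_exp (g / ħ / 8)]
      rw [Real.exp_neg, inv_eq_one_div, div_div, div_le_div_iff₀ (by positivity) hg]
      have h2 : g / ħ / 8 * (8 * ħ) = g := by field_simp
      linarith [mul_le_mul_of_nonneg_right h1 (by positivity : 0 ≤ 8 * ħ)]
    have hγ : Real.exp (-(g / 8) / ħ) = Real.exp (-(g / ħ / 8)) := by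
      congr 1
      ring
    rw [hγ]
    set F := Real.exp (-(g / ħ / 8)) with hF
    calc _ ≤ (Ω * (W₀ * Real.exp (g / ħ / 4)) * (2 * E)
            + (2 * (CV * 2 ^ d) + M') * E * (2 * (W₀ * Real.exp (g / ħ / 4)))) / ħ * Real.exp T := by
          gcongr
      _ = C₁ * (Real.exp (g / ħ / 4) * E) / ħ * Real.exp T := by rw [hC₁]; ring
      _ = C₁ * (F / ħ) * Real.exp T * F := by rw [hexp]; ring
      _ ≤ C₁ * (8 / g) * Real.exp T * F := by gcongr
      _ ≤ _ := by gcongr; linarith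
  · gcongr
    rw [div_mul_eq_mul_div, div_right_comm]
    gcongr
  · intro t ht p κ hp
    refine hp.tailPoly_mul (K := K) (hadmt t) hħ one_le_two hCA (hA t ht) (by linarith) hr hCV.le
      (htaylor (a t) (hR t ht)).1 hρ2 ?_
    rw [hρ, div_mul_cancel₀ _ hr.ne']
    refine mul_le_mul_of_nonneg_left (Real.sqrt_le_sqrt ?_) hK0.le
    have h1 : (((Hagedorn.truncLevel J l : ℕ) : ℝ) + ((l + 1 : ℕ) : ℝ)) ≤ J + 4 * l := by
      exact_mod_cast (by unfold Hagedorn.truncLevel; omega)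
    calc _ ≤ ħ * (J + 4 * l) := by gcongr
      _ = ħ * J + 4 * (ħ * l) := by ring
      _ ≤ g * J + 4 * g := by gcongr
      _ = g * (J + 4) := by ring
  · intro t ht x
    obtain ⟨h1, h2⟩ := htaylor (a t) (hR t ht)
    rw [← Hagedorn.sum_multiIndices_eq_quadPot_add_taylorTail hV (half_pos hr)
      (fun x q hq0 hq1 hx => h2 x 2 q hq0 hq1 hx) hl1, ← Complex.ofReal_sub, Complex.norm_real]
    exact Hagedorn.abs_sub_taylor_le hδ hM hτ hVan hr hCV (hR t ht) h1 h2 hN hb x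
  · intro t ht x
    refine (hVan.abs_le_exp hδ hM hτ (hR t ht) hb x).trans ?_
    gcongr
    exact sub_le_self _ (by positivity)
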